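/- Consider a word RAM with words of $w$ bits whose storage consists of a constant number $k$ of words (registers) and of a sequence $S$ of $n$ elements at positions $0,\dots,n-1$. Each element consists of a key, which is one word, and of an arbitrary datum. Each of the following instructions has unit cost: loading a constant or copying a register; addition and subtraction modulo $2^w$, bitwise AND and OR, and unrestricted left and right shifts on registers; reading or overwriting the key of the element at the position given by a register; exchanging the elements (keys and data) at two positions given by registers; jumps, unconditional or depending on whether the content of one register is less than, or equal to, that of another. Data can be moved only by exchanges of elements; they can be neither inspected nor copied. Initially one register contains $n$ and the others contain $0$. For every real constant $c>0$ there are constants $k$ and $K$ and a program for this machine with $k$ registers, all depending only on $c$, such that the following holds for all integers $n\ge 0$ and $w\ge 0$ with $n<2^w$ (in particular for words of $O(\log n)$ bits, where both $n$ and the keys fit into one word). If the input is any sequence $S$ of $n$ elements whose keys are integers in $[1,n^c]$ that fit into a word of $w$ bits, then the program halts after at most $K(n+1)$ steps, and at that time the sequence is the result of sorting $S$ stably by key: it is a rearrangement of the original elements (original keys and data) with keys in non-decreasing order, in which elements with equal keys appear in the same order as in $S$. Thus $n$ integer keys in $[1,n^c]$ can be sorted stably in $O(n)$ time using only $O(1)$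 extra words, if the keys may be modified during the computation. -/

import Mathlib

/-! A word RAM whose only storage is a fixed number `k` of words (the registers) and the
sequence of `n` elements that has to be sorted.  A word has `w` bits.  An element carries a key,
which is one word, and a datum of an arbitrary type `α`.  The machine can read and overwrite the
key of an element and can exchange two elements; it can neither inspect, copy nor create data. -/

namespace InPlaceSort

/-- An element of the sequence: a key of `w` bits together with the datum it belongs to. -/
structure Elem (w : ℕ) (α : Type*) where
  key : BitVec w
  data : α

/-- The instructions of a machine with `k` registers.  Each has unit cost.  Operands of type
`Fin k` are register numbers, `target` is the position of an instruction in the program, and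
positions in the sequence are addressed indirectly, through the content of a register. -/
inductive Instr (k : ℕ) where
  | const (dst : Fin k) (v : ℕ)
  | move (dst src : Fin k)
  | add (dst a b : Fin k)
  | sub (dst a b : Fin k)
  | bitAnd (dst a b : Fin k)
  | bitOr (dst a b : Fin k)
  | shiftLeft (dst a b : Fin k)
  | shiftRight (dst a b : Fin k)
  | readKey (dst idx : Fin k)
  | writeKey (idx src : Fin k)
  | exchange (idx₁ idx₂ : Fin k)
  | jump (target : ℕ)
  | jumpLt (a b : Fin k) (target : ℕ)
  | jumpEq (a b : Fin k) (target : ℕ)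

/-- A program is a finite list of instructions.  It does not mention the number of elements, the
word length or the type of the data. -/
abbrev Program (k : ℕ) := List (Instr k)

/-- A state of the machine: program counter, registers, and the sequence of elements
(at positions `0, …, n - 1`). -/
structure State (k w n : ℕ) (α : Type*) where
  pc : ℕ
  reg : Fin k → BitVec w
  seq : Fin n → Elem w α

variable {k w n : ℕ} {α : Type*}

/-- Go to the next instruction after storing `v` in register `dst`. -/
def State.store (s : State k w n α) (dst : Fin k) (v : BitVec w) : State k w n α :=
  { s with pc := s.pc + 1, reg := Function.update s.reg dst v }

/-- Execution of one instruction.  Arithmetic is modulo `2 ^ w`, and words are compared as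
unsigned numbers.  An instruction that addresses a position outside of the sequence leaves the
state unchanged, so that the machine stays at this instruction for ever and never halts. -/
def exec (s : State k w n α) : Instr k → State k w n α
  | .const dst v => s.store dst (BitVec.ofNat w v)
  | .move dst src => s.store dst (s.reg src)
  | .add dst a b => s.store dst (s.reg a + s.reg b)
  | .sub dst a b => s.store dst (s.reg a - s.reg b)
  | .bitAnd dst a b => s.store dst (s.reg a &&& s.reg b)
  | .bitOr dst a b => s.store dst (s.reg a ||| s.reg b)
  | .shiftLeft dst a b => s.store dst (s.reg a <<< (s.reg b).toNat)
  | .shiftRight dst a b => s.store dst (s.reg a >>> (s.reg b).toNat)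
  | .readKey dst idx =>
      if h : (s.reg idx).toNat < n then s.store dst (s.seq ⟨(s.reg idx).toNat, h⟩).key else s
  | .writeKey idx src =>
      if h : (s.reg idx).toNat < n then
        { s with
          pc := s.pc + 1
          seq := Function.update s.seq ⟨(s.reg idx).toNat, h⟩
            { key := s.reg src, data := (s.seq ⟨(s.reg idx).toNat, h⟩).data } }
      else s
  | .exchange idx₁ idx₂ =>
      if h : (s.reg idx₁).toNat < n ∧ (s.reg idx₂).toNat < n then
        { s with
          pc := s.pc + 1
          seq := s.seq ∘ Equiv.swap ⟨(s.reg idx₁).toNat, h.1⟩ ⟨(s.reg idx₂).toNat, h.2⟩ }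
      else s
  | .jump target => { s with pc := target }
  | .jumpLt a b target =>
      { s with pc := if (s.reg a).toNat < (s.reg b).toNat then target else s.pc + 1 }
  | .jumpEq a b target =>
      { s with pc := if s.reg a = s.reg b then target else s.pc + 1 }

/-- The machine has halted when the program counter has left the program. -/
def Halted (P : Program k) (s : State k w n α) : Prop :=
  P.length ≤ s.pc

/-- One step of the machine; a halted machine does not change any more. -/
def step (P : Program k) (s : State k w n α) : State k w n α :=
  match P[s.pc]? with
  | none => s
  | some i => exec s i

/-- The initial state: register `0` holds the number `n` of elements, every other register is
zero, and the sequence is the input. -/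
def init (k : ℕ) (S : Fin n → Elem w α) : State k w n α where
  pc := 0
  reg := fun r => if r.val = 0 then BitVec.ofNat w n else 0
  seq := S

/-- The state after `t` steps on the input `S`. -/
def run (P : Program k) (S : Fin n → Elem w α) (t : ℕ) : State k w n α :=
  (step P)^[t] (init k S)

/-- `T` is the result of sorting `S` stably by key: `T` is a rearrangement of the elements of `S`
(keys and data), the keys are in non-decreasing order, and elements with equal keys are in the
same order in `T` as in `S`. -/
def IsStableSort (S T : Fin n → Elem w α) : Prop :=
  ∃ σ : Equiv.Perm (Fin n),
    (∀ i, T i = S (σ i)) ∧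
    (∀ i j, i < j → (T i).key.toNat ≤ (T j).key.toNat) ∧
    (∀ i j, i < j → (T i).key = (T j).key → σ i < σ j)

end InPlaceSort

/-!
The program keeps a sorted prefix of `m` elements and extends it in rounds.  A round appends a
chunk of about `m / 2 ^ (θ + 4)` elements, with `θ` depending on the exponent `c` only, and takes
`O(m)` time; so its time is proportional to the size of the chunk, and all rounds together take
`O(n)` time.

The memory for a round comes from the keys of the prefix.  A key of `lob + q + 1` significant bits
is split into a top bit, a cell of `q` bits and a low field.  The prefix is sorted, so that its
keys decompose into at most `2 ^ (q + 1)` runs with equal cell.  `compress_spec` lets the top bit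
of every word say whether a run ends there, and lists the cells of the runs in the cells of the
first `base = 2 ^ (q + 1)` words; the original top bits are determined by the number of keys whose
top bit is `0`.  All other cells of the prefix are now free.  As `q` is about a quarter of the
number of bits of `n`, a constant number `2 ^ θ` of cells can hold a key or a position: they form a
*virtual word*, and there are seven arrays of `D = 2 ^ e` virtual words (`Sizes`, `Cfg.arr`).

In this memory the indices of the chunk elements are sorted by a least-significant-digit radix
sort with digits of `q` bits, in a constant number of passes (`radix_spec`).  Then prefix and chunk
are merged from right to left (`wp_mergeBody`, `merge_spec`).  Data can only be exchanged, so the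
remaining chunk elements occupy, in an arbitrary order, the positions between the remaining prefix
and the final elements; the tables `loc` and `who` keep track of them (`Window.shift`,
`Window.drop`).  The keys of the merged list are written in compressed form at once, because the
cells of their words belong to the memory; its list of runs is collected in an array of its own,
moved to the front (`copyRuns_spec`), and finally all keys are restored (`decode_spec`).  The merge
compares elements by key and then by position, and all chunk elements come after all prefix
elements in the input, so the result is stable (`Prefix.extend`).

The first prefix has `2 ^ (2 * q) = O(√n)` elements and is sorted by insertion
(`firstPrefix_spec`); short sequences are sorted by insertion altogether.

The program is written in a small structured language with unbounded natural numbers, whose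
semantics (`Big`) demands that no overflow occurs; `Big.run` says that its translation to machine
code behaves in the same way.  Time bounds and functional correctness are proved together, as
statements `Spec`, for which `Wp`, `Spec.for_up`, `Spec.for_down` and `Spec.loop_time` are the
proof rules.
-/

set_option linter.constructorNameAsVariable false

namespace InPlaceSort

/-! ### A structured language over named variables -/

/-- The program variables.  Each of them is kept in a register of its own. -/
inductive Var
  | n | len | q | lob | bq | half | base | m | d | D | e | b | i | j | t | r | z | z' | cu | pu | hp
  | x | y | u | f | g | c | acc | sh | pk | sel | src | jj | tmp | adr | val | r' | u' | mx
  deriving DecidableEq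

/-- Arithmetic expressions.  `low a b` stands for `a` modulo `2 ^ b`, that is, the low `b` bits
of `a`. -/
inductive Ex
  | var (x : Var)
  | lit (v : ℕ)
  | add (a b : Ex)
  | sub (a b : Ex)
  | shl (a b : Ex)
  | shr (a b : Ex)
  | low (a b : Ex)

instance : Coe Var Ex := ⟨Ex.var⟩
instance (v : ℕ) : OfNat Ex v := ⟨Ex.lit v⟩
instance : Add Ex := ⟨Ex.add⟩
instance : Sub Ex := ⟨Ex.sub⟩
instance : HShiftLeft Ex Ex Ex := ⟨Ex.shl⟩
instance : HShiftRight Ex Ex Ex := ⟨Ex.shr⟩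

/-- The value of an expression, as an unbounded natural number. -/
def Ex.eval (r : Var → ℕ) : Ex → ℕ
  | .var x => r x
  | .lit v => v
  | .add a b => a.eval r + b.eval r
  | .sub a b => a.eval r - b.eval r
  | .shl a b => a.eval r * 2 ^ b.eval r
  | .shr a b => a.eval r / 2 ^ b.eval r
  | .low a b => a.eval r % 2 ^ b.eval r

/-- No overflow or underflow occurs when the expression is computed with words of `w` bits, so
that the machine computes `Ex.eval`. -/
def Ex.Ok (w : ℕ) (r : Var → ℕ) : Ex → Prop
  | .var _ => True
  | .lit v => v < 2 ^ w
  | .add a b => a.Ok w r ∧ b.Ok w r ∧ a.eval r + b.eval r < 2 ^ w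
  | .sub a b => a.Ok w r ∧ b.Ok w r ∧ b.eval r ≤ a.eval r
  | .shl a b => a.Ok w r ∧ b.Ok w r ∧ a.eval r * 2 ^ b.eval r < 2 ^ w
  | .shr a b => a.Ok w r ∧ b.Ok w r
  | .low a b => a.Ok w r ∧ b.Ok w r

section ExSimp
variable (r : Var → ℕ) (w : ℕ) (a b : Ex)
@[simp] theorem Ex.eval_var (x : Var) : (Ex.var x).eval r = r x := rfl
@[simp] theorem Ex.eval_zero : (0 : Ex).eval r = 0 := rfl
@[simp] theorem Ex.eval_one : (1 : Ex).eval r = 1 := rfl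
@[simp] theorem Ex.eval_lit (v : ℕ) : (Ex.lit v).eval r = v := rfl
@[simp] theorem Ex.eval_add : (a + b).eval r = a.eval r + b.eval r := rfl
@[simp] theorem Ex.eval_sub : (a - b).eval r = a.eval r - b.eval r := rfl
@[simp] theorem Ex.eval_shl : (a <<< b).eval r = a.eval r * 2 ^ b.eval r := rfl
@[simp] theorem Ex.eval_shr : (a >>> b).eval r = a.eval r / 2 ^ b.eval r := rfl
@[simp] theorem Ex.eval_low : (Ex.low a b).eval r = a.eval r % 2 ^ b.eval r := rfl
@[simp] theorem Ex.ok_var (x : Var) : (Ex.var x).Ok w r := trivial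
@[simp] theorem Ex.ok_zero : (0 : Ex).Ok w r := Nat.two_pow_pos w
@[simp] theorem Ex.ok_one : (1 : Ex).Ok w r ↔ 0 < w :=
  (Nat.one_lt_two_pow_iff (n := w)).trans Nat.pos_iff_ne_zero.symm
@[simp] theorem Ex.ok_lit (v : ℕ) : (Ex.lit v).Ok w r ↔ v < 2 ^ w := Iff.rfl
@[simp] theorem Ex.ok_add :
    (a + b).Ok w r ↔ a.Ok w r ∧ b.Ok w r ∧ a.eval r + b.eval r < 2 ^ w := Iff.rfl
@[simp] theorem Ex.ok_sub :
    (a - b).Ok w r ↔ a.Ok w r ∧ b.Ok w r ∧ b.eval r ≤ a.eval r := Iff.rfl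
@[simp] theorem Ex.ok_shl :
    (a <<< b).Ok w r ↔ a.Ok w r ∧ b.Ok w r ∧ a.eval r * 2 ^ b.eval r < 2 ^ w := Iff.rfl
@[simp] theorem Ex.ok_shr : (a >>> b).Ok w r ↔ a.Ok w r ∧ b.Ok w r := Iff.rfl
@[simp] theorem Ex.ok_low : (Ex.low a b).Ok w r ↔ a.Ok w r ∧ b.Ok w r := Iff.rfl
end ExSimp

/-- Tests of conditional commands and loops. -/
inductive Cond
  | lt (a b : Ex)
  | eq (a b : Ex)

/-- The truth value of a test. -/
def Cond.holds (r : Var → ℕ) : Cond → Prop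
  | .lt a b => a.eval r < b.eval r
  | .eq a b => a.eval r = b.eval r

/-- No overflow occurs in the evaluation of a test. -/
def Cond.Ok (w : ℕ) (r : Var → ℕ) : Cond → Prop
  | .lt a b => a.Ok w r ∧ b.Ok w r
  | .eq a b => a.Ok w r ∧ b.Ok w r

@[simp] theorem Cond.holds_lt (r : Var → ℕ) (a b : Ex) :
    (Cond.lt a b).holds r ↔ a.eval r < b.eval r := Iff.rfl
@[simp] theorem Cond.holds_eq (r : Var → ℕ) (a b : Ex) :
    (Cond.eq a b).holds r ↔ a.eval r = b.eval r := Iff.rfl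
@[simp] theorem Cond.ok_lt (w : ℕ) (r : Var → ℕ) (a b : Ex) :
    (Cond.lt a b).Ok w r ↔ a.Ok w r ∧ b.Ok w r := Iff.rfl
@[simp] theorem Cond.ok_eq (w : ℕ) (r : Var → ℕ) (a b : Ex) :
    (Cond.eq a b).Ok w r ↔ a.Ok w r ∧ b.Ok w r := Iff.rfl

/-- Commands. -/
inductive Com
  | skip
  | asg (x : Var) (e : Ex)
  | read (x : Var) (a : Ex)
  | write (a e : Ex)
  | exch (a b : Ex)
  | seq (c d : Com)
  | ite (p : Cond) (c d : Com)
  | loop (p : Cond) (c : Com)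

prefix:max "♯" => Ex.var
infixr:60 " ;; " => Com.seq
infix:61 " ≔ " => Com.asg

/-- A state of the structured language: the values of the variables, the keys by position, and
for every position the original position of the datum that it holds now. -/
@[ext] structure St where
  r : Var → ℕ
  key : ℕ → ℕ
  id : ℕ → ℕ

/-- Assignment to a variable. -/
def St.set (s : St) (x : Var) (v : ℕ) : St := { s with r := Function.update s.r x v }

/-- Replacement of all keys. -/
def St.setKey (s : St) (κ : ℕ → ℕ) : St := { s with key := κ }

/-- Replacement of the arrangement of the data. -/
def St.setId (s : St) (ι : ℕ → ℕ) : St := { s with id := ι }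

section StSimp
variable (s : St) (x y : Var) (v : ℕ) (κ : ℕ → ℕ)
@[simp] theorem St.set_r : (s.set x v).r y = if y = x then v else s.r y := by
  simp [St.set, Function.update_apply]
@[simp] theorem St.set_key : (s.set x v).key = s.key := rfl
@[simp] theorem St.set_id : (s.set x v).id = s.id := rfl
@[simp] theorem St.setKey_r : (s.setKey κ).r = s.r := rfl
@[simp] theorem St.setKey_key : (s.setKey κ).key = κ := rfl
@[simp] theorem St.setKey_id : (s.setKey κ).id = s.id := rfl
@[simp] theorem St.setId_r : (s.setId κ).r = s.r := rfl
@[simp] theorem St.setId_key : (s.setId κ).key = s.key := rfl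
@[simp] theorem St.setId_id : (s.setId κ).id = κ := rfl
end StSimp

/-- The number of machine instructions that compute an expression. -/
def Ex.len : Ex → ℕ
  | .var _ => 1
  | .lit _ => 1
  | .add a b => a.len + b.len + 1
  | .sub a b => a.len + b.len + 1
  | .shl a b => a.len + b.len + 1
  | .shr a b => a.len + b.len + 1
  | .low a b => a.len + b.len + 3

/-- The number of machine instructions that evaluate the operands of a test. -/
def Cond.len : Cond → ℕ
  | .lt a b => a.len + b.len
  | .eq a b => a.len + b.len

/-- Big-step semantics: `Big w n c s t s'` says that the command `c`, started in `s` on a machine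
with words of `w` bits and `n` elements, ends in `s'` after `t` machine instructions, without
overflow and without addressing a position outside of the sequence. -/
inductive Big (w n : ℕ) : Com → St → ℕ → St → Prop
  | skip (s) : Big w n .skip s 0 s
  | asg (s x) (e : Ex) (h : e.Ok w s.r) :
      Big w n (.asg x e) s (e.len + 1) (s.set x (e.eval s.r))
  | read (s x) (a : Ex) (h : a.Ok w s.r) (hn : a.eval s.r < n) :
      Big w n (.read x a) s (a.len + 1) (s.set x (s.key (a.eval s.r)))
  | write (s) (a e : Ex) (h : a.Ok w s.r) (h' : e.Ok w s.r) (hn : a.eval s.r < n) :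
      Big w n (.write a e) s (a.len + e.len + 1)
        (s.setKey (Function.update s.key (a.eval s.r) (e.eval s.r)))
  | exch (s) (a b : Ex) (h : a.Ok w s.r) (h' : b.Ok w s.r) (hn : a.eval s.r < n)
      (hn' : b.eval s.r < n) :
      Big w n (.exch a b) s (a.len + b.len + 1)
        ((s.setKey (s.key ∘ Equiv.swap (a.eval s.r) (b.eval s.r))).setId
          (s.id ∘ Equiv.swap (a.eval s.r) (b.eval s.r)))
  | seq {c d s t s' t' s''} : Big w n c s t s' → Big w n d s' t' s'' →
      Big w n (.seq c d) s (t + t') s''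
  | ite_true {p c d s t s'} : p.Ok w s.r → p.holds s.r → Big w n c s t s' →
      Big w n (.ite p c d) s (p.len + 1 + t) s'
  | ite_false {p c d s t s'} : p.Ok w s.r → ¬ p.holds s.r → Big w n d s t s' →
      Big w n (.ite p c d) s (p.len + 1 + t + 1) s'
  | loop_true {p c s t s' t' s''} : p.Ok w s.r → p.holds s.r → Big w n c s t s' →
      Big w n (.loop p c) s' t' s'' → Big w n (.loop p c) s (p.len + 1 + t + 1 + t') s''
  | loop_false {p c s} : p.Ok w s.r → ¬ p.holds s.r → Big w n (.loop p c) s (p.len + 2) s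

/-! ### Compilation to the word RAM -/

/-- The number of variables. -/
def numVars : ℕ := 40

theorem Var.ctorIdx_lt (x : Var) : x.ctorIdx < numVars := by
  cases x <;> decide

theorem Var.ctorIdx_inj {x y : Var} (h : x.ctorIdx = y.ctorIdx) : x = y := by
  rw [← Var.ofNat_ctorIdx x, ← Var.ofNat_ctorIdx y, h]

/-- The register of a variable in a machine with `k + 1` registers.  Register `0` is left free
for the input. -/
def Var.reg (k : ℕ) (x : Var) : Fin (k + 1) :=
  Fin.ofNat (k + 1) (1 + x.ctorIdx)

/-- The registers for intermediate results; they follow those of the variables. -/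
def tempReg (k τ : ℕ) : Fin (k + 1) := Fin.ofNat (k + 1) (1 + numVars + τ)

/-- The machine code of an expression.  The result is left in the temporary register `τ`, and
only temporary registers from `τ` on are changed. -/
def Ex.code (k : ℕ) : Ex → ℕ → List (Instr (k + 1))
  | .var x, τ => [.move (tempReg k τ) (x.reg k)]
  | .lit v, τ => [.const (tempReg k τ) v]
  | .add a b, τ => a.code k τ ++ b.code k (τ + 1) ++
      [.add (tempReg k τ) (tempReg k τ) (tempReg k (τ + 1))]
  | .sub a b, τ => a.code k τ ++ b.code k (τ + 1) ++
      [.sub (tempReg k τ) (tempReg k τ) (tempReg k (τ + 1))]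
  | .shl a b, τ => a.code k τ ++ b.code k (τ + 1) ++
      [.shiftLeft (tempReg k τ) (tempReg k τ) (tempReg k (τ + 1))]
  | .shr a b, τ => a.code k τ ++ b.code k (τ + 1) ++
      [.shiftRight (tempReg k τ) (tempReg k τ) (tempReg k (τ + 1))]
  | .low a b, τ => a.code k τ ++ b.code k (τ + 1) ++
      [.shiftRight (tempReg k (τ + 2)) (tempReg k τ) (tempReg k (τ + 1)),
       .shiftLeft (tempReg k (τ + 2)) (tempReg k (τ + 2)) (tempReg k (τ + 1)),
       .sub (tempReg k τ) (tempReg k τ) (tempReg k (τ + 2))]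

/-- The number of temporary registers that the code of an expression needs. -/
def Ex.width : Ex → ℕ
  | .var _ => 1
  | .lit _ => 1
  | .add a b => max a.width (b.width + 1)
  | .sub a b => max a.width (b.width + 1)
  | .shl a b => max a.width (b.width + 1)
  | .shr a b => max a.width (b.width + 1)
  | .low a b => max 3 (max a.width (b.width + 1))

/-- The machine code that evaluates a test and jumps to `target` if it holds. -/
def Cond.code (k : ℕ) (target : ℕ) : Cond → List (Instr (k + 1))
  | .lt a b => a.code k 0 ++ b.code k 1 ++ [.jumpLt (tempReg k 0) (tempReg k 1) target]
  | .eq a b => a.code k 0 ++ b.code k 1 ++ [.jumpEq (tempReg k 0) (tempReg k 1) target]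

/-- The number of temporary registers that a test needs. -/
def Cond.width : Cond → ℕ
  | .lt a b => max a.width (b.width + 1)
  | .eq a b => max a.width (b.width + 1)

/-- The length of the machine code of a command. -/
def Com.len : Com → ℕ
  | .skip => 0
  | .asg _ e => e.len + 1
  | .read _ a => a.len + 1
  | .write a e => a.len + e.len + 1
  | .exch a b => a.len + b.len + 1
  | .seq c d => c.len + d.len
  | .ite p c d => p.len + 1 + d.len + 1 + c.len
  | .loop p c => p.len + 1 + 1 + c.len + 1

/-- The machine code of a command that is placed at position `off` of the program. -/
def Com.code (k : ℕ) : Com → ℕ → List (Instr (k + 1))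
  | .skip, _ => []
  | .asg x e, _ => e.code k 0 ++ [.move (x.reg k) (tempReg k 0)]
  | .read x a, _ => a.code k 0 ++ [.readKey (x.reg k) (tempReg k 0)]
  | .write a e, _ => a.code k 0 ++ e.code k 1 ++ [.writeKey (tempReg k 0) (tempReg k 1)]
  | .exch a b, _ => a.code k 0 ++ b.code k 1 ++ [.exchange (tempReg k 0) (tempReg k 1)]
  | .seq c d, off => c.code k off ++ d.code k (off + c.len)
  | .ite p c d, off =>
      p.code k (off + p.len + 1 + d.len + 1) ++ (d.code k (off + p.len + 1) ++
        ([.jump (off + p.len + 1 + d.len + 1 + c.len)] ++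
          c.code k (off + p.len + 1 + d.len + 1)))
  | .loop p c, off =>
      p.code k (off + p.len + 1 + 1) ++ ([.jump (off + p.len + 1 + 1 + c.len + 1)] ++
        (c.code k (off + p.len + 1 + 1) ++ [.jump off]))

/-- The number of temporary registers that a command needs. -/
def Com.width : Com → ℕ
  | .skip => 0
  | .asg _ e => e.width
  | .read _ a => a.width
  | .write a e => max a.width (e.width + 1)
  | .exch a b => max a.width (b.width + 1)
  | .seq c d => max c.width d.width
  | .ite p c d => max p.width (max c.width d.width)
  | .loop p c => max p.width c.width

@[simp] theorem Ex.length_code (k : ℕ) (e : Ex) (τ : ℕ) : (e.code k τ).length = e.len := by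
  induction e generalizing τ <;> simp [Ex.code, Ex.len, Nat.add_assoc, *]

@[simp] theorem Cond.length_code (k : ℕ) (p : Cond) (l : ℕ) :
    (p.code k l).length = p.len + 1 := by
  cases p <;> simp [Cond.code, Cond.len, Nat.add_assoc]

@[simp] theorem Com.length_code (k : ℕ) (c : Com) (off : ℕ) : (c.code k off).length = c.len := by
  induction c generalizing off <;> simp [Com.code, Com.len, *] <;> omega

/-- The program `P` contains the code `l` from position `off` on. -/
def Seg {k : ℕ} (P : Program k) : ℕ → List (Instr k) → Prop
  | _, [] => True
  | off, i :: l => P[off]? = some i ∧ Seg P (off + 1) l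

theorem seg_append {k : ℕ} (P : Program k) (off : ℕ) (l l' : List (Instr k)) :
    Seg P off (l ++ l') ↔ Seg P off l ∧ Seg P (off + l.length) l' := by
  induction l generalizing off with
  | nil => simp [Seg]
  | cons i l ih => simp [Seg, ih, and_assoc, Nat.add_assoc, Nat.add_comm 1]

theorem seg_suffix {k : ℕ} (p l : List (Instr k)) : Seg (p ++ l : Program k) p.length l := by
  induction l generalizing p with
  | nil => trivial
  | cons i l ih =>
    refine ⟨by simp, ?_⟩
    simpa using ih (p ++ [i])

section Simulation
variable {k w n : ℕ} {α : Type*}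

theorem step_eq {P : Program k} {s : State k w n α} {i : Instr k} (h : P[s.pc]? = some i) :
    step P s = exec s i := by
  simp [step, h]

/-- The machine state `S` results from the input `S₀` and represents the state `s` of the
structured language. -/
structure Rel (S₀ : Fin n → Elem w α) (s : St) (S : State (k + 1) w n α) : Prop where
  reg : ∀ x : Var, (S.reg (x.reg k)).toNat = s.r x
  key : ∀ p : Fin n, (S.seq p).key.toNat = s.key p
  id : ∀ p : Fin n, ∃ h : s.id p < n, (S.seq p).data = (S₀ ⟨s.id p, h⟩).data

theorem Var.reg_val (x : Var) (h : numVars ≤ k) :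
    (x.reg k).val = 1 + x.ctorIdx := by
  have := x.ctorIdx_lt
  simp only [Var.reg, Fin.ofNat]
  exact Nat.mod_eq_of_lt (by omega)

theorem tempReg_val {τ : ℕ} (h : numVars + τ < k) : (tempReg k τ).val = 1 + numVars + τ := by
  simp only [tempReg, Fin.ofNat]
  exact Nat.mod_eq_of_lt (by omega)

theorem Var.reg_inj (h : numVars ≤ k) {x y : Var} : x.reg k = y.reg k ↔ x = y := by
  constructor
  · intro e
    have := congrArg Fin.val e
    rw [Var.reg_val x h, Var.reg_val y h] at this
    exact Var.ctorIdx_inj (by omega)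
  · rintro rfl; rfl

theorem Var.reg_lt (h : numVars ≤ k) (x : Var) : (x.reg k).val < 1 + numVars := by
  rw [Var.reg_val x h]
  have := x.ctorIdx_lt
  omega

/-- The code of the expression `e` leaves the value of `e` in the temporary register `τ` and does
not change the registers below it. -/
def Ex.Correct (w n : ℕ) (α : Type*) (P : Program (k + 1)) (r : Var → ℕ) (e : Ex) : Prop :=
  ∀ (τ : ℕ) (S : State (k + 1) w n α), (∀ x : Var, (S.reg (x.reg k)).toNat = r x) →
    numVars + τ + e.width ≤ k → Seg P S.pc (e.code k τ) →
    ∃ R, (step P)^[e.len] S = { S with pc := S.pc + e.len, reg := R } ∧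
      (R (tempReg k τ)).toNat = e.eval r ∧
      ∀ i : Fin (k + 1), i.val < 1 + numVars + τ → R i = S.reg i

/-- The evaluation of two operands, one after the other. -/
theorem Ex.Correct.pair {P : Program (k + 1)} {r : Var → ℕ} {a b : Ex}
    (ha : a.Correct w n α P r) (hb : b.Correct w n α P r) (τ : ℕ) (S : State (k + 1) w n α)
    (l : List (Instr (k + 1))) (hr : ∀ x : Var, (S.reg (x.reg k)).toNat = r x)
    (hk : numVars + τ + max a.width (b.width + 1) ≤ k)
    (hP : Seg P S.pc (a.code k τ ++ b.code k (τ + 1) ++ l)) :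
    ∃ R, (step P)^[a.len + b.len] S = { S with pc := S.pc + (a.len + b.len), reg := R } ∧
      (R (tempReg k τ)).toNat = a.eval r ∧ (R (tempReg k (τ + 1))).toNat = b.eval r ∧
      Seg P (S.pc + (a.len + b.len)) l ∧
      ∀ i : Fin (k + 1), i.val < 1 + numVars + τ → R i = S.reg i := by
  rw [seg_append, seg_append] at hP
  simp only [List.length_append, Ex.length_code] at hP
  obtain ⟨⟨hP1, hP2⟩, hP3⟩ := hP
  have hw : 0 < b.width := by cases b <;> simp [Ex.width]
  have h1 := le_max_left a.width (b.width + 1)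
  have h2 := le_max_right a.width (b.width + 1)
  obtain ⟨R, e1, e2, e3⟩ := ha τ S hr (by omega) hP1
  obtain ⟨R', e1', e2', e3'⟩ := hb (τ + 1) { S with pc := S.pc + a.len, reg := R }
    (fun x => by
      rw [← hr x]
      simp only
      rw [e3 _ (by have := x.reg_lt (k := k) (by omega); omega)])
    (by omega) hP2
  refine ⟨R', ?_, ?_, e2', hP3, ?_⟩
  · rw [Nat.add_comm a.len, Function.iterate_add_apply, e1, e1']
    simp [Nat.add_assoc, Nat.add_comm]
  · rw [e3' _ (by rw [tempReg_val (by omega)]; omega)]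
    exact e2
  · intro i hi
    rw [e3' i (by omega)]
    exact e3 i hi

/-- `Ex.code` computes `Ex.eval`. -/
theorem Ex.correct {P : Program (k + 1)} (r : Var → ℕ) (e : Ex) (hok : e.Ok w r) :
    e.Correct w n α P r := by
  have base : ∀ (τ : ℕ) (S : State (k + 1) w n α) (i : Instr (k + 1)) (v : BitVec w),
      numVars + τ + 1 ≤ k → Seg P S.pc [i] → exec S i = S.store (tempReg k τ) v →
      ∃ R, (step P)^[1] S = { S with pc := S.pc + 1, reg := R } ∧
        (R (tempReg k τ)) = v ∧ ∀ i : Fin (k + 1), i.val < 1 + numVars + τ → R i = S.reg i := by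
    intro τ S i v hk hP hi
    refine ⟨Function.update S.reg (tempReg k τ) v, ?_, by simp, ?_⟩
    · simp [step_eq hP.1, hi, State.store]
    · intro j hj
      apply Function.update_of_ne
      rintro rfl
      rw [tempReg_val (by omega)] at hj
      omega
  have fin : ∀ (a b : Ex) (τ : ℕ) (S : State (k + 1) w n α) (R : Fin (k + 1) → BitVec w)
      (i : Instr (k + 1)) (v : BitVec w),
      (step P)^[a.len + b.len] S = { S with pc := S.pc + (a.len + b.len), reg := R } →
      numVars + τ + 1 ≤ k →
      (∀ i : Fin (k + 1), i.val < 1 + numVars + τ → R i = S.reg i) →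
      Seg P (S.pc + (a.len + b.len)) [i] →
      exec { S with pc := S.pc + (a.len + b.len), reg := R } i =
        State.store { S with pc := S.pc + (a.len + b.len), reg := R } (tempReg k τ) v →
      ∃ R, (step P)^[a.len + b.len + 1] S = { S with pc := S.pc + (a.len + b.len + 1), reg := R } ∧
        R (tempReg k τ) = v ∧
        ∀ i : Fin (k + 1), i.val < 1 + numVars + τ → R i = S.reg i := by
    intro a b τ S R i v h1 hk h2 h3 h4
    obtain ⟨R', e1, e2, e3⟩ := base τ _ i v hk h3 h4
    refine ⟨R', ?_, e2, fun j hj => by rw [e3 j hj, ← h2 j hj]⟩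
    rw [Nat.add_comm (a.len + b.len) 1, Function.iterate_add_apply, h1, e1]
    simp [Nat.add_assoc]
    omega
  induction e with
  | var x =>
    intro τ S hr hk hP
    obtain ⟨R, e1, e2, e3⟩ := base τ S _ (S.reg (x.reg k)) hk hP rfl
    exact ⟨R, e1, by rw [e2]; exact hr x, e3⟩
  | lit v =>
    intro τ S hr hk hP
    obtain ⟨R, e1, e2, e3⟩ := base τ S _ (BitVec.ofNat w v) hk hP rfl
    exact ⟨R, e1, by rw [e2]; simpa using Nat.mod_eq_of_lt hok, e3⟩
  | add a b iha ihb =>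
    intro τ S hr hk hP
    obtain ⟨R, e1, e2, e3, e4, e5⟩ := (iha hok.1).pair (ihb hok.2.1) τ S _ hr hk hP
    obtain ⟨R', f1, f2, f3⟩ := fin a b τ S R _ _ e1 (by simp [Ex.width] at hk; omega) e5 e4 rfl
    refine ⟨R', f1, ?_, f3⟩
    rw [f2, BitVec.toNat_add, e2, e3]
    exact Nat.mod_eq_of_lt hok.2.2
  | sub a b iha ihb =>
    intro τ S hr hk hP
    obtain ⟨R, e1, e2, e3, e4, e5⟩ := (iha hok.1).pair (ihb hok.2.1) τ S _ hr hk hP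
    obtain ⟨R', f1, f2, f3⟩ := fin a b τ S R _ _ e1 (by simp [Ex.width] at hk; omega) e5 e4 rfl
    refine ⟨R', f1, ?_, f3⟩
    rw [f2, BitVec.toNat_sub_of_le (by rw [BitVec.le_def, e2, e3]; exact hok.2.2), e2, e3]
    rfl
  | shl a b iha ihb =>
    intro τ S hr hk hP
    obtain ⟨R, e1, e2, e3, e4, e5⟩ := (iha hok.1).pair (ihb hok.2.1) τ S _ hr hk hP
    obtain ⟨R', f1, f2, f3⟩ := fin a b τ S R _ _ e1 (by simp [Ex.width] at hk; omega) e5 e4 rfl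
    refine ⟨R', f1, ?_, f3⟩
    rw [f2, BitVec.toNat_shiftLeft, Nat.shiftLeft_eq]
    simp only [e2, e3]
    exact Nat.mod_eq_of_lt hok.2.2
  | shr a b iha ihb =>
    intro τ S hr hk hP
    obtain ⟨R, e1, e2, e3, e4, e5⟩ := (iha hok.1).pair (ihb hok.2) τ S _ hr hk hP
    obtain ⟨R', f1, f2, f3⟩ := fin a b τ S R _ _ e1 (by simp [Ex.width] at hk; omega) e5 e4 rfl
    refine ⟨R', f1, ?_, f3⟩
    rw [f2, BitVec.toNat_ushiftRight, Nat.shiftRight_eq_div_pow]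
    simp only [e2, e3]
    rfl
  | low a b iha ihb =>
    intro τ S hr hk hP
    have hk3 : 3 ≤ (Ex.low a b).width := le_max_left _ _
    have hk2 : max a.width (b.width + 1) ≤ (Ex.low a b).width := le_max_right _ _
    obtain ⟨R, e1, e2, e3, e4, e5⟩ := (iha hok.1).pair (ihb hok.2) τ S _ hr
      (by omega) hP
    have ne : ∀ i j, i < 3 → j < 3 → i ≠ j → tempReg k (τ + i) ≠ tempReg k (τ + j) := by
      intro i j hi hj hij h
      have := congrArg Fin.val h
      rw [tempReg_val (by omega), tempReg_val (by omega)] at this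
      omega
    have n02 := ne 0 2 (by omega) (by omega) (by omega)
    have n12 := ne 1 2 (by omega) (by omega) (by omega)
    simp only [Nat.add_zero] at n02
    obtain ⟨p1, p2, p3, -⟩ := e4
    rw [show (Ex.low a b).len = 1 + (1 + (1 + (a.len + b.len))) by simp [Ex.len]; omega]
    set v₁ := R (tempReg k τ) >>> (R (tempReg k (τ + 1))).toNat with hv₁
    set v₂ := v₁ <<< (R (tempReg k (τ + 1))).toNat with hv₂
    refine ⟨Function.update (Function.update (Function.update R (tempReg k (τ + 2)) v₁)
      (tempReg k (τ + 2)) v₂) (tempReg k τ) (R (tempReg k τ) - v₂), ?_⟩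
    have s1 := step_eq (s := ({ S with pc := S.pc + (a.len + b.len), reg := R } :
      State (k + 1) w n α)) p1
    have s2 := step_eq (s := ({ S with
      pc := S.pc + (a.len + b.len) + 1
      reg := Function.update R (tempReg k (τ + 2)) v₁ } : State (k + 1) w n α)) p2
    have s3 := step_eq (s := ({ S with
      pc := S.pc + (a.len + b.len) + 1 + 1
      reg := Function.update (Function.update R (tempReg k (τ + 2)) v₁) (tempReg k (τ + 2)) v₂ } :
        State (k + 1) w n α)) p3
    simp only [exec, State.store, Function.update_self, Function.update_of_ne n02,
      Function.update_of_ne n12] at s1 s2 s3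
    rw [Function.iterate_add_apply (step P) 1, Function.iterate_add_apply (step P) 1,
      Function.iterate_add_apply (step P) 1]
    simp only [Function.iterate_one]
    rw [e1, s1, s2, s3]
    refine ⟨?_, ?_, ?_⟩
    · simp only [State.mk.injEq, and_true]
      omega
    · simp only [Function.update_self]
      have hle : (R (tempReg k τ)).toNat / 2 ^ (R (tempReg k (τ + 1))).toNat *
        2 ^ (R (tempReg k (τ + 1))).toNat ≤ (R (tempReg k τ)).toNat := Nat.div_mul_le_self _ _
      have hlt := (R (tempReg k τ)).isLt
      have hval : v₂.toNat = (R (tempReg k τ)).toNat /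
          2 ^ (R (tempReg k (τ + 1))).toNat * 2 ^ (R (tempReg k (τ + 1))).toNat := by
        rw [hv₂, hv₁, BitVec.toNat_shiftLeft, BitVec.toNat_ushiftRight, Nat.shiftLeft_eq,
          Nat.shiftRight_eq_div_pow]
        exact Nat.mod_eq_of_lt (by omega)
      rw [BitVec.toNat_sub_of_le (by rw [BitVec.le_def, hval]; exact hle), hval, e2, e3]
      simp only [Ex.eval]
      have := Nat.div_add_mod' (a.eval r) (2 ^ b.eval r)
      omega
    · intro i hi
      have h0 : i ≠ tempReg k τ := by
        rintro rfl; rw [tempReg_val (by omega)] at hi; omega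
      have h2 : i ≠ tempReg k (τ + 2) := by
        rintro rfl; rw [tempReg_val (by omega)] at hi; omega
      rw [Function.update_of_ne h0, Function.update_of_ne h2, Function.update_of_ne h2, e5 i hi]

end Simulation

/-! ### Correctness of the compiled code -/

theorem iterate_add_apply' {β : Type*} (f : β → β) (a b : ℕ) (x : β) :
    f^[a + b] x = f^[b] (f^[a] x) := by
  rw [Nat.add_comm, Function.iterate_add_apply]

section Simulation
variable {k w n : ℕ} {α : Type*}

/-- Only registers of intermediate results differ, so that the represented state is the same. -/
theorem Rel.of_reg {S₀ : Fin n → Elem w α} {s : St} {S : State (k + 1) w n α} (h : Rel S₀ s S)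
    (hk : numVars ≤ k) {R : Fin (k + 1) → BitVec w}
    (hR : ∀ i : Fin (k + 1), i.val < 1 + numVars + 0 → R i = S.reg i) (pc : ℕ) :
    Rel S₀ s { S with pc := pc, reg := R } :=
  ⟨fun x => by rw [← h.reg x]; simp only; rw [hR _ (x.reg_lt hk)], h.key, h.id⟩

/-- The test jumps if and only if it holds. -/
theorem Cond.correct {P : Program (k + 1)} {S₀ : Fin n → Elem w α} {s : St} (p : Cond)
    (target : ℕ) (hok : p.Ok w s.r) (S : State (k + 1) w n α) (hS : Rel S₀ s S)
    (hk : numVars + p.width ≤ k) (hP : Seg P S.pc (p.code k target)) [Decidable (p.holds s.r)] :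
    ∃ S', (step P)^[p.len + 1] S = S' ∧ Rel S₀ s S' ∧
      S'.pc = if p.holds s.r then target else S.pc + (p.len + 1) := by
  cases p with
  | lt a b =>
    obtain ⟨R, e1, e2, e3, e4, e5⟩ := (Ex.correct s.r a hok.1).pair (Ex.correct s.r b hok.2) 0 S _
      hS.reg (by simpa [Cond.width] using hk) hP
    refine ⟨_, rfl, ?_⟩
    rw [Cond.len, iterate_add_apply', e1, Function.iterate_one,
      step_eq e4.1, exec]
    refine ⟨hS.of_reg (by omega) e5 _, ?_⟩
    simp [e2, e3, Cond.holds, Nat.add_assoc]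
  | eq a b =>
    obtain ⟨R, e1, e2, e3, e4, e5⟩ := (Ex.correct s.r a hok.1).pair (Ex.correct s.r b hok.2) 0 S _
      hS.reg (by simpa [Cond.width] using hk) hP
    refine ⟨_, rfl, ?_⟩
    rw [Cond.len, iterate_add_apply', e1, Function.iterate_one,
      step_eq e4.1, exec]
    refine ⟨hS.of_reg (by omega) e5 _, ?_⟩
    simp [← BitVec.toNat_inj, e2, e3, Cond.holds, Nat.add_assoc]

theorem Rel.set {S₀ : Fin n → Elem w α} {s : St} {S : State (k + 1) w n α} (h : Rel S₀ s S)
    (hk : numVars ≤ k) (x : Var) (v : BitVec w) :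
    Rel S₀ (s.set x v.toNat) (S.store (x.reg k) v) := by
  refine ⟨fun y => ?_, h.key, h.id⟩
  simp only [State.store, St.set_r, Function.update_apply, Var.reg_inj hk]
  split_ifs
  · rfl
  · exact h.reg y

open scoped Classical in
/-- The machine code of a command does what the command does, in exactly the same time. -/
theorem Big.sim {P : Program (k + 1)} {S₀ : Fin n → Elem w α} {c : Com} {s s' : St} {t : ℕ}
    (h : Big w n c s t s') : ∀ S : State (k + 1) w n α, Rel S₀ s S → numVars + c.width ≤ k →
      Seg P S.pc (c.code k S.pc) →
      ∃ S', (step P)^[t] S = S' ∧ Rel S₀ s' S' ∧ S'.pc = S.pc + c.len := by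
  induction h with
  | skip s => exact fun S hS _ _ => ⟨S, rfl, hS, rfl⟩
  | asg s x e h =>
    intro S hS hk hP
    rw [Com.code, seg_append, Ex.length_code] at hP
    obtain ⟨R, e1, e2, e3⟩ := Ex.correct (k := k) s.r e h 0 S hS.reg hk hP.1
    refine ⟨_, rfl, ?_⟩
    rw [iterate_add_apply', e1, Function.iterate_one, step_eq hP.2.1, exec,
      ← e2]
    exact ⟨(hS.of_reg (by omega) e3 _).set (by omega) x _, rfl⟩
  | read s x a h hn =>
    intro S hS hk hP
    rw [Com.code, seg_append, Ex.length_code] at hP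
    obtain ⟨R, e1, e2, e3⟩ := Ex.correct (k := k) s.r a h 0 S hS.reg hk hP.1
    refine ⟨_, rfl, ?_⟩
    rw [iterate_add_apply', e1, Function.iterate_one, step_eq hP.2.1, exec]
    simp only [e2, hn, dif_pos]
    rw [show s.key (a.eval s.r) = s.key (⟨a.eval s.r, hn⟩ : Fin n) from rfl, ← hS.key]
    exact ⟨(hS.of_reg (by omega) e3 _).set (by omega) x _, rfl⟩
  | write s a e h h' hn =>
    intro S hS hk hP
    obtain ⟨R, e1, e2, e3, e4, e5⟩ := (Ex.correct s.r a h).pair (Ex.correct s.r e h') 0 S _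
      hS.reg (by simpa [Com.width] using hk) hP
    refine ⟨_, rfl, ?_⟩
    rw [iterate_add_apply', e1, Function.iterate_one,
      step_eq e4.1, exec]
    simp only [e2, hn, dif_pos]
    have h0 := hS.of_reg (by omega) e5 (S.pc + (a.len + e.len))
    refine ⟨⟨h0.reg, fun p => ?_, fun p => ?_⟩, by simp [Com.len, Nat.add_assoc]⟩
    · simp only [Function.update_apply, St.setKey_key, Fin.ext_iff]
      split_ifs
      · exact e3
      · exact h0.key p
    · obtain ⟨h1, h2⟩ := h0.id p
      refine ⟨h1, ?_⟩
      simp only [Function.update_apply]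
      split_ifs with hp
      · subst hp; exact h2
      · exact h2
  | exch s a b h h' hn hn' =>
    intro S hS hk hP
    obtain ⟨R, e1, e2, e3, e4, e5⟩ := (Ex.correct s.r a h).pair (Ex.correct s.r b h') 0 S _
      hS.reg (by simpa [Com.width] using hk) hP
    refine ⟨_, rfl, ?_⟩
    rw [iterate_add_apply', e1, Function.iterate_one,
      step_eq e4.1, exec]
    simp only [e2, hn, hn', e3, and_self, dif_pos]
    have h0 := hS.of_reg (by omega) e5 (S.pc + (a.len + b.len))
    have hsw : ∀ p : Fin n,
        ((Equiv.swap (⟨a.eval s.r, hn⟩ : Fin n) ⟨b.eval s.r, hn'⟩ p : Fin n) : ℕ) =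
          Equiv.swap (a.eval s.r) (b.eval s.r) p := by
      intro p
      simp only [Equiv.swap_apply_def, Fin.ext_iff]
      split_ifs <;> rfl
    refine ⟨⟨h0.reg, fun p => ?_, fun p => ?_⟩, by simp [Com.len, Nat.add_assoc]⟩
    · have := h0.key (Equiv.swap ⟨a.eval s.r, hn⟩ ⟨b.eval s.r, hn'⟩ p)
      rw [hsw] at this
      exact this
    · have := h0.id (Equiv.swap ⟨a.eval s.r, hn⟩ ⟨b.eval s.r, hn'⟩ p)
      rw [hsw] at this
      exact this
  | seq _ _ ih ih' =>
    intro S hS hk hP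
    rw [Com.code, seg_append, Com.length_code] at hP
    simp only [Com.width] at hk
    obtain ⟨S1, e1, e2, e3⟩ := ih S hS (by omega) hP.1
    obtain ⟨S2, f1, f2, f3⟩ := ih' S1 e2 (by omega) (by rw [e3]; exact hP.2)
    refine ⟨S2, ?_, f2, by rw [f3, e3, Com.len, Nat.add_assoc]⟩
    rw [iterate_add_apply', e1, f1]
  | @ite_true p c d s t s' hok hp _ ih =>
    intro S hS hk hP
    rw [Com.code, seg_append, seg_append, seg_append] at hP
    simp only [Com.length_code, Cond.length_code, List.length_singleton] at hP
    simp only [Com.width] at hk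
    obtain ⟨S1, e1, e2, e3⟩ := p.correct _ hok S hS (by omega) hP.1
    rw [if_pos hp] at e3
    obtain ⟨S2, f1, f2, f3⟩ := ih S1 e2 (by omega) (by
      rw [e3]; convert hP.2.2.2 using 1; omega)
    refine ⟨S2, ?_, f2, by rw [f3, e3, Com.len]; omega⟩
    rw [iterate_add_apply', e1, f1]
  | @ite_false p c d s t s' hok hp _ ih =>
    intro S hS hk hP
    rw [Com.code, seg_append, seg_append, seg_append] at hP
    simp only [Com.length_code, Cond.length_code, List.length_singleton] at hP
    simp only [Com.width] at hk
    obtain ⟨S1, e1, e2, e3⟩ := p.correct _ hok S hS (by omega) hP.1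
    rw [if_neg hp] at e3
    obtain ⟨S2, f1, f2, f3⟩ := ih S1 e2 (by omega) (by rw [e3]; exact hP.2.1)
    refine ⟨_, rfl, ?_⟩
    rw [iterate_add_apply', iterate_add_apply', e1, f1, Function.iterate_one]
    rw [step_eq (by rw [f3, e3]; exact hP.2.2.1.1), exec]
    exact ⟨⟨f2.reg, f2.key, f2.id⟩, by simp only [Com.len]; omega⟩
  | @loop_true p c s t s' t' s'' hok hp _ _ ih ih' =>
    intro S hS hk hP
    have hP' := hP
    have hk' := hk
    rw [Com.code, seg_append, seg_append, seg_append] at hP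
    simp only [Com.length_code, Cond.length_code, List.length_singleton] at hP
    simp only [Com.width] at hk
    obtain ⟨S1, e1, e2, e3⟩ := p.correct _ hok S hS (by omega) hP.1
    rw [if_pos hp] at e3
    obtain ⟨S2, f1, f2, f3⟩ := ih S1 e2 (by omega) (by
      rw [e3]; convert hP.2.2.1 using 1; omega)
    obtain ⟨S3, g1, g2, g3⟩ := ih' { S2 with pc := S.pc } ⟨f2.reg, f2.key, f2.id⟩ hk' hP'
    refine ⟨S3, ?_, g2, g3⟩
    rw [iterate_add_apply', iterate_add_apply', iterate_add_apply', e1, f1, Function.iterate_one]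
    rw [step_eq (by rw [f3, e3]; convert hP.2.2.2.1 using 2; omega), exec, g1]
  | @loop_false p c s hok hp =>
    intro S hS hk hP
    rw [Com.code, seg_append, seg_append, seg_append] at hP
    simp only [Com.length_code, Cond.length_code, List.length_singleton] at hP
    simp only [Com.width] at hk
    obtain ⟨S1, e1, e2, e3⟩ := p.correct _ hok S hS (by omega) hP.1
    rw [if_neg hp] at e3
    refine ⟨_, rfl, ?_⟩
    rw [show p.len + 2 = p.len + 1 + 1 by omega, iterate_add_apply', e1,
      Function.iterate_one]
    rw [step_eq (by rw [e3]; exact hP.2.1.1), exec]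
    exact ⟨⟨e2.reg, e2.key, e2.id⟩, by simp only [Com.len]; omega⟩

/-- A correct command yields a program for the word RAM. -/
theorem Big.run {k w n : ℕ} {α : Type*} {c : Com} (S : Fin n → Elem w α) {s s' : St} {t : ℕ}
    (hn : n < 2 ^ w) (hr : ∀ x, s.r x = if x = .n then n else 0)
    (hkey : ∀ p : Fin n, (S p).key.toNat = s.key p) (hid : ∀ p, s.id p = p)
    (h : Big w n c s t s') (hk : numVars + c.width ≤ k) :
    let P : Program (k + 1) := .move (Var.reg k .n) 0 :: c.code k 1
    Halted P (InPlaceSort.run P S (t + 1)) ∧ Rel S s' (InPlaceSort.run P S (t + 1)) := by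
  intro P
  have h1 : step P (init (k + 1) S) =
      { pc := 1, reg := Function.update (init (k + 1) S).reg (Var.reg k .n) (BitVec.ofNat w n),
        seq := S } := rfl
  have hrel : Rel S s (step P (init (k + 1) S)) := by
    rw [h1]
    refine ⟨fun x => ?_, hkey, fun p => ⟨by rw [hid]; exact p.isLt, ?_⟩⟩
    · simp only [Function.update_apply, Var.reg_inj (show numVars ≤ k by omega), hr]
      split_ifs
      · simpa using Nat.mod_eq_of_lt hn
      · have : (Var.reg k x).val ≠ 0 := by rw [Var.reg_val x (by omega)]; omega
        rw [init]
        simp only [if_neg this]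
        rfl
    · simp only [hid]
  obtain ⟨S', e1, e2, e3⟩ := h.sim (P := P) _ hrel hk (by
    rw [h1]; exact (seg_suffix [_] (c.code k 1)))
  have : InPlaceSort.run P S (t + 1) = S' := by
    rw [InPlaceSort.run, Function.iterate_succ_apply, e1]
  rw [this]
  refine ⟨?_, e2⟩
  rw [Halted, e3, h1]
  simp [P, Nat.add_comm]

end Simulation

/-! ### Reasoning about commands -/

/-- The command may assign to the variable. -/
def Com.Assigns : Com → Var → Prop
  | .skip, _ => False
  | .asg x _, y => y = x
  | .read x _, y => y = x
  | .write _ _, _ => False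
  | .exch _ _, _ => False
  | .seq c d, y => c.Assigns y ∨ d.Assigns y
  | .ite _ c d, y => c.Assigns y ∨ d.Assigns y
  | .loop _ c, y => c.Assigns y

theorem Big.frame {w n : ℕ} {c : Com} {s s' : St} {t : ℕ} (h : Big w n c s t s') (y : Var)
    (hy : ¬ c.Assigns y) : s'.r y = s.r y := by
  induction h with
  | skip | write | exch => rfl
  | asg | read => exact (St.set_r ..).trans (if_neg hy)
  | seq _ _ ih ih' => rw [ih' (fun h => hy (.inr h)), ih (fun h => hy (.inl h))]
  | ite_true _ _ _ ih => exact ih (fun h => hy (.inl h))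
  | ite_false _ _ _ ih => exact ih (fun h => hy (.inr h))
  | loop_true _ _ _ _ ih ih' => rw [ih' hy, ih hy]
  | loop_false => rfl

/-- `Spec w n c s T Q`: started in `s`, the command `c` ends after at most `T` machine
instructions in a state that satisfies `Q`. -/
def Spec (w n : ℕ) (c : Com) (s : St) (T : ℕ) (Q : St → Prop) : Prop :=
  ∃ t s', Big w n c s t s' ∧ t ≤ T ∧ Q s'

/-- Weakest preconditions of commands without loops. -/
def Wp (w n : ℕ) : Com → (St → Prop) → St → Prop
  | .skip, Q, s => Q s
  | .asg x e, Q, s => e.Ok w s.r ∧ Q (s.set x (e.eval s.r))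
  | .read x a, Q, s => a.Ok w s.r ∧ a.eval s.r < n ∧ Q (s.set x (s.key (a.eval s.r)))
  | .write a e, Q, s => a.Ok w s.r ∧ e.Ok w s.r ∧ a.eval s.r < n ∧
      Q (s.setKey (Function.update s.key (a.eval s.r) (e.eval s.r)))
  | .exch a b, Q, s => a.Ok w s.r ∧ b.Ok w s.r ∧ a.eval s.r < n ∧ b.eval s.r < n ∧
      Q ((s.setKey (s.key ∘ Equiv.swap (a.eval s.r) (b.eval s.r))).setId
          (s.id ∘ Equiv.swap (a.eval s.r) (b.eval s.r)))
  | .seq c d, Q, s => Wp w n c (Wp w n d Q) s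
  | .ite p c d, Q, s => p.Ok w s.r ∧ (p.holds s.r → Wp w n c Q s) ∧ (¬ p.holds s.r → Wp w n d Q s)
  | .loop _ _, _, _ => False

/-- An upper bound for the running time of a command without loops. -/
def Com.cost : Com → ℕ
  | .skip => 0
  | .asg _ e => e.len + 1
  | .read _ a => a.len + 1
  | .write a e => a.len + e.len + 1
  | .exch a b => a.len + b.len + 1
  | .seq c d => c.cost + d.cost
  | .ite p c d => p.len + 2 + (c.cost + d.cost)
  | .loop _ _ => 0

section Rules
variable {w n : ℕ} {c d : Com} {s : St} {T T' : ℕ} {Q Q' : St → Prop}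

theorem Wp.mono (h : Wp w n c Q s) (hQ : ∀ s, Q s → Q' s) : Wp w n c Q' s := by
  induction c generalizing s Q Q' with
  | skip => exact hQ _ h
  | asg x e => exact ⟨h.1, hQ _ h.2⟩
  | read x a => exact ⟨h.1, h.2.1, hQ _ h.2.2⟩
  | write a e => exact ⟨h.1, h.2.1, h.2.2.1, hQ _ h.2.2.2⟩
  | exch a b => exact ⟨h.1, h.2.1, h.2.2.1, h.2.2.2.1, hQ _ h.2.2.2.2⟩
  | seq c d ihc ihd => exact ihc h (fun s h => ihd h hQ)
  | ite p c d ihc ihd => exact ⟨h.1, fun hp => ihc (h.2.1 hp) hQ, fun hp => ihd (h.2.2 hp) hQ⟩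
  | loop => exact h

theorem Wp.spec (h : Wp w n c Q s) : Spec w n c s c.cost Q := by
  induction c generalizing s Q with
  | skip => exact ⟨_, _, .skip s, le_rfl, h⟩
  | asg x e => exact ⟨_, _, .asg s x e h.1, le_rfl, h.2⟩
  | read x a => exact ⟨_, _, .read s x a h.1 h.2.1, le_rfl, h.2.2⟩
  | write a e => exact ⟨_, _, .write s a e h.1 h.2.1 h.2.2.1, le_rfl, h.2.2.2⟩
  | exch a b => exact ⟨_, _, .exch s a b h.1 h.2.1 h.2.2.1 h.2.2.2.1, le_rfl, h.2.2.2.2⟩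
  | seq c d ihc ihd =>
    obtain ⟨t, s', h1, h2, h3⟩ := ihc h
    obtain ⟨t', s'', h1', h2', h3'⟩ := ihd h3
    exact ⟨_, _, h1.seq h1', Nat.add_le_add h2 h2', h3'⟩
  | ite p c d ihc ihd =>
    by_cases hp : p.holds s.r
    · obtain ⟨t, s', h1, h2, h3⟩ := ihc (h.2.1 hp)
      exact ⟨_, _, .ite_true h.1 hp h1, by simp only [Com.cost]; omega, h3⟩
    · obtain ⟨t, s', h1, h2, h3⟩ := ihd (h.2.2 hp)
      exact ⟨_, _, .ite_false h.1 hp h1, by simp only [Com.cost]; omega, h3⟩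
  | loop => exact h.elim

/-- Variables to which the command does not assign keep their values. -/
theorem Wp.frame (h : Wp w n c Q s) :
    Wp w n c (fun s' => Q s' ∧ ∀ y, ¬ c.Assigns y → s'.r y = s.r y) s := by
  induction c generalizing s Q with
  | skip => exact ⟨h, fun _ _ => rfl⟩
  | asg x e => exact ⟨h.1, h.2, fun y hy => (St.set_r ..).trans (if_neg hy)⟩
  | read x a => exact ⟨h.1, h.2.1, h.2.2, fun y hy => (St.set_r ..).trans (if_neg hy)⟩
  | write a e => exact ⟨h.1, h.2.1, h.2.2.1, h.2.2.2, fun _ _ => rfl⟩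
  | exch a b => exact ⟨h.1, h.2.1, h.2.2.1, h.2.2.2.1, h.2.2.2.2, fun _ _ => rfl⟩
  | seq c d ihc ihd =>
    refine (ihc h).mono fun s' hs' => (ihd hs'.1).mono fun s'' hs'' => ⟨hs''.1, fun y hy => ?_⟩
    rw [hs''.2 y fun h => hy (.inr h), hs'.2 y fun h => hy (.inl h)]
  | ite p c d ihc ihd =>
    exact ⟨h.1, fun hp => (ihc (h.2.1 hp)).mono fun s' hs' =>
      ⟨hs'.1, fun y hy => hs'.2 y fun h => hy (.inl h)⟩,
      fun hp => (ihd (h.2.2 hp)).mono fun s' hs' =>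
      ⟨hs'.1, fun y hy => hs'.2 y fun h => hy (.inr h)⟩⟩
  | loop => exact h.elim

/-- Sequential composition with an intermediate assertion. -/
theorem Wp.seq_frame (h : Wp w n c Q s)
    (h' : ∀ s', Q s' → (∀ y, ¬ c.Assigns y → s'.r y = s.r y) → Wp w n d Q' s') :
    Wp w n (c ;; d) Q' s :=
  h.frame.mono fun s' hs' => h' s' hs'.1 hs'.2

theorem Spec.mono (h : Spec w n c s T Q) (hT : T ≤ T') (hQ : ∀ s', Q s' → Q' s') :
    Spec w n c s T' Q' := by
  obtain ⟨t, s', h1, h2, h3⟩ := h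
  exact ⟨t, s', h1, h2.trans hT, hQ _ h3⟩

theorem Spec.seq (h : Spec w n c s T (fun s' => Spec w n d s' T' Q)) :
    Spec w n (c ;; d) s (T + T') Q := by
  obtain ⟨t, s', h1, h2, t', s'', h1', h2', h3'⟩ := h
  exact ⟨_, _, h1.seq h1', Nat.add_le_add h2 h2', h3'⟩

/-- Variables to which the command does not assign keep their values. -/
theorem Spec.frame (h : Spec w n c s T Q) :
    Spec w n c s T (fun s' => Q s' ∧ ∀ y, ¬ c.Assigns y → s'.r y = s.r y) := by
  obtain ⟨t, s', h1, h2, h3⟩ := h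
  exact ⟨t, s', h1, h2, h3, fun y hy => h1.frame y hy⟩

/-- Sequential composition with the knowledge about unchanged variables. -/
theorem Spec.seq_frame (h : Spec w n c s T Q)
    (h' : ∀ s', Q s' → (∀ y, ¬ c.Assigns y → s'.r y = s.r y) → Spec w n d s' T' Q') :
    Spec w n (c ;; d) s (T + T') Q' :=
  Spec.seq (h.frame.mono le_rfl fun s' hs' => h' s' hs'.1 hs'.2)

theorem Spec.ite {p : Cond} (hp : p.Ok w s.r) (h : p.holds s.r → Spec w n c s T Q)
    (h' : ¬ p.holds s.r → Spec w n d s T Q) : Spec w n (.ite p c d) s (p.len + 2 + T) Q := by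
  by_cases hh : p.holds s.r
  · obtain ⟨t, s', h1, h2, h3⟩ := h hh
    exact ⟨_, _, .ite_true hp hh h1, by omega, h3⟩
  · obtain ⟨t, s', h1, h2, h3⟩ := h' hh
    exact ⟨_, _, .ite_false hp hh h1, by omega, h3⟩

/-- Total correctness of a loop.  The invariant `I` carries a bound for the time that the loop
still needs. -/
theorem Spec.loop_time {p : Cond} (I : ℕ → St → Prop) {T : ℕ}
    (hI : ∀ N s', I N s' → (∀ y, ¬ c.Assigns y → s'.r y = s.r y) →
      p.Ok w s'.r ∧ (p.holds s'.r → ∃ T, T + p.len + 2 ≤ N ∧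
        Spec w n c s' T fun s'' => ∃ N', T + p.len + 2 + N' ≤ N ∧ I N' s''))
    (h0 : I T s) :
    Spec w n (.loop p c) s (T + p.len + 2)
      (fun s' => (∃ N, I N s' ∧ ¬ p.holds s'.r) ∧ ∀ y, ¬ c.Assigns y → s'.r y = s.r y) := by
  suffices H : ∀ N s', I N s' → (∀ y, ¬ c.Assigns y → s'.r y = s.r y) →
      Spec w n (.loop p c) s' (N + p.len + 2)
        (fun s' => (∃ N, I N s' ∧ ¬ p.holds s'.r) ∧ ∀ y, ¬ c.Assigns y → s'.r y = s.r y) from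
    H T s h0 fun _ _ => rfl
  intro N
  induction N using Nat.strong_induction_on with
  | _ N ih =>
    intro s' h hf
    obtain ⟨hok, hstep⟩ := hI N s' h hf
    by_cases hp : p.holds s'.r
    · obtain ⟨T', hT', t, s₁, h1, h2, N', hN', h3⟩ := hstep hp
      obtain ⟨t', s₂, h1', h2', h3'⟩ := ih N' (by omega) s₁ h3
        (fun y hy => by rw [h1.frame y hy, hf y hy])
      exact ⟨_, _, .loop_true hok hp h1 h1', by omega, h3'⟩
    · exact ⟨_, _, .loop_false hok hp, by omega, ⟨N, h, hp⟩, hf⟩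

/-- Total correctness of a loop with a bound `N` for the number of iterations, each of which
takes time at most `T`. -/
theorem Spec.loop_count {p : Cond} (I : ℕ → St → Prop) {T N : ℕ}
    (hI : ∀ N s', I N s' → (∀ y, ¬ c.Assigns y → s'.r y = s.r y) →
      p.Ok w s'.r ∧ (p.holds s'.r → Spec w n c s' T fun s'' => ∃ N', N' < N ∧ I N' s''))
    (h0 : I N s) :
    Spec w n (.loop p c) s ((N + 1) * (T + p.len + 2))
      (fun s' => (∃ N, I N s' ∧ ¬ p.holds s'.r) ∧ ∀ y, ¬ c.Assigns y → s'.r y = s.r y) := by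
  have := Spec.loop_time (w := w) (n := n) (c := c) (s := s) (p := p)
    (fun M s' => ∃ N, M = N * (T + p.len + 2) ∧ I N s') (T := N * (T + p.len + 2)) ?_ ⟨N, rfl, h0⟩
  · refine this.mono (by rw [Nat.add_mul]; omega) ?_
    rintro s' ⟨⟨_, ⟨N', -, h1⟩, h2⟩, h3⟩
    exact ⟨⟨N', h1, h2⟩, h3⟩
  · rintro _ s' ⟨M, rfl, hM⟩ hf
    obtain ⟨hok, hstep⟩ := hI M s' hM hf
    refine ⟨hok, fun hp => ⟨T, ?_, ?_⟩⟩
    · obtain ⟨_, _, _, _, N', hN', _⟩ := hstep hp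
      have : 1 * (T + p.len + 2) ≤ M * (T + p.len + 2) := Nat.mul_le_mul_right _ (by omega)
      omega
    · refine (hstep hp).mono le_rfl ?_
      rintro s'' ⟨N', hN', h⟩
      refine ⟨_, ?_, N', rfl, h⟩
      have : (N' + 1) * (T + p.len + 2) ≤ M * (T + p.len + 2) := Nat.mul_le_mul_right _ (by omega)
      rw [Nat.add_mul] at this
      omega

/-- `c` is executed for `i = 0, …, b - 1`, where `b` is the value of the variable `b`. -/
def forUp (i b : Var) (c : Com) : Com :=
  i ≔ 0 ;; .loop (.lt i b) (c ;; i ≔ i + 1)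

/-- `c` is executed for `i = b - 1, …, 0`, where `b` is the initial value of `i`. -/
def forDown (i : Var) (c : Com) : Com :=
  .loop (.lt 0 i) (i ≔ i - 1 ;; c)

@[simp] theorem forUp_assigns (i b y : Var) (c : Com) :
    (forUp i b c).Assigns y ↔ y = i ∨ c.Assigns y := by
  simp only [forUp, Com.Assigns]; tauto

@[simp] theorem forDown_assigns (i y : Var) (c : Com) :
    (forDown i c).Assigns y ↔ y = i ∨ c.Assigns y := by
  simp only [forDown, Com.Assigns]

/-- Counting upwards.  `I k` holds before the iteration with `i = k`. -/
theorem Spec.for_up {i b : Var} {B : ℕ} (I : ℕ → St → Prop) (hB : s.r b = B)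
    (hBw : B < 2 ^ w) (hib : b ≠ i) (hi : ¬ c.Assigns i) (hb : ¬ c.Assigns b)
    (h0 : I 0 (s.set i 0))
    (hstep : ∀ k < B, ∀ s', I k s' → s'.r i = k →
      (∀ y, y ≠ i → ¬ c.Assigns y → s'.r y = s.r y) →
      Spec w n c s' T fun s'' => I (k + 1) (s''.set i (k + 1))) :
    Spec w n (forUp i b c) s ((B + 2) * (T + 8)) (fun s' => I B s') := by
  have hpos : 0 < 2 ^ w := by positivity
  have h1 : Spec w n (i ≔ 0) s 2 (fun s' => s' = s.set i 0) :=
    Wp.spec (c := i ≔ 0) ⟨hpos, rfl⟩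
  refine (Spec.seq (h1.mono le_rfl ?_)).mono (T := 2 + (B + 1) * (T + 4 + 2 + 2)) ?_ fun _ h => h
  swap
  · nlinarith
  rintro _ rfl
  refine (Spec.loop_count (fun N s' => ∃ k ≤ B, N = B - k ∧ I k s' ∧ s'.r i = k) (T := T + 4) ?_
    ⟨0, by omega, rfl, h0, by simp⟩).mono le_rfl ?_
  · rintro N s' ⟨k, hk, rfl, hI, hik⟩ hf
    have hf' : ∀ y, y ≠ i → ¬ c.Assigns y → s'.r y = s.r y := by
      intro y hy hy'
      rw [hf y (by simp [Com.Assigns, hy, hy'])]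
      simp [hy]
    refine ⟨by simp, fun hlt => ?_⟩
    simp only [Cond.holds_lt, Ex.eval_var, hik, hf' b hib hb, hB] at hlt
    refine (hstep k hlt s' hI hik hf').seq_frame fun s'' h2 hf2 => ?_
    have hi2 : s''.r i = k := by rw [hf2 i hi, hik]
    refine (Wp.spec (c := i ≔ i + 1) (Q := fun s3 => s3 = s''.set i (k + 1)) ?_).mono le_rfl ?_
    · simp only [Wp, Ex.ok_add, Ex.ok_var, Ex.eval_var, Ex.eval_one, Ex.eval_add, hi2, Ex.ok_one,
        true_and, and_true]
      refine ⟨?_, by omega⟩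
      by_contra h0
      have : w = 0 := by omega
      subst this
      omega
    · rintro _ rfl
      exact ⟨B - (k + 1), by omega, k + 1, by omega, rfl, h2, by simp⟩
  · rintro s' ⟨⟨N, ⟨k, hk, rfl, hI, hik⟩, hnot⟩, hf⟩
    have hb' : s'.r b = B := by
      rw [hf b (by simp [Com.Assigns, hib, hb])]
      simp [hib, hB]
    simp only [Cond.holds_lt, Ex.eval_var, hik, hb'] at hnot
    rwa [show k = B by omega] at hI

/-- Counting downwards.  `I k` holds after the iteration with `i = k`. -/
theorem Spec.for_down {i : Var} {B : ℕ} (I : ℕ → St → Prop) (hB : s.r i = B)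
    (hw : 0 < w) (hi : ¬ c.Assigns i) (h0 : I B s)
    (hstep : ∀ k < B, ∀ s', I (k + 1) s' → s'.r i = k + 1 →
      (∀ y, y ≠ i → ¬ c.Assigns y → s'.r y = s.r y) → Spec w n c (s'.set i k) T (I k)) :
    Spec w n (forDown i c) s ((B + 2) * (T + 8)) (fun s' => I 0 s') := by
  have hpos : 0 < 2 ^ w := by positivity
  refine (Spec.loop_count (c := i ≔ i - 1 ;; c) (p := .lt 0 i) (N := B) (T := 4 + T)
    (fun N s' => I N s' ∧ s'.r i = N ∧ N ≤ B) ?_ ⟨h0, hB, le_rfl⟩).mono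
    (T' := (B + 2) * (T + 8)) ?_ ?_
  · rintro N s' ⟨hI, hiN, hNB⟩ hf
    refine ⟨by simp, fun hlt => ?_⟩
    simp only [Cond.holds_lt, Ex.eval_var, hiN, Ex.eval_zero] at hlt
    obtain ⟨k, rfl⟩ : ∃ k, N = k + 1 := ⟨N - 1, by omega⟩
    have hk : k < B := hNB
    have h1 : Spec w n (i ≔ i - 1) s' 4 (fun s'' => s'' = s'.set i k) := by
      refine Wp.spec (c := i ≔ i - 1) ?_
      simp [Wp, hiN, hw]
    refine Spec.seq (h1.mono le_rfl ?_)
    rintro _ rfl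
    refine (hstep k hk s' hI hiN fun y hy hy' => hf y (by simp [Com.Assigns, hy, hy'])).frame.mono
      le_rfl ?_
    rintro s'' ⟨h2, h3⟩
    exact ⟨k, by omega, h2, by rw [h3 i hi]; simp, hk.le⟩
  · simp only [Cond.len, Ex.len]
    nlinarith
  · rintro s' ⟨⟨N, ⟨hI, hiN, -⟩, hnot⟩, hf⟩
    have : N = 0 := by simpa [hiN] using hnot
    rwa [this] at hI
end Rules

/-! ### Fields of a word and virtual words -/

/-- The parameters of a run.  A word of `lob + q + 1` significant bits is regarded as a top bit,
a middle field of `q` bits (its cell) and a low field of `lob` bits.  `2 ^ θ` cells form a virtual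
word; the hypotheses say that this is enough for a key, that every position fits into the
significant bits, and that the constant `θ` can be loaded. -/
structure Cfg where
  w : ℕ
  n : ℕ
  q : ℕ
  lob : ℕ
  θ : ℕ
  n_lt : n < 2 ^ w
  bits_le : lob + q + 1 ≤ w
  q_pos : 0 < q
  bits_le_cells : lob + q + 1 ≤ q * 2 ^ θ
  θ_lt : θ < 2 ^ w
  n_lt_bits : n < 2 ^ (lob + q + 1)

namespace Cfg
variable (C : Cfg)

/-- The bits above the cell. -/
def top (x : ℕ) : ℕ := x / 2 ^ (C.lob + C.q)
/-- The cell of a word. -/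
def mid (x : ℕ) : ℕ := x / 2 ^ C.lob % 2 ^ C.q
/-- The low field of a word. -/
def lo (x : ℕ) : ℕ := x % 2 ^ C.lob
/-- The word with the given fields. -/
def pack (f c l : ℕ) : ℕ := (f * 2 ^ C.q + c) * 2 ^ C.lob + l
/-- The number of cells that are reserved for the list of runs. -/
def base : ℕ := 2 * 2 ^ C.q

variable {C}

theorem mid_lt (x : ℕ) : C.mid x < 2 ^ C.q := Nat.mod_lt _ (by positivity)
theorem lo_lt (x : ℕ) : C.lo x < 2 ^ C.lob := Nat.mod_lt _ (by positivity)

theorem w_pos (C : Cfg) : 0 < C.w := by have := C.bits_le; omega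

theorem lo_pack {f c l : ℕ} (hl : l < 2 ^ C.lob) : C.lo (C.pack f c l) = l := by
  rw [lo, pack, Nat.mul_add_mod', Nat.mod_eq_of_lt hl]

theorem pack_div {f c l : ℕ} (hl : l < 2 ^ C.lob) : C.pack f c l / 2 ^ C.lob = f * 2 ^ C.q + c := by
  rw [pack, Nat.add_div_of_dvd_right (Dvd.intro_left _ rfl), Nat.mul_div_cancel _ (by positivity),
    Nat.div_eq_of_lt hl, Nat.add_zero]

theorem mid_pack {f c l : ℕ} (hc : c < 2 ^ C.q) (hl : l < 2 ^ C.lob) :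
    C.mid (C.pack f c l) = c := by
  rw [mid, pack_div hl, Nat.mul_add_mod', Nat.mod_eq_of_lt hc]

theorem top_pack {f c l : ℕ} (hc : c < 2 ^ C.q) (hl : l < 2 ^ C.lob) :
    C.top (C.pack f c l) = f := by
  rw [top, pow_add, ← Nat.div_div_eq_div_mul, pack_div hl,
    Nat.add_div_of_dvd_right (Dvd.intro_left _ rfl), Nat.mul_div_cancel _ (by positivity),
    Nat.div_eq_of_lt hc, Nat.add_zero]

theorem pack_fields (x : ℕ) : C.pack (C.top x) (C.mid x) (C.lo x) = x := by
  rw [pack, top, mid, lo, pow_add, ← Nat.div_div_eq_div_mul, Nat.div_add_mod', Nat.div_add_mod']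

theorem pack_lt {f c l : ℕ} (hf : f ≤ 1) (hc : c < 2 ^ C.q) (hl : l < 2 ^ C.lob) :
    C.pack f c l < 2 ^ (C.lob + C.q + 1) := by
  have h1 : f * 2 ^ C.q + c + 1 ≤ 2 * 2 ^ C.q := by nlinarith
  have h2 : (f * 2 ^ C.q + c + 1) * 2 ^ C.lob ≤ 2 * 2 ^ C.q * 2 ^ C.lob := Nat.mul_le_mul_right _ h1
  rw [pack, show C.lob + C.q + 1 = 1 + C.q + C.lob by omega, pow_add, pow_add, pow_one]
  rw [Nat.add_mul] at h2
  omega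

theorem top_le {x : ℕ} (hx : x < 2 ^ (C.lob + C.q + 1)) : C.top x ≤ 1 := by
  rw [top]
  refine Nat.le_of_lt_succ (Nat.div_lt_of_lt_mul ?_)
  rwa [pow_succ] at hx

variable (C)

/-- Replacement of the cell of the word `p`. -/
def setCell (κ : ℕ → ℕ) (p c : ℕ) : ℕ → ℕ :=
  Function.update κ p (C.pack (C.top (κ p)) c (C.lo (κ p)))

/-- Replacement of all fields but the cell of the word `p`. -/
def setLo (κ : ℕ → ℕ) (p f l : ℕ) : ℕ → ℕ :=
  Function.update κ p (C.pack f (C.mid (κ p)) l)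

/-- The position of the `k`-th cell of the virtual word `a`. -/
def ix (a k : ℕ) : ℕ := C.base + a * 2 ^ C.θ + k

/-- The number that is formed by the first `k` cells of the virtual word `a`. -/
def vwk (κ : ℕ → ℕ) (a : ℕ) : ℕ → ℕ
  | 0 => 0
  | k + 1 => vwk κ a k * 2 ^ C.q + C.mid (κ (C.ix a k))

/-- The content of the virtual word `a`. -/
def vw (κ : ℕ → ℕ) (a : ℕ) : ℕ := C.vwk κ a (2 ^ C.θ)

/-- Replacement of the first `k` cells of the virtual word `a` by the digits of `x`. -/
def vsetk (κ : ℕ → ℕ) (a : ℕ) : ℕ → ℕ → ℕ → ℕ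
  | 0, _ => κ
  | k + 1, x => vsetk (C.setCell κ (C.ix a k) (x % 2 ^ C.q)) a k (x / 2 ^ C.q)

/-- Replacement of the content of the virtual word `a`. -/
def vset (κ : ℕ → ℕ) (a x : ℕ) : ℕ → ℕ := C.vsetk κ a (2 ^ C.θ) x

/-- All keys fit into the significant bits. -/
def Bounded (κ : ℕ → ℕ) : Prop := ∀ p < C.n, κ p < 2 ^ (C.lob + C.q + 1)

/-- The virtual word `a` lies inside of the first `m` words. -/
def Fits (m a : ℕ) : Prop := C.base + (a + 1) * 2 ^ C.θ ≤ m

variable {C} {κ κ' : ℕ → ℕ} {p p' c f l a a' x m k : ℕ}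

theorem setCell_of_ne (h : p' ≠ p) : C.setCell κ p c p' = κ p' := Function.update_of_ne h _ _

theorem setLo_of_ne (h : p' ≠ p) : C.setLo κ p f l p' = κ p' := Function.update_of_ne h _ _

theorem lo_setCell : C.lo (C.setCell κ p c p') = C.lo (κ p') := by
  by_cases h : p' = p
  · rw [h, setCell, Function.update_self, lo_pack (lo_lt _)]
  · rw [setCell_of_ne h]

theorem top_setCell (hc : c < 2 ^ C.q) : C.top (C.setCell κ p c p') = C.top (κ p') := by
  by_cases h : p' = p
  · rw [h, setCell, Function.update_self, top_pack hc (lo_lt _)]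
  · rw [setCell_of_ne h]

theorem mid_setCell (hc : c < 2 ^ C.q) :
    C.mid (C.setCell κ p c p') = if p' = p then c else C.mid (κ p') := by
  split_ifs with h
  · rw [h, setCell, Function.update_self, mid_pack hc (lo_lt _)]
  · rw [setCell_of_ne h]

theorem lo_setLo (hl : l < 2 ^ C.lob) :
    C.lo (C.setLo κ p f l p') = if p' = p then l else C.lo (κ p') := by
  split_ifs with h
  · rw [h, setLo, Function.update_self, lo_pack hl]
  · rw [setLo_of_ne h]

theorem top_setLo (hl : l < 2 ^ C.lob) :
    C.top (C.setLo κ p f l p') = if p' = p then f else C.top (κ p') := by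
  split_ifs with h
  · rw [h, setLo, Function.update_self, top_pack (mid_lt _) hl]
  · rw [setLo_of_ne h]

theorem mid_setLo (hl : l < 2 ^ C.lob) : C.mid (C.setLo κ p f l p') = C.mid (κ p') := by
  by_cases h : p' = p
  · rw [h, setLo, Function.update_self, mid_pack (mid_lt _) hl]
  · rw [setLo_of_ne h]

theorem Bounded.setCell (h : C.Bounded κ) (hc : c < 2 ^ C.q) : C.Bounded (C.setCell κ p c) := by
  intro p' hp'
  by_cases hp : p' = p
  · subst hp
    rw [Cfg.setCell, Function.update_self]
    exact pack_lt (top_le (h _ hp')) hc (lo_lt _)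
  · rw [setCell_of_ne hp]; exact h _ hp'

theorem Bounded.setLo (h : C.Bounded κ) (hf : f ≤ 1) (hl : l < 2 ^ C.lob) :
    C.Bounded (C.setLo κ p f l) := by
  intro p' hp'
  by_cases hp : p' = p
  · subst hp
    rw [Cfg.setLo, Function.update_self]
    exact pack_lt hf (mid_lt _) hl
  · rw [setLo_of_ne hp]; exact h _ hp'

theorem mod_q_lt : x % 2 ^ C.q < 2 ^ C.q := Nat.mod_lt _ (by positivity)

theorem lo_vsetk : C.lo (C.vsetk κ a k x p) = C.lo (κ p) := by
  induction k generalizing κ x with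
  | zero => rfl
  | succ k ih => rw [vsetk, ih, lo_setCell]

theorem top_vsetk : C.top (C.vsetk κ a k x p) = C.top (κ p) := by
  induction k generalizing κ x with
  | zero => rfl
  | succ k ih => rw [vsetk, ih, top_setCell mod_q_lt]

theorem vsetk_of_outside (h : p < C.ix a 0 ∨ C.ix a k ≤ p) : C.vsetk κ a k x p = κ p := by
  induction k generalizing κ x with
  | zero => rfl
  | succ k ih =>
    simp only [ix] at h ih ⊢
    rw [vsetk, ih (by omega), setCell_of_ne]
    simp only [ix]; omega

theorem Bounded.vsetk (h : C.Bounded κ) : C.Bounded (C.vsetk κ a k x) := by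
  induction k generalizing κ x with
  | zero => exact h
  | succ k ih => exact ih (h.setCell mod_q_lt)

theorem Bounded.vset (h : C.Bounded κ) : C.Bounded (C.vset κ a x) := h.vsetk

theorem lo_vset : C.lo (C.vset κ a x p) = C.lo (κ p) := lo_vsetk
theorem top_vset : C.top (C.vset κ a x p) = C.top (κ p) := top_vsetk

theorem vset_of_lt_base (h : p < C.base) : C.vset κ a x p = κ p :=
  vsetk_of_outside (.inl (by simp only [ix]; omega))

theorem vset_of_le (h : C.Fits m a) (hp : m ≤ p) : C.vset κ a x p = κ p := by
  refine vsetk_of_outside (.inr ?_)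
  rw [Fits, Nat.add_mul] at h
  simp only [ix]
  omega

theorem vwk_congr (h : ∀ i < k, C.mid (κ (C.ix a i)) = C.mid (κ' (C.ix a i))) :
    C.vwk κ a k = C.vwk κ' a k := by
  induction k with
  | zero => rfl
  | succ k ih => rw [vwk, vwk, ih (fun i hi => h i (by omega)), h k (by omega)]

theorem vwk_vsetk (hx : x < 2 ^ (C.q * k)) : C.vwk (C.vsetk κ a k x) a k = x := by
  induction k generalizing κ x with
  | zero => simp at hx; simp [vwk, hx]
  | succ k ih =>
    have h1 : C.mid (C.vsetk κ a (k + 1) x (C.ix a k)) = x % 2 ^ C.q := by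
      rw [vsetk, vsetk_of_outside (.inr le_rfl), mid_setCell mod_q_lt, if_pos rfl]
    rw [vwk, h1, vsetk, ih, Nat.div_add_mod']
    rw [Nat.div_lt_iff_lt_mul (by positivity), ← pow_add]
    rwa [Nat.mul_add, Nat.mul_one] at hx

theorem vw_vset_self (hx : x < 2 ^ (C.lob + C.q + 1)) : C.vw (C.vset κ a x) a = x :=
  vwk_vsetk (hx.trans_le (Nat.pow_le_pow_right (by omega) C.bits_le_cells))

theorem vw_vset_of_ne (h : a' ≠ a) : C.vw (C.vset κ a x) a' = C.vw κ a' := by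
  refine vwk_congr fun i hi => ?_
  rw [vset, vsetk_of_outside]
  simp only [ix]
  rcases Nat.lt_or_gt_of_ne h with h | h
  · left
    have : (a' + 1) * 2 ^ C.θ ≤ a * 2 ^ C.θ := Nat.mul_le_mul_right _ h
    rw [Nat.add_mul] at this
    omega
  · right
    have : (a + 1) * 2 ^ C.θ ≤ a' * 2 ^ C.θ := Nat.mul_le_mul_right _ h
    rw [Nat.add_mul] at this
    omega

theorem vw_vset (hx : x < 2 ^ (C.lob + C.q + 1)) :
    C.vw (C.vset κ a x) a' = if a' = a then x else C.vw κ a' := by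
  split_ifs with h
  · rw [h, vw_vset_self hx]
  · exact vw_vset_of_ne h

theorem vw_setLo (hl : l < 2 ^ C.lob) : C.vw (C.setLo κ p f l) a = C.vw κ a :=
  vwk_congr fun _ _ => mid_setLo hl

theorem vw_setCell (hp : p < C.base) : C.vw (C.setCell κ p c) a = C.vw κ a :=
  vwk_congr fun i _ => by rw [setCell_of_ne]; simp only [ix]; omega

theorem vwk_mul_le {K : ℕ} (h : k < K) :
    C.vwk κ a k * 2 ^ C.q + C.mid (κ (C.ix a k)) ≤ C.vwk κ a K := by
  induction K with
  | zero => omega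
  | succ K ih =>
    rw [vwk]
    rcases Nat.lt_succ_iff_lt_or_eq.mp h with h | rfl
    · have h1 := ih h
      have : C.vwk κ a K * 1 ≤ C.vwk κ a K * 2 ^ C.q :=
        Nat.mul_le_mul_left _ (Nat.one_le_two_pow)
      omega
    · exact le_rfl

end Cfg

/-- The variables that hold the parameters have the right values. -/
structure Env (C : Cfg) (s : St) : Prop where
  n : s.r .n = C.n
  q : s.r .q = C.q
  lob : s.r .lob = C.lob
  bq : s.r .bq = C.lob + C.q
  b : s.r .b = C.lob + C.q + 1
  half : s.r .half = 2 ^ C.q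
  base : s.r .base = C.base

theorem Env.of_eq {C : Cfg} {s s' : St} (h : Env C s) (hn : s'.r .n = s.r .n)
    (hq : s'.r .q = s.r .q) (hlob : s'.r .lob = s.r .lob) (hbq : s'.r .bq = s.r .bq)
    (hb : s'.r .b = s.r .b) (hhalf : s'.r .half = s.r .half) (hbase : s'.r .base = s.r .base) :
    Env C s' :=
  ⟨hn.trans h.n, hq.trans h.q, hlob.trans h.lob, hbq.trans h.bq, hb.trans h.b,
    hhalf.trans h.half, hbase.trans h.base⟩

/-- The command does not assign to the variables that hold the parameters. -/
def Com.KeepsEnv (c : Com) : Prop :=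
  ¬ c.Assigns .n ∧ ¬ c.Assigns .q ∧ ¬ c.Assigns .lob ∧ ¬ c.Assigns .bq ∧ ¬ c.Assigns .b ∧
    ¬ c.Assigns .half ∧ ¬ c.Assigns .base

theorem Env.of_frame {C : Cfg} {c : Com} {s s' : St} (h : Env C s)
    (hf : ∀ y, ¬ c.Assigns y → s'.r y = s.r y) (hc : c.KeepsEnv) : Env C s' := by
  obtain ⟨h1, h2, h3, h4, h5, h6, h7⟩ := hc
  exact h.of_eq (hf _ h1) (hf _ h2) (hf _ h3) (hf _ h4) (hf _ h5) (hf _ h6) (hf _ h7)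

theorem Env.set {C : Cfg} {s : St} (h : Env C s) {x : Var} (v : ℕ)
    (hx : x ∉ [Var.n, .q, .lob, .bq, .b, .half, .base]) : Env C (s.set x v) := by
  simp only [List.mem_cons, List.not_mem_nil, or_false, not_or] at hx
  obtain ⟨h1, h2, h3, h4, h5, h6, h7⟩ := hx
  apply h.of_eq <;> simp [Ne.symm, *]

/-- Overwrite the cell of the word `p` with `c`.  Here and below, scratch variables are set to `0`
at the end, so that the final state does not depend on intermediate results. -/
def setCellC (p c : Ex) : Com :=
  .read .tmp p ;;
  .write p (((♯.tmp >>> ♯.bq) <<< ♯.q + c) <<< ♯.lob + Ex.low ♯.tmp ♯.lob) ;;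
  .tmp ≔ 0

/-- Overwrite the fields of the word `p` other than the cell with `f` and `l`. -/
def setLoC (p f l : Ex) : Com :=
  .read .tmp p ;;
  .write p ((f <<< ♯.q + Ex.low (♯.tmp >>> ♯.lob) ♯.q) <<< ♯.lob + l) ;;
  .tmp ≔ 0

/-- Exchange the data at two positions, but not the keys, which are in use as memory. -/
def swapData (a b : Ex) : Com :=
  .read .tmp a ;; .read .val b ;; .exch a b ;; .write a ♯.tmp ;; .write b ♯.val ;;
  .tmp ≔ 0 ;; .val ≔ 0

/-- Read the first `k` cells of the virtual word whose address is in the variable `adr`. -/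
def vreadAux (θ : ℕ) (x : Var) : ℕ → Com
  | 0 => x ≔ 0
  | k + 1 => vreadAux θ x k ;;
      .read .tmp (♯.base + ♯.adr <<< Ex.lit θ + Ex.lit k) ;;
      x ≔ ♯x <<< ♯.q + Ex.low (♯.tmp >>> ♯.lob) ♯.q

/-- Read the virtual word `a`. -/
def vread (θ : ℕ) (x : Var) (a : Ex) : Com :=
  .adr ≔ a ;; vreadAux θ x (2 ^ θ) ;; .tmp ≔ 0 ;; .adr ≔ 0

/-- Write the digits of the variable `val` into the first `k` cells of the virtual word whose
address is in the variable `adr`, last digit first. -/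
def vwriteAux (θ : ℕ) : ℕ → Com
  | 0 => .skip
  | k + 1 => setCellC (♯.base + ♯.adr <<< Ex.lit θ + Ex.lit k) (Ex.low ♯.val ♯.q) ;;
      .val ≔ ♯.val >>> ♯.q ;; vwriteAux θ k

/-- Overwrite the virtual word `a`. -/
def vwrite (θ : ℕ) (a e : Ex) : Com :=
  .adr ≔ a ;; .val ≔ e ;; vwriteAux θ (2 ^ θ) ;; .tmp ≔ 0 ;; .adr ≔ 0 ;; .val ≔ 0

@[simp] theorem setCellC_assigns (p c : Ex) (y : Var) :
    (setCellC p c).Assigns y ↔ y = .tmp := by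
  simp [setCellC, Com.Assigns]

@[simp] theorem setLoC_assigns (p f l : Ex) (y : Var) :
    (setLoC p f l).Assigns y ↔ y = .tmp := by
  simp [setLoC, Com.Assigns]

@[simp] theorem swapData_assigns (a b : Ex) (y : Var) :
    (swapData a b).Assigns y ↔ y = .tmp ∨ y = .val := by
  simp only [swapData, Com.Assigns]; tauto

@[simp] theorem vread_assigns (θ : ℕ) (x : Var) (a : Ex) (y : Var) :
    (vread θ x a).Assigns y ↔ y = x ∨ y = .tmp ∨ y = .adr := by
  have : ∀ k, (vreadAux θ x k).Assigns y → y = x ∨ y = .tmp := by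
    intro k
    induction k with
    | zero => exact .inl
    | succ k ih => simp only [vreadAux, Com.Assigns]; tauto
  have h' : ∀ k, (vreadAux θ x k).Assigns x := by
    intro k
    cases k <;> simp [vreadAux, Com.Assigns]
  have h1 := this (2 ^ θ)
  have h2 := h' (2 ^ θ)
  simp only [vread, Com.Assigns]
  constructor
  · tauto
  · rintro (rfl | h | h) <;> tauto

@[simp] theorem vwrite_assigns (θ : ℕ) (a e : Ex) (y : Var) :
    (vwrite θ a e).Assigns y ↔ y = .tmp ∨ y = .adr ∨ y = .val := by
  have : ∀ k, (vwriteAux θ k).Assigns y → y = .val ∨ y = .tmp := by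
    intro k
    induction k with
    | zero => exact False.elim
    | succ k ih => simp only [vwriteAux, Com.Assigns, setCellC_assigns]; tauto
  have h1 := this (2 ^ θ)
  simp only [vwrite, Com.Assigns]
  tauto

section Macros
variable {C : Cfg} {s : St} {Q : St → Prop}

theorem Cfg.word_lt (C : Cfg) {x : ℕ} (h : x < 2 ^ (C.lob + C.q + 1)) : x < 2 ^ C.w :=
  h.trans_le (Nat.pow_le_pow_right (by omega) C.bits_le)

theorem Cfg.pos_lt (C : Cfg) {x : ℕ} (h : x ≤ C.n) : x < 2 ^ C.w := h.trans_lt C.n_lt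

theorem wp_setCellC {p c : Ex} (hE : Env C s) (hK : C.Bounded s.key)
    (hp : ∀ v, p.Ok C.w (s.set .tmp v).r) (hpe : ∀ v, p.eval (s.set .tmp v).r = p.eval s.r)
    (hc : ∀ v, c.Ok C.w (s.set .tmp v).r) (hce : ∀ v, c.eval (s.set .tmp v).r = c.eval s.r)
    (hpn : p.eval s.r < C.n) (hcq : c.eval s.r < 2 ^ C.q)
    (hQ : Q ((s.set .tmp 0).setKey (C.setCell s.key (p.eval s.r) (c.eval s.r)))) :
    Wp C.w C.n (setCellC p c) Q s := by
  have hself : s.set .tmp (s.r .tmp) = s := by ext <;> simp; intro h; rw [h]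
  have hp0 : p.Ok C.w s.r := by simpa [hself] using hp (s.r .tmp)
  have hpk : C.pack (C.top (s.key (p.eval s.r))) (c.eval s.r) (C.lo (s.key (p.eval s.r))) <
      2 ^ C.w := C.word_lt (Cfg.pack_lt (Cfg.top_le (hK _ hpn)) hcq (Cfg.lo_lt _))
  have hpk2 := hpk
  rw [Cfg.pack] at hpk2
  have hpk3 : C.top (s.key (p.eval s.r)) * 2 ^ C.q + c.eval s.r ≤
    (C.top (s.key (p.eval s.r)) * 2 ^ C.q + c.eval s.r) * 2 ^ C.lob :=
    Nat.le_mul_of_pos_right _ (by positivity)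
  simp only [setCellC, Wp]
  refine ⟨hp0, hpn, hp _, ?_, by rwa [hpe], by simp, ?_⟩
  · simp only [Ex.ok_add, Ex.ok_shl, Ex.ok_shr, Ex.ok_var, Ex.eval_shr, Ex.eval_var, St.set_r,
      Ex.eval_add, Ex.eval_shl, Ex.ok_low, Ex.eval_low, hce, hc, hE.q, hE.lob, hE.bq, reduceCtorEq,
      if_true, if_false, true_and]
    rw [← Cfg.top, ← Cfg.lo]
    omega
  · convert hQ using 1
    ext1
    · funext y
      simp only [St.set_r, St.setKey_r, Ex.eval_zero]
      split_ifs <;> rfl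
    · simp [hE.q, hE.lob, hE.bq, hpe, hce, Cfg.setCell, Cfg.pack, Cfg.top, Cfg.lo]
    · rfl

theorem wp_setLoC {p f l : Ex} (hE : Env C s)
    (hp : ∀ v, p.Ok C.w (s.set .tmp v).r) (hpe : ∀ v, p.eval (s.set .tmp v).r = p.eval s.r)
    (hf : ∀ v, f.Ok C.w (s.set .tmp v).r) (hfe : ∀ v, f.eval (s.set .tmp v).r = f.eval s.r)
    (hl : ∀ v, l.Ok C.w (s.set .tmp v).r) (hle : ∀ v, l.eval (s.set .tmp v).r = l.eval s.r)
    (hpn : p.eval s.r < C.n) (hf1 : f.eval s.r ≤ 1) (hll : l.eval s.r < 2 ^ C.lob)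
    (hQ : Q ((s.set .tmp 0).setKey (C.setLo s.key (p.eval s.r) (f.eval s.r) (l.eval s.r)))) :
    Wp C.w C.n (setLoC p f l) Q s := by
  have hself : s.set .tmp (s.r .tmp) = s := by ext <;> simp; intro h; rw [h]
  have hp0 : p.Ok C.w s.r := by simpa [hself] using hp (s.r .tmp)
  have hpk : C.pack (f.eval s.r) (C.mid (s.key (p.eval s.r))) (l.eval s.r) <
      2 ^ C.w := C.word_lt (Cfg.pack_lt hf1 (Cfg.mid_lt _) hll)
  have hpk2 := hpk
  rw [Cfg.pack] at hpk2
  have hpk3 : f.eval s.r * 2 ^ C.q + C.mid (s.key (p.eval s.r)) ≤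
    (f.eval s.r * 2 ^ C.q + C.mid (s.key (p.eval s.r))) * 2 ^ C.lob :=
    Nat.le_mul_of_pos_right _ (by positivity)
  simp only [setLoC, Wp]
  refine ⟨hp0, hpn, hp _, ?_, by rwa [hpe], by simp, ?_⟩
  · simp only [Ex.ok_add, Ex.ok_shl, Ex.ok_shr, Ex.ok_var, Ex.eval_shr, Ex.eval_var, St.set_r,
      Ex.eval_add, Ex.eval_shl, Ex.ok_low, Ex.eval_low, hfe, hf, hle, hl, hE.q, hE.lob,
      reduceCtorEq, if_true, if_false, true_and]
    rw [← Cfg.mid]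
    omega
  · convert hQ using 1
    ext1
    · funext y
      simp only [St.set_r, St.setKey_r, Ex.eval_zero]
      split_ifs <;> rfl
    · simp [hE.q, hE.lob, hpe, hfe, hle, Cfg.setLo, Cfg.pack, Cfg.mid]
    · rfl

theorem wp_swapData {a b : Var} (ha : a ≠ .tmp ∧ a ≠ .val) (hb : b ≠ .tmp ∧ b ≠ .val)
    (han : s.r a < C.n) (hbn : s.r b < C.n)
    (hQ : Q (((s.set .tmp 0).set .val 0).setId (s.id ∘ Equiv.swap (s.r a) (s.r b)))) :
    Wp C.w C.n (swapData ♯a ♯b) Q s := by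
  simp only [swapData, Wp, Ex.ok_var, Ex.eval_var, St.set_r, St.setKey_r, St.setId_r, ha.1, ha.2,
    hb.1, hb.2, if_false, true_and, han, hbn, Ex.ok_zero, Ex.eval_zero]
  convert hQ using 1
  ext1
  · funext y
    simp only [St.set_r, St.setKey_r, St.setId_r]
    split_ifs <;> rfl
  · funext p
    simp only [St.set_key, St.setKey_key, St.setId_key, Function.update_apply, reduceCtorEq,
      if_false, if_true, Function.comp, Equiv.swap_apply_def]
    split_ifs with h1 h2 <;> simp_all
  · rfl

/-- The address computation of a cell does not overflow. -/
theorem Cfg.ix_lt {C : Cfg} {a k m : ℕ} (h : C.Fits m a) (hm : m ≤ C.n) (hk : k < 2 ^ C.θ) :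
    a * 2 ^ C.θ < 2 ^ C.w ∧ C.base + a * 2 ^ C.θ < 2 ^ C.w ∧ k < 2 ^ C.w ∧
      C.base + a * 2 ^ C.θ + k < C.n ∧ C.base + a * 2 ^ C.θ + k < 2 ^ C.w := by
  have := C.n_lt
  rw [Cfg.Fits, Nat.add_mul] at h
  omega

theorem wp_vread {x : Var} {a : Ex} {m : ℕ} (hE : Env C s)
    (hx : ¬ (x = .tmp ∨ x = .adr ∨ x = .q ∨ x = .lob ∨ x = .base)) (ha : a.Ok C.w s.r)
    (hf : C.Fits m (a.eval s.r)) (hm : m ≤ C.n) (hv : C.vw s.key (a.eval s.r) < 2 ^ C.w)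
    (hQ : Q (((s.set .tmp 0).set .adr 0).set x (C.vw s.key (a.eval s.r)))) :
    Wp C.w C.n (vread C.θ x a) Q s := by
  simp only [not_or] at hx
  obtain ⟨hx1, hx2, hx3, hx4, hx5⟩ := hx
  have aux : ∀ k ≤ 2 ^ C.θ, ∀ (R : St → Prop) (s : St), Env C s → C.Fits m (s.r .adr) →
      C.vw s.key (s.r .adr) < 2 ^ C.w →
      (∀ u, R ((s.set .tmp u).set x (C.vwk s.key (s.r .adr) k))) →
      Wp C.w C.n (vreadAux C.θ x k) R s := by
    intro k
    induction k with
    | zero =>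
      intro _ R s hE hf hv hR
      refine ⟨by simp, ?_⟩
      convert hR (s.r .tmp) using 1
      ext1
      · funext y
        simp only [St.set_r, Cfg.vwk, Ex.eval_zero]
        split_ifs <;> simp_all
      · rfl
      · rfl
    | succ k ih =>
      intro hk R s hE hf hv hR
      obtain ⟨i1, i2, i3, i4, i5⟩ := Cfg.ix_lt hf hm (Nat.lt_of_succ_le hk)
      refine ih (by omega) _ s hE hf hv fun u => ?_
      have h2 : C.vwk s.key (s.r .adr) k * 2 ^ C.q + C.mid (s.key (C.ix (s.r .adr) k)) ≤
        C.vw s.key (s.r .adr) := Cfg.vwk_mul_le hk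
      rw [Cfg.ix, Cfg.mid] at h2
      simp only [Wp, Ex.ok_add, Ex.ok_shl, Ex.ok_var, Ex.ok_lit, Ex.eval_var, Ex.eval_lit,
        Ex.eval_shl, Ex.eval_add, St.set_r, St.set_key, Ne.symm hx2, Ne.symm hx5, reduceCtorEq,
        if_false, if_true, hE.base, hE.q, hE.lob, Ne.symm hx3, Ne.symm hx4, Ne.symm hx1, hx1,
        Ex.ok_low, Ex.ok_shr, Ex.eval_low, Ex.eval_shr, true_and, C.θ_lt]
      refine ⟨⟨⟨i1, i2⟩, i3, i5⟩, i4, ⟨by omega, by omega⟩, ?_⟩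
      convert hR (s.key (C.base + s.r .adr * 2 ^ C.θ + k)) using 1
      ext1
      · funext y
        simp only [St.set_r, Cfg.vwk, Cfg.mid, Cfg.ix]
        split_ifs <;> rfl
      · rfl
      · rfl
  refine ⟨ha, ?_⟩
  refine aux _ le_rfl _ _ ?_ (by simpa using hf) (by simpa using hv) fun u => ?_
  · exact hE.of_eq (by simp) (by simp) (by simp) (by simp) (by simp) (by simp) (by simp)
  · simp only [Wp, Ex.ok_zero, true_and, Ex.eval_zero]
    convert hQ using 1
    ext1
    · funext y
      simp only [St.set_r, Cfg.vw, if_true, St.set_key]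
      split_ifs <;> simp_all
    · rfl
    · rfl

theorem wp_vwrite {a e : Ex} {m : ℕ} (hE : Env C s) (hK : C.Bounded s.key) (ha : a.Ok C.w s.r)
    (he : ∀ v, e.Ok C.w (s.set .adr v).r) (hee : ∀ v, e.eval (s.set .adr v).r = e.eval s.r)
    (hf : C.Fits m (a.eval s.r)) (hm : m ≤ C.n)
    (hQ : Q ((((s.set .tmp 0).set .adr 0).set .val 0).setKey
      (C.vset s.key (a.eval s.r) (e.eval s.r)))) :
    Wp C.w C.n (vwrite C.θ a e) Q s := by
  have aux : ∀ k ≤ 2 ^ C.θ, ∀ (R : St → Prop) (s : St), Env C s → C.Bounded s.key →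
      C.Fits m (s.r .adr) →
      (∀ u v, R (((s.set .tmp u).set .val v).setKey
        (C.vsetk s.key (s.r .adr) k (s.r .val)))) →
      Wp C.w C.n (vwriteAux C.θ k) R s := by
    intro k
    induction k with
    | zero =>
      intro _ R s hE hK hf hR
      show R s
      convert hR (s.r .tmp) (s.r .val) using 1
      ext1 <;> simp [Cfg.vsetk]
      funext y; simp
      split_ifs with h1 h2 <;> simp_all
    | succ k ih =>
      intro hk R s hE hK hf hR
      obtain ⟨i1, i2, i3, i4, i5⟩ := Cfg.ix_lt hf hm (Nat.lt_of_succ_le hk)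
      refine wp_setCellC hE hK (by simp [hE.base, C.θ_lt, *]) (by simp) (by simp) (by simp)
        (by simpa [hE.base] using i4) (by simpa [hE.q] using Cfg.mod_q_lt) ?_
      refine ⟨by simp, ih (by omega) _ _ ?_ ?_ (by simpa using hf) fun u v => ?_⟩
      · exact hE.of_eq (by simp) (by simp) (by simp) (by simp) (by simp) (by simp) (by simp)
      · simp only [St.set_key, St.setKey_key]
        exact hK.setCell (by simpa [hE.q] using Cfg.mod_q_lt)
      · convert hR u v using 1
        ext1
        · funext y
          simp only [St.set_r, St.setKey_r]
          split_ifs <;> rfl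
        · simp [Cfg.vsetk, Cfg.ix, hE.q, hE.base]
        · rfl
  refine ⟨ha, he _, ?_⟩
  refine aux _ le_rfl _ _ ?_ (by simpa using hK) (by simpa using hf) fun u v => ?_
  · exact hE.of_eq (by simp) (by simp) (by simp) (by simp) (by simp) (by simp) (by simp)
  · simp only [Wp, Ex.ok_zero, true_and, Ex.eval_zero]
    convert hQ using 1
    ext1
    · funext y
      simp only [St.set_r, St.setKey_r]
      split_ifs <;> rfl
    · simp [Cfg.vset, hee]
    · rfl

end Macros

/-! ### Compression of a sorted list of keys -/

namespace Cfg
variable (C : Cfg)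

/-- In a list of `N` keys, position `p` is the last one of a run of equal cells. -/
def flag (κ : ℕ → ℕ) (N p : ℕ) : ℕ :=
  if p + 1 = N ∨ C.mid (κ p) ≠ C.mid (κ (p + 1)) then 1 else 0

/-- The number of runs that end before position `p`. -/
def cnt (κ : ℕ → ℕ) (N p : ℕ) : ℕ := ∑ i ∈ Finset.range p, C.flag κ N i

/-- The words `key` represent the list `κ 0, …, κ (N - 1)` in compressed form: the top bits mark
the ends of runs of equal cells, and the cells of the runs are listed in the cells of the first
words.  The top bits of `κ` are not represented. -/
structure Packed (κ : ℕ → ℕ) (N : ℕ) (key : ℕ → ℕ) : Prop where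
  lo : ∀ p < N, C.lo (key p) = C.lo (κ p)
  top : ∀ p < N, C.top (key p) = C.flag κ N p
  run : ∀ p < N, C.flag κ N p = 1 → C.mid (key (C.cnt κ N p)) = C.mid (κ p)

variable {C} {κ : ℕ → ℕ} {N p : ℕ}

theorem flag_le : C.flag κ N p ≤ 1 := by
  rw [flag]; split_ifs <;> omega

theorem cnt_succ : C.cnt κ N (p + 1) = C.cnt κ N p + C.flag κ N p := Finset.sum_range_succ _ _

theorem cnt_zero : C.cnt κ N 0 = 0 := rfl

theorem cnt_le : C.cnt κ N p ≤ p := by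
  induction p with
  | zero => rfl
  | succ p ih => rw [cnt_succ]; have := flag_le (C := C) (κ := κ) (N := N) (p := p); omega

/-- A run of a sorted list ends where the upper part of the keys increases, so that the number
of runs is bounded by the number of values of the upper part. -/
theorem cnt_le_div (hs : ∀ a b, a < b → b < N → κ a ≤ κ b) (hp : p < N) :
    C.cnt κ N p ≤ κ p / 2 ^ C.lob := by
  induction p with
  | zero => simp [cnt_zero]
  | succ p ih =>
    have h1 := ih (by omega)
    have h2 : κ p / 2 ^ C.lob ≤ κ (p + 1) / 2 ^ C.lob :=
      Nat.div_le_div_right (hs _ _ (by omega) hp)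
    rw [cnt_succ, flag]
    split_ifs with h
    · rcases h with h | h
      · omega
      · have : κ p / 2 ^ C.lob ≠ κ (p + 1) / 2 ^ C.lob := fun he => h (by rw [mid, mid, he])
        omega
    · omega

theorem cnt_lt_base (hs : ∀ a b, a < b → b < N → κ a ≤ κ b)
    (hb : ∀ p < N, κ p < 2 ^ (C.lob + C.q + 1)) (hp : p < N) : C.cnt κ N p < C.base := by
  refine (cnt_le_div hs hp).trans_lt ?_
  rw [Nat.div_lt_iff_lt_mul (by positivity), base]
  have := hb p hp
  rwa [show 2 ^ (C.lob + C.q + 1) = 2 * 2 ^ C.q * 2 ^ C.lob by ring] at this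

theorem cnt_le_base (hs : ∀ a b, a < b → b < N → κ a ≤ κ b)
    (hb : ∀ p < N, κ p < 2 ^ (C.lob + C.q + 1)) (hp : p ≤ N) : C.cnt κ N p ≤ C.base := by
  cases p with
  | zero => simp [cnt_zero]
  | succ p =>
    have := cnt_lt_base hs hb (show p < N by omega)
    have := flag_le (C := C) (κ := κ) (N := N) (p := p)
    rw [cnt_succ]
    omega

theorem cnt_mono {p' : ℕ} (h : p ≤ p') : C.cnt κ N p ≤ C.cnt κ N p' :=
  Finset.sum_le_sum_of_subset (Finset.range_mono h)

theorem cnt_lt_cnt {p' : ℕ} (h : p < p') (hf : C.flag κ N p = 1) :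
    C.cnt κ N p < C.cnt κ N p' := by
  have h1 := cnt_mono (C := C) (κ := κ) (N := N) (show p + 1 ≤ p' from h)
  rw [cnt_succ, hf] at h1
  omega

end Cfg

/-- Read the key at position `i` and find out whether a run ends there. -/
def findFlag : Com :=
  .read .x ♯.i ;;
  .f ≔ 1 ;;
  .y ≔ ♯.i + 1 ;;
  .ite (.lt ♯.y ♯.m)
    (.read .y ♯.y ;;
      .ite (.eq (.low (♯.x >>> ♯.lob) ♯.q) (.low (♯.y >>> ♯.lob) ♯.q)) (.f ≔ 0) .skip)
    .skip

/-- One step of the compression, at position `i`.  The variable `r` counts the runs, and `z` the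
keys whose top bit is `0`; they form an initial segment. -/
def compressBody : Com :=
  findFlag ;;
  .ite (.eq ♯.f 1) (setCellC ♯.r (.low (♯.x >>> ♯.lob) ♯.q) ;; .r ≔ ♯.r + 1) .skip ;;
  .ite (.eq (♯.x >>> ♯.bq) 0) (.z ≔ ♯.i + 1) .skip ;;
  setLoC ♯.i ♯.f (.low ♯.x ♯.lob)

/-- Compression of the first `m` keys, which are sorted. -/
def compress : Com :=
  .r ≔ 0 ;; .z ≔ 0 ;; forUp .i .m compressBody

theorem spec_asg_zero {w n : ℕ} {s : St} (x : Var) :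
    Spec w n (x ≔ 0) s 2 (fun s' => s' = s.set x 0) :=
  Wp.spec (c := _ ≔ _) (by simp [Wp])

/-- The state after `k` steps of the compression of the list `κ`. -/
structure CompressInv (C : Cfg) (κ ι : ℕ → ℕ) (m k : ℕ) (s : St) : Prop where
  bounded : C.Bounded s.key
  lo : ∀ p < k, C.lo (s.key p) = C.lo (κ p)
  top : ∀ p < k, C.top (s.key p) = C.flag κ m p
  run : ∀ p < k, C.flag κ m p = 1 → C.mid (s.key (C.cnt κ m p)) = C.mid (κ p)
  raw : ∀ p, k ≤ p → s.key p = κ p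
  id : s.id = ι
  r : s.r .r = C.cnt κ m k
  z : ∀ p < k, p < s.r .z ↔ κ p < 2 ^ (C.lob + C.q)
  z_le : s.r .z ≤ k

/-- The cell of a run is written to a position that is at most `k`; the cell that it overwrites has
been read before. -/
theorem wp_compressBody {C : Cfg} {s : St} {m k : ℕ} {κ ι : ℕ → ℕ} (hE : Env C s)
    (hm : s.r .m = m) (hmn : m ≤ C.n)
    (hs : ∀ a b, a < b → b < m → κ a ≤ κ b) (hk : k < m) (hi : s.r .i = k)
    (hI : CompressInv C κ ι m k s) :
    Wp C.w C.n compressBody (fun s' => CompressInv C κ ι m (k + 1) (s'.set .i (k + 1))) s := by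
  obtain ⟨a1, a2, a3, a4, a5, a6, a7, a8, a9⟩ := hI
  have hw := C.w_pos
  have hkw : k + 1 < 2 ^ C.w := C.pos_lt (by omega)
  have hck : C.cnt κ m k ≤ k := Cfg.cnt_le
  refine Wp.seq_frame (Q := fun s' => s'.key = s.key ∧ s'.id = ι ∧ s'.r .x = κ k ∧
    s'.r .f = C.flag κ m k) ?_ fun s1 ⟨b1, b2, b3, b4⟩ f1 => ?_
  · simp only [findFlag, Wp, Cfg.flag, Cfg.mid]
    simp [hi, hm, hE.q, hE.lob, hw, a5, hkw, a6]
    refine ⟨by omega, fun h => ⟨by omega, fun h' => ?_, fun h' => ?_⟩, fun h => ?_⟩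
    · simp [h', h.ne]
    · simp [h']
    · simp [show k + 1 = m by omega]
  have e1 := hE.of_frame f1 (by simp [Com.KeepsEnv, findFlag, Com.Assigns])
  have i1 : s1.r .i = k := by rw [f1 _ (by simp [findFlag, Com.Assigns]), hi]
  have r1 : s1.r .r = C.cnt κ m k := by rw [f1 _ (by simp [findFlag, Com.Assigns]), a7]
  have z1 : s1.r .z = s.r .z := f1 _ (by simp [findFlag, Com.Assigns])
  clear f1
  refine Wp.seq_frame (Q := fun s' => s'.key = (if C.flag κ m k = 1 then
      C.setCell s.key (C.cnt κ m k) (C.mid (κ k)) else s.key) ∧ s'.id = ι ∧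
    s'.r .r = C.cnt κ m (k + 1)) ?_ fun s2 ⟨c1, c2, c3⟩ f2 => ?_
  · refine ⟨by simp [hw], fun h => ?_, fun h => ?_⟩
    · simp only [Cond.holds_eq, Ex.eval_var, b4, Ex.eval_one] at h
      refine wp_setCellC e1 (by rwa [b1]) (by simp) (by simp) (by simp) (by simp)
        (by simp [r1]; omega) (by simpa [e1.q] using Cfg.mod_q_lt) ?_
      simp [Wp, r1, h, Cfg.cnt_succ, hw, b1, b2, b3, Cfg.mid, e1.lob, e1.q]
      omega
    · simp only [Cond.holds_eq, Ex.eval_var, b4, Ex.eval_one] at h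
      have := Cfg.flag_le (C := C) (κ := κ) (N := m) (p := k)
      simp [Wp, h, b1, b2, r1, Cfg.cnt_succ]
      omega
  have e2 := e1.of_frame f2 (by simp [Com.KeepsEnv, Com.Assigns])
  have i2 : s2.r .i = k := by rw [f2 _ (by simp [Com.Assigns]), i1]
  have x2 : s2.r .x = κ k := by rw [f2 _ (by simp [Com.Assigns]), b3]
  have ff2 : s2.r .f = C.flag κ m k := by rw [f2 _ (by simp [Com.Assigns]), b4]
  have z2 : s2.r .z = s.r .z := by rw [f2 _ (by simp [Com.Assigns]), z1]
  clear f2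
  refine Wp.seq_frame (Q := fun s' => s'.key = s2.key ∧ s'.id = ι ∧
    (∀ p < k + 1, p < s'.r .z ↔ κ p < 2 ^ (C.lob + C.q)) ∧ s'.r .z ≤ k + 1) ?_
    fun s3 ⟨d1, d2, d3, d4⟩ f3 => ?_
  · refine ⟨by simp, fun h => ?_, fun h => ?_⟩
    · simp [x2, e2.bq] at h
      simp [Wp, hw, i2, hkw, c2]
      intro p hp
      rcases (show p < k ∨ p = k by omega) with hp | rfl
      · have := hs p k hp hk
        constructor
        · intro; omega
        · intro; omega
      · simp [h]
    · simp [x2, e2.bq] at h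
      simp [Wp, c2, z2]
      refine ⟨fun p hp => ?_, by omega⟩
      rcases (show p < k ∨ p = k by omega) with hp | rfl
      · exact a8 p hp
      · constructor
        · intro; omega
        · intro; omega
  have e3 := e2.of_frame f3 (by simp [Com.KeepsEnv, Com.Assigns])
  have i3 : s3.r .i = k := by rw [f3 _ (by simp [Com.Assigns]), i2]
  have x3 : s3.r .x = κ k := by rw [f3 _ (by simp [Com.Assigns]), x2]
  have ff3 : s3.r .f = C.flag κ m k := by rw [f3 _ (by simp [Com.Assigns]), ff2]
  have r3 : s3.r .r = C.cnt κ m (k + 1) := by rw [f3 _ (by simp [Com.Assigns]), c3]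
  clear f3
  have hl : κ k % 2 ^ C.lob < 2 ^ C.lob := Cfg.lo_lt _
  refine wp_setLoC e3 (by simp) (by simp) (by simp) (by simp) (by simp) (by simp)
    (by simp [i3]; omega) (by simpa [ff3] using Cfg.flag_le) (by simpa [e3.lob, x3] using hl) ?_
  simp only [Ex.eval_var, i3, ff3, Ex.eval_low, x3, e3.lob, d1, c1]
  set key1 := if C.flag κ m k = 1 then C.setCell s.key (C.cnt κ m k) (C.mid (κ k)) else s.key
    with hkey1
  have g1 : ∀ p, C.lo (key1 p) = C.lo (s.key p) := by
    intro p; rw [hkey1]; split_ifs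
    · exact Cfg.lo_setCell
    · rfl
  have g2 : ∀ p, C.top (key1 p) = C.top (s.key p) := by
    intro p; rw [hkey1]; split_ifs
    · exact Cfg.top_setCell (Cfg.mid_lt _)
    · rfl
  constructor
  · simp only [St.set_key, St.setKey_key]
    refine Cfg.Bounded.setLo ?_ Cfg.flag_le hl
    rw [hkey1]; split_ifs
    · exact a1.setCell (Cfg.mid_lt _)
    · exact a1
  · intro p hp
    simp only [St.set_key, St.setKey_key]
    rw [Cfg.lo_setLo hl, g1]
    split_ifs with h
    · rw [h, Cfg.lo]
    · exact a2 p (by omega)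
  · intro p hp
    simp only [St.set_key, St.setKey_key]
    rw [Cfg.top_setLo hl, g2]
    split_ifs with h
    · rw [h]
    · exact a3 p (by omega)
  · intro p hp hf
    simp only [St.set_key, St.setKey_key]
    rw [Cfg.mid_setLo hl, hkey1]
    rcases (show p < k ∨ p = k by omega) with hp | rfl
    · have := Cfg.cnt_lt_cnt (C := C) hp hf
      split_ifs
      · rw [Cfg.mid_setCell (Cfg.mid_lt _), if_neg (by omega), a4 p hp hf]
      · exact a4 p hp hf
    · rw [if_pos hf, Cfg.mid_setCell (Cfg.mid_lt _), if_pos rfl]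
  · intro p hp
    simp only [St.set_key, St.setKey_key]
    rw [Cfg.setLo_of_ne (by omega), hkey1]
    split_ifs
    · rw [Cfg.setCell_of_ne (by omega), a5 p (by omega)]
    · exact a5 p (by omega)
  · simpa using d2
  · simpa using r3
  · simpa using d3
  · simpa using d4

/-- Compression takes linear time, and it leaves all cells from the first `base` ones on free for
other purposes. -/
theorem compress_spec {C : Cfg} {s : St} {m : ℕ} (hE : Env C s) (hK : C.Bounded s.key)
    (hm : s.r .m = m) (hmn : m ≤ C.n) (hs : ∀ a b, a < b → b < m → s.key a ≤ s.key b) :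
    Spec C.w C.n compress s ((m + 2) * (compressBody.cost + 12)) fun s' =>
      C.Bounded s'.key ∧ C.Packed s.key m s'.key ∧ (∀ p, m ≤ p → s'.key p = s.key p) ∧
      s'.id = s.id ∧ s'.r .r = C.cnt s.key m m ∧
      (∀ p < m, p < s'.r .z ↔ s.key p < 2 ^ (C.lob + C.q)) := by
  refine (Spec.seq ((spec_asg_zero _).mono le_rfl ?_)).mono
    (T := 2 + (2 + (m + 2) * (compressBody.cost + 8))) (by nlinarith) fun _ h => h
  rintro _ rfl
  refine Spec.seq ((spec_asg_zero _).mono le_rfl ?_)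
  rintro _ rfl
  refine (Spec.for_up (B := m) (T := compressBody.cost) (CompressInv C s.key s.id m)
    (by simp [hm]) (C.pos_lt hmn) (by simp) (by simp [compressBody, findFlag, Com.Assigns])
    (by simp [compressBody, findFlag, Com.Assigns]) ?_ ?_).mono le_rfl ?_
  · constructor <;> simp [Cfg.cnt_zero, hK]
  · intro k hk t hI hik hf
    have e : ∀ y, y ≠ .i → ¬ compressBody.Assigns y → t.r y = s.r y := by
      intro y hy hy'
      rw [hf y hy hy']
      simp [compressBody, Com.Assigns] at hy'
      simp [hy']
    have hEt : Env C t := by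
      apply hE.of_eq <;> exact e _ (by simp) (by simp [compressBody, findFlag, Com.Assigns])
    have hmt : t.r .m = m := by
      rw [e _ (by simp) (by simp [compressBody, findFlag, Com.Assigns]), hm]
    exact (wp_compressBody hEt hmt hmn hs hk hik hI).spec
  · intro s' h
    exact ⟨h.bounded, ⟨h.lo, h.top, h.run⟩, h.raw, h.id, h.r, h.z⟩

/-! ### Ranks -/

/-- The rank of `x` among the numbers below `d`, with respect to the order given by `f`. -/
def rank (d : ℕ) (f : ℕ → ℕ) (x : ℕ) : ℕ := ((Finset.range d).filter fun y => f y < f x).card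

section Rank
variable {d : ℕ} {f : ℕ → ℕ} {x y : ℕ}

theorem rank_lt_rank (hy : y < d) (h : f y < f x) : rank d f y < rank d f x := by
  refine Finset.card_lt_card ⟨fun z hz => ?_, fun hsub => ?_⟩
  · simp only [Finset.mem_filter] at hz ⊢
    exact ⟨hz.1, hz.2.trans h⟩
  · have := hsub (Finset.mem_filter.mpr ⟨Finset.mem_range.mpr hy, h⟩)
    simp at this

theorem rank_lt (hx : x < d) : rank d f x < d := by
  have : rank d f x < (Finset.range d).card := by
    refine Finset.card_lt_card ⟨Finset.filter_subset _ _, fun hsub => ?_⟩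
    have := hsub (Finset.mem_range.mpr hx)
    simp at this
  simpa using this

theorem rank_lt_rank_iff (hf : Set.InjOn f (Set.Iio d)) (hx : x < d) (hy : y < d) :
    rank d f y < rank d f x ↔ f y < f x := by
  refine ⟨fun h => ?_, rank_lt_rank hy⟩
  by_contra hle
  rcases (not_lt.mp hle).lt_or_eq with h' | h'
  · exact absurd (rank_lt_rank hx h') (by omega)
  · rw [hf hx hy h'] at h
    omega

theorem rank_inj (hf : Set.InjOn f (Set.Iio d)) (hx : x < d) (hy : y < d)
    (h : rank d f x = rank d f y) : x = y := by
  have h1 := rank_lt_rank_iff hf hx hy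
  have h2 := rank_lt_rank_iff hf hy hx
  exact hf hx hy (by omega)

theorem exists_rank_eq (hf : Set.InjOn f (Set.Iio d)) {j : ℕ} (hj : j < d) :
    ∃ x < d, rank d f x = j := by
  have := Finset.surj_on_of_inj_on_of_card_le (s := Finset.range d) (t := Finset.range d)
    (fun x _ => rank d f x) (fun x hx => by simpa using rank_lt (by simpa using hx))
    (fun x y hx hy h => rank_inj hf (by simpa using hx) (by simpa using hy) h) le_rfl j (by simpa)
  obtain ⟨x, hx, h⟩ := this
  exact ⟨x, by simpa using hx, h.symm⟩

/-- Pairs whose second component is below `d` are compared lexicographically by comparing single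
numbers. -/
theorem lex_lt_iff {a b : ℕ} (hx : x < d) (hy : y < d) :
    a * d + y < b * d + x ↔ a < b ∨ a = b ∧ y < x := by
  constructor
  · intro h
    rcases lt_trichotomy a b with h' | rfl | h'
    · exact .inl h'
    · exact .inr ⟨rfl, by omega⟩
    · have : (b + 1) * d ≤ a * d := Nat.mul_le_mul_right _ h'
      rw [Nat.add_mul] at this
      omega
  · rintro (h | ⟨rfl, h⟩)
    · have : (a + 1) * d ≤ b * d := Nat.mul_le_mul_right _ h
      rw [Nat.add_mul] at this
      omega
    · omega

/-- The order of the indices below `d` by the key `key`, ties being broken by the index. -/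
def lexOrder (d : ℕ) (key : ℕ → ℕ) (y : ℕ) : ℕ := key y * d + y

theorem lexOrder_injOn (key : ℕ → ℕ) : Set.InjOn (lexOrder d key) (Set.Iio d) := by
  intro x hx y hy h
  have h1 := lex_lt_iff (a := key x) (b := key y) hy hx
  have h2 := lex_lt_iff (a := key y) (b := key x) hx hy
  simp only [lexOrder] at h
  omega

/-- Counting the elements with a smaller digit and those with the same digit that come earlier
gives the rank with respect to the digit and, for equal digits, the former order. -/
theorem rank_refine {f' dig : ℕ → ℕ}
    (hf' : ∀ x < d, ∀ y < d, f' y < f' x ↔ dig y < dig x ∨ dig y = dig x ∧ f y < f x)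
    (hf : Set.InjOn f (Set.Iio d)) (hx : x < d) :
    rank d f' x = ((Finset.range d).filter fun y => dig y < dig x).card +
      ((Finset.range d).filter fun y => dig y = dig x ∧ rank d f y < rank d f x).card := by
  rw [rank, ← Finset.card_union_of_disjoint, ← Finset.filter_or]
  · congr 1
    refine Finset.filter_congr fun y hy => ?_
    have hy : y < d := by simpa using hy
    rw [hf' x hx y hy, rank_lt_rank_iff hf hx hy]
  · refine Finset.disjoint_filter.mpr fun y _ h1 h2 => ?_
    omega

/-- The elements with property `P` that have been visited are counted, when the elements are
visited in the order of `f` and `x` is visited. -/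
theorem card_rank_succ (P : ℕ → Prop) [DecidablePred P] (hf : Set.InjOn f (Set.Iio d))
    (hx : x < d) :
    ((Finset.range d).filter fun y => P y ∧ rank d f y < rank d f x + 1).card =
      ((Finset.range d).filter fun y => P y ∧ rank d f y < rank d f x).card +
        if P x then 1 else 0 := by
  have hiff : ∀ y < d, rank d f y < rank d f x + 1 ↔ rank d f y < rank d f x ∨ y = x := by
    intro y hy
    constructor
    · intro h
      rcases Nat.lt_succ_iff_lt_or_eq.mp h with h | h
      · exact .inl h
      · exact .inr (rank_inj hf hy hx h)
    · rintro (h | rfl) <;> omega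
  split_ifs with hP
  · rw [← Finset.card_insert_of_notMem (a := x) (by simp)]
    congr 1
    ext y
    simp only [Finset.mem_filter, Finset.mem_range, Finset.mem_insert]
    constructor
    · rintro ⟨h1, h2, h3⟩
      rcases (hiff y h1).mp h3 with h | h
      · exact .inr ⟨h1, h2, h⟩
      · exact .inl h
    · rintro (rfl | ⟨h1, h2, h3⟩)
      · exact ⟨hx, hP, by omega⟩
      · exact ⟨h1, h2, by omega⟩
  · rw [Nat.add_zero]
    refine congrArg _ (Finset.filter_congr fun y hy => ?_)
    rw [hiff y (by simpa using hy)]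
    constructor
    · rintro ⟨h1, h | rfl⟩
      · exact ⟨h1, h⟩
      · exact absurd h1 hP
    · exact fun h => ⟨h.1, .inl h.2⟩

theorem card_filter_lt_succ (dig : ℕ → ℕ) (g : ℕ) :
    ((Finset.range d).filter fun y => dig y < g + 1).card =
      ((Finset.range d).filter fun y => dig y < g).card +
        ((Finset.range d).filter fun y => dig y = g).card := by
  rw [← Finset.card_union_of_disjoint, ← Finset.filter_or]
  · congr 1
    exact Finset.filter_congr fun y _ => by omega
  · exact Finset.disjoint_filter.mpr fun y _ h1 h2 => by omega

theorem card_filter_range_succ (dig : ℕ → ℕ) (g k : ℕ) :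
    ((Finset.range (k + 1)).filter fun y => dig y = g).card =
      ((Finset.range k).filter fun y => dig y = g).card + if dig k = g then 1 else 0 := by
  rw [Finset.range_add_one, Finset.filter_insert]
  split_ifs
  · rw [Finset.card_insert_of_notMem (by simp)]
  · rfl

theorem card_filter_range_le (k : ℕ) (P : ℕ → Prop) [DecidablePred P] :
    ((Finset.range k).filter P).card ≤ k :=
  (Finset.card_filter_le _ _).trans (by simp)

end Rank

/-! ### The memory of a round -/

/-- The sizes in a round: a sorted prefix of `m` elements is extended by a chunk of `d` elements
with the help of `7` arrays of `D = 2 ^ e` virtual words, and the first `base` cells are left to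
the list of runs.  The arrays `0` and `1` hold lists of chunk indices, and array `5` the counters
of the radix sort.  The arrays `2`, `3` and `4` hold the sorted keys of the chunk, the positions of
its elements in sorted order and the inverse table, and array `6` the list of runs of the merged
list. -/
structure Sizes (C : Cfg) (m d e : ℕ) : Prop where
  le_n : m + d ≤ C.n
  fits : C.base + 7 * 2 ^ e * 2 ^ C.θ ≤ m
  base_le : C.base ≤ 2 ^ e
  d_le : d ≤ 2 ^ e

/-- The variables that do not change during a round have the right values. -/
structure Ctx (C : Cfg) (m d e : ℕ) (s : St) : Prop extends Env C s where
  m : s.r .m = m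
  d : s.r .d = d
  D : s.r .D = 2 ^ e
  e : s.r .e = e

/-- The command does not assign to the variables that are fixed during a round. -/
def Com.KeepsCtx (c : Com) : Prop :=
  c.KeepsEnv ∧ ¬ c.Assigns .m ∧ ¬ c.Assigns .d ∧ ¬ c.Assigns .D ∧ ¬ c.Assigns .e

theorem Ctx.of_frame {C : Cfg} {m d e : ℕ} {c : Com} {s s' : St} (h : Ctx C m d e s)
    (hf : ∀ y, ¬ c.Assigns y → s'.r y = s.r y) (hc : c.KeepsCtx) : Ctx C m d e s' := by
  obtain ⟨h0, h1, h2, h3, h4⟩ := hc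
  exact ⟨h.toEnv.of_frame hf h0, (hf _ h1).trans h.m, (hf _ h2).trans h.d, (hf _ h3).trans h.D,
    (hf _ h4).trans h.e⟩

theorem Ctx.set {C : Cfg} {m d e : ℕ} {s : St} (h : Ctx C m d e s) {x : Var} (v : ℕ)
    (hx : x ∉ [Var.n, .q, .lob, .bq, .b, .half, .base, .m, .d, .D, .e]) :
    Ctx C m d e (s.set x v) := by
  simp only [List.mem_cons, List.not_mem_nil, or_false, not_or] at hx
  obtain ⟨h1, h2, h3, h4, h5, h6, h7, h8, h9, h10, h11⟩ := hx
  refine ⟨h.toEnv.set v (by simp [*]), ?_, ?_, ?_, ?_⟩ <;>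
    simp [Ne.symm, *, h.m, h.d, h.D, h.e]

/-- The words `κ'` result from `κ` by changes of virtual words inside of the first `m` words. -/
structure VStep (C : Cfg) (m : ℕ) (κ κ' : ℕ → ℕ) : Prop where
  lo : ∀ p, C.lo (κ' p) = C.lo (κ p)
  top : ∀ p, C.top (κ' p) = C.top (κ p)
  low : ∀ p < C.base, κ' p = κ p
  high : ∀ p, m ≤ p → κ' p = κ p
  bounded : C.Bounded κ'

theorem VStep.refl {C : Cfg} {m : ℕ} {κ : ℕ → ℕ} (h : C.Bounded κ) : VStep C m κ κ :=
  ⟨fun _ => rfl, fun _ => rfl, fun _ _ => rfl, fun _ _ => rfl, h⟩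

theorem VStep.trans {C : Cfg} {m : ℕ} {κ κ' κ'' : ℕ → ℕ} (h : VStep C m κ κ')
    (h' : VStep C m κ' κ'') : VStep C m κ κ'' :=
  ⟨fun p => (h'.lo p).trans (h.lo p), fun p => (h'.top p).trans (h.top p),
    fun p hp => (h'.low p hp).trans (h.low p hp), fun p hp => (h'.high p hp).trans (h.high p hp),
    h'.bounded⟩

theorem VStep.vset {C : Cfg} {m : ℕ} {κ κ' : ℕ → ℕ} (h : VStep C m κ κ') {a : ℕ}
    (ha : C.Fits m a) (x : ℕ) : VStep C m κ (C.vset κ' a x) :=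
  ⟨fun p => Cfg.lo_vset.trans (h.lo p), fun p => Cfg.top_vset.trans (h.top p),
    fun p hp => (Cfg.vset_of_lt_base hp).trans (h.low p hp),
    fun p hp => (Cfg.vset_of_le ha hp).trans (h.high p hp), h.bounded.vset⟩

theorem VStep.packed {C : Cfg} {m N : ℕ} {κ key key' : ℕ → ℕ} (h : VStep C m key key')
    (hp : C.Packed κ N key) (hs : ∀ a b, a < b → b < N → κ a ≤ κ b)
    (hb : ∀ p < N, κ p < 2 ^ (C.lob + C.q + 1)) : C.Packed κ N key' :=
  ⟨fun p h' => (h.lo p).trans (hp.lo p h'), fun p h' => (h.top p).trans (hp.top p h'),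
    fun p h' hf => by rw [h.low _ (Cfg.cnt_lt_base hs hb h'), hp.run p h' hf]⟩

namespace Sizes
variable {C : Cfg} {m d e : ℕ} (h : Sizes C m d e)
include h

theorem D_le : 7 * 2 ^ e ≤ m := by
  have h1 := h.fits
  have : 7 * 2 ^ e * 1 ≤ 7 * 2 ^ e * 2 ^ C.θ := Nat.mul_le_mul_left _ (Nat.one_le_two_pow)
  omega

theorem fits_of_lt {a : ℕ} (ha : a < 7 * 2 ^ e) : C.Fits m a := by
  have h1 := h.fits
  have : (a + 1) * 2 ^ C.θ ≤ 7 * 2 ^ e * 2 ^ C.θ := Nat.mul_le_mul_right _ ha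
  rw [Cfg.Fits]
  omega

theorem m_le : m ≤ C.n := by have := h.le_n; omega

theorem lt_word {a : ℕ} (ha : a ≤ 7 * 2 ^ e) : a < 2 ^ C.w := by
  have h1 := h.D_le
  have h2 := h.m_le
  exact C.pos_lt (by omega)

theorem half_le : 2 ^ C.q ≤ 2 ^ e := by
  have := h.base_le
  rw [Cfg.base] at this
  omega

end Sizes

/-- The address of the entry `a` of the `k`-th array of virtual words. -/
def region : ℕ → Ex → Ex
  | 0, a => a
  | k + 1, a => ♯.D + region k a

theorem region_eval (r : Var → ℕ) (k : ℕ) (a : Ex) :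
    (region k a).eval r = k * r .D + a.eval r := by
  induction k with
  | zero => simp [region]
  | succ k ih => simp [region, ih]; ring

theorem region_ok {w : ℕ} {r : Var → ℕ} {k : ℕ} {a : Ex} (ha : a.Ok w r)
    (h : k * r .D + a.eval r < 2 ^ w) : (region k a).Ok w r := by
  induction k with
  | zero => exact ha
  | succ k ih =>
    rw [Nat.add_mul] at h
    refine ⟨trivial, ih (by omega), ?_⟩
    rw [region_eval]
    simp
    omega

/-- The entry `j` of the `k`-th array of virtual words. -/
def Cfg.arr (C : Cfg) (e : ℕ) (κ : ℕ → ℕ) (k j : ℕ) : ℕ := C.vw κ (k * 2 ^ e + j)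

section Arr
variable {C : Cfg} {m d e : ℕ} {s : St} {Q : St → Prop} {κ : ℕ → ℕ}

theorem Cfg.arr_vset {k k' j j' x : ℕ} (hj : j < 2 ^ e) (hj' : j' < 2 ^ e)
    (hx : x < 2 ^ (C.lob + C.q + 1)) :
    C.arr e (C.vset κ (k * 2 ^ e + j) x) k' j' =
      if k' = k ∧ j' = j then x else C.arr e κ k' j' := by
  rw [arr, vw_vset hx]
  have : k' * 2 ^ e + j' = k * 2 ^ e + j ↔ k' = k ∧ j' = j := by
    have h1 := lex_lt_iff (a := k) (b := k') hj' hj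
    have h2 := lex_lt_iff (a := k') (b := k) hj hj'
    omega
  simp only [this, arr]

theorem wp_vread_arr {x : Var} {a : Ex} {k : ℕ} (hc : Ctx C m d e s) (hS : Sizes C m d e)
    (hx : ¬ (x = .tmp ∨ x = .adr ∨ x = .q ∨ x = .lob ∨ x = .base)) (hk : k < 7)
    (ha : a.Ok C.w s.r) (hj : a.eval s.r < 2 ^ e)
    (hv : C.arr e s.key k (a.eval s.r) < 2 ^ C.w)
    (hQ : Q (((s.set .tmp 0).set .adr 0).set x (C.arr e s.key k (a.eval s.r)))) :
    Wp C.w C.n (vread C.θ x (region k a)) Q s := by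
  have h1 : (region k a).eval s.r = k * 2 ^ e + a.eval s.r := by rw [region_eval, hc.D]
  have h2 : (k + 1) * 2 ^ e ≤ 7 * 2 ^ e := Nat.mul_le_mul_right _ hk
  rw [Nat.add_mul] at h2
  refine wp_vread hc.toEnv hx (region_ok ha ?_) (m := m) ?_ hS.m_le ?_ ?_
  · rw [hc.D]; exact hS.lt_word (by omega)
  · rw [h1]; exact hS.fits_of_lt (by omega)
  · rw [h1]; exact hv
  · rw [h1]; exact hQ

theorem wp_vwrite_arr {a v : Ex} {k : ℕ} (hc : Ctx C m d e s) (hS : Sizes C m d e)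
    (hK : C.Bounded s.key) (hk : k < 7) (ha : a.Ok C.w s.r) (hj : a.eval s.r < 2 ^ e)
    (hv : ∀ u, v.Ok C.w (s.set .adr u).r) (hve : ∀ u, v.eval (s.set .adr u).r = v.eval s.r)
    (hQ : Q ((((s.set .tmp 0).set .adr 0).set .val 0).setKey
      (C.vset s.key (k * 2 ^ e + a.eval s.r) (v.eval s.r)))) :
    Wp C.w C.n (vwrite C.θ (region k a) v) Q s := by
  have h1 : (region k a).eval s.r = k * 2 ^ e + a.eval s.r := by rw [region_eval, hc.D]
  have h2 : (k + 1) * 2 ^ e ≤ 7 * 2 ^ e := Nat.mul_le_mul_right _ hk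
  rw [Nat.add_mul] at h2
  refine wp_vwrite hc.toEnv hK (region_ok ha ?_) hv hve (m := m) ?_ hS.m_le ?_
  · rw [hc.D]; exact hS.lt_word (by omega)
  · rw [h1]; exact hS.fits_of_lt (by omega)
  · rw [h1]; exact hQ

theorem VStep.vset_arr {κ' : ℕ → ℕ} (h : VStep C m κ κ') (hS : Sizes C m d e) {k j : ℕ}
    (hk : k < 7) (hj : j < 2 ^ e) (x : ℕ) : VStep C m κ (C.vset κ' (k * 2 ^ e + j) x) := by
  have h2 : (k + 1) * 2 ^ e ≤ 7 * 2 ^ e := Nat.mul_le_mul_right _ hk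
  rw [Nat.add_mul] at h2
  exact h.vset (hS.fits_of_lt (by omega)) x

/-- Counting upwards during a round. -/
theorem Ctx.for_up {i b : Var} {B : ℕ} {c : Com} (hc : Ctx C m d e s) (I : ℕ → St → Prop)
    (hB : s.r b = B) (hBw : B ≤ C.n) (hib : b ≠ i) (hi : ¬ c.Assigns i) (hb : ¬ c.Assigns b)
    (hkeep : c.KeepsCtx) (hi' : i ∉ [Var.n, .q, .lob, .bq, .b, .half, .base, .m, .d, .D, .e])
    (h0 : I 0 (s.set i 0))
    (hstep : ∀ k < B, ∀ s', Ctx C m d e s' → I k s' → s'.r i = k →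
      (∀ y, y ≠ i → ¬ c.Assigns y → s'.r y = s.r y) →
      Wp C.w C.n c (fun s'' => I (k + 1) (s''.set i (k + 1))) s') :
    Spec C.w C.n (forUp i b c) s ((B + 2) * (c.cost + 8))
      (fun s' => Ctx C m d e s' ∧ I B s') := by
  have hf : ∀ y ∈ [Var.n, .q, .lob, .bq, .b, .half, .base, .m, .d, .D, .e], y ≠ i := by
    rintro y hy rfl; exact hi' hy
  have hk : (forUp i b c).KeepsCtx := by
    obtain ⟨⟨h1, h2, h3, h4, h5, h6, h7⟩, h8, h9, h10, h11⟩ := hkeep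
    simp only [List.mem_cons, List.not_mem_nil, or_false, forall_eq_or_imp, forall_eq] at hf
    simp only [Com.KeepsCtx, Com.KeepsEnv, forUp_assigns]
    tauto
  refine (Spec.for_up (T := c.cost) I hB (C.pos_lt hBw) hib hi hb h0 ?_).frame.mono le_rfl
    fun s' h => ⟨hc.of_frame h.2 hk, h.1⟩
  intro k hk s' hI hik hfr
  have hc' : Ctx C m d e s' := by
    obtain ⟨⟨h1, h2, h3, h4, h5, h6, h7⟩, h8, h9, h10, h11⟩ := hkeep
    simp only [List.mem_cons, List.not_mem_nil, or_false, forall_eq_or_imp, forall_eq] at hf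
    refine ⟨hc.toEnv.of_eq ?_ ?_ ?_ ?_ ?_ ?_ ?_, (hfr _ ?_ ?_).trans hc.m, (hfr _ ?_ ?_).trans hc.d,
      (hfr _ ?_ ?_).trans hc.D, (hfr _ ?_ ?_).trans hc.e⟩
    any_goals apply hfr
    all_goals tauto
  exact (hstep k hk s' hc' hI hik hfr).spec

theorem Cfg.word_of_pos (C : Cfg) {x : ℕ} (h : x ≤ C.n) : x < 2 ^ (C.lob + C.q + 1) :=
  h.trans_lt C.n_lt_bits

end Arr

/-! ### Radix sort of the chunk -/

/-- Set the counters of all digits to zero. -/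
def radixClear (θ : ℕ) : Com := forUp .g .half (vwrite θ (region 5 ♯.g) 0)

/-- Find the current digit of the chunk element with index `x`. -/
def digit (x : Var) : Com :=
  .read .y (♯.m + ♯x) ;; .g ≔ .low (♯.y >>> ♯.sh) ♯.q

/-- Count the digit of the chunk element with index `j`. -/
def radixCountBody (θ : ℕ) : Com :=
  digit .j ;; vread θ .c (region 5 ♯.g) ;; vwrite θ (region 5 ♯.g) (♯.c + 1)

/-- Count how often each digit occurs in the chunk. -/
def radixCount (θ : ℕ) : Com := forUp .j .d (radixCountBody θ)

/-- Replace the number of occurrences of the digit `g` by that of all smaller digits. -/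
def radixSumBody (θ : ℕ) : Com :=
  vread θ .c (region 5 ♯.g) ;; vwrite θ (region 5 ♯.g) ♯.acc ;; .acc ≔ ♯.acc + ♯.c

/-- Replace the counters by the first positions of the elements with a digit. -/
def radixSum (θ : ℕ) : Com := .acc ≔ 0 ;; forUp .g .half (radixSumBody θ)

/-- Move the entry `j` of the list of indices to its new place. -/
def radixMoveBody (θ : ℕ) : Com :=
  vread θ .x (region 0 ♯.j) ;; digit .x ;; vread θ .c (region 5 ♯.g) ;;
    vwrite θ (region 1 ♯.c) ♯.x ;; vwrite θ (region 5 ♯.g) (♯.c + 1)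

/-- Distribute the indices according to the current digit. -/
def radixMove (θ : ℕ) : Com := forUp .j .d (radixMoveBody θ)

/-- Copy the entry `j` of the list of indices back. -/
def radixCopyBody (θ : ℕ) : Com :=
  vread θ .x (region 1 ♯.j) ;; vwrite θ (region 0 ♯.j) ♯.x

/-- Copy the list of indices back. -/
def radixCopy (θ : ℕ) : Com := forUp .j .d (radixCopyBody θ)

/-- Sort the indices of the chunk elements stably by the current digit. -/
def radixPass (θ : ℕ) : Com :=
  radixClear θ ;; radixCount θ ;; radixSum θ ;; radixMove θ ;; radixCopy θ ;; .sh ≔ ♯.sh + ♯.q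

section Radix
variable {C : Cfg} {m d e : ℕ} {s : St} {κ : ℕ → ℕ}

theorem radixClear_spec (hc : Ctx C m d e s) (hS : Sizes C m d e) (hV : VStep C m κ s.key) :
    Spec C.w C.n (radixClear C.θ) s ((m + 2) * ((vwrite C.θ (region 5 ♯.g) 0).cost + 8)) fun s' =>
      Ctx C m d e s' ∧ VStep C m κ s'.key ∧ s'.id = s.id ∧ (∀ g < 2 ^ C.q, C.arr e s'.key 5 g = 0) ∧
      ∀ j < 2 ^ e, C.arr e s'.key 0 j = C.arr e s.key 0 j := by
  have hD := hS.D_le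
  have hh := hS.half_le
  have hmn := hS.m_le
  refine (Ctx.for_up hc (fun k s' => VStep C m κ s'.key ∧ s'.id = s.id ∧
    (∀ g < k, C.arr e s'.key 5 g = 0) ∧ ∀ j < 2 ^ e, C.arr e s'.key 0 j = C.arr e s.key 0 j)
    hc.half (by omega) (by simp) (by simp) (by simp)
    (by simp [Com.KeepsCtx, Com.KeepsEnv]) (by simp) (by simpa using hV) ?_).mono
    (Nat.mul_le_mul_right _ (by omega)) fun s' h => h
  rintro k hk t ht ⟨a1, a2, a3, a4⟩ hg -
  refine wp_vwrite_arr ht hS a1.bounded (by omega) (by simp) (by simp [hg]; omega) (by simp)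
    (by simp) ?_
  simp only [Ex.eval_var, hg, Ex.eval_zero, St.setKey_key, St.set_key]
  refine ⟨a1.vset_arr hS (by omega) (by omega) _, by simpa using a2, fun g hgk => ?_,
    fun j hj => ?_⟩
  · rw [Cfg.arr_vset (by omega) (by omega) (by positivity)]
    split_ifs with h
    · rfl
    · exact a3 g (by omega)
  · rw [Cfg.arr_vset (by omega) (by omega) (by positivity), if_neg (by omega), a4 j hj]

theorem wp_digit {x : Var} {Q : St → Prop} (hE : Env C s) (hx : m + s.r x < C.n) (hm : s.r .m = m)
    (hQ : Q ((s.set .y (s.key (m + s.r x))).set .g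
      (s.key (m + s.r x) / 2 ^ s.r .sh % 2 ^ C.q))) :
    Wp C.w C.n (digit x) Q s := by
  simp only [digit, Wp, Ex.ok_add, Ex.ok_var, Ex.eval_add, Ex.eval_var, hm, true_and, Ex.ok_low,
    Ex.ok_shr]
  refine ⟨C.pos_lt hx.le, hx, ?_⟩
  simpa [hE.q] using hQ

theorem Ctx.setKey (h : Ctx C m d e s) (κ' : ℕ → ℕ) : Ctx C m d e (s.setKey κ') :=
  ⟨⟨h.n, h.q, h.lob, h.bq, h.b, h.half, h.base⟩, h.m, h.d, h.D, h.e⟩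

theorem radixCount_spec (hc : Ctx C m d e s) (hS : Sizes C m d e) (hV : VStep C m κ s.key)
    {dig : ℕ → ℕ} (hdig : ∀ x, dig x = κ (m + x) / 2 ^ s.r .sh % 2 ^ C.q)
    (h5 : ∀ g < 2 ^ C.q, C.arr e s.key 5 g = 0) :
    Spec C.w C.n (radixCount C.θ) s ((d + 2) * ((radixCountBody C.θ).cost + 8)) fun s' =>
      Ctx C m d e s' ∧ VStep C m κ s'.key ∧ s'.id = s.id ∧
      (∀ g < 2 ^ C.q, C.arr e s'.key 5 g = ((Finset.range d).filter fun y => dig y = g).card) ∧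
      ∀ j < 2 ^ e, C.arr e s'.key 0 j = C.arr e s.key 0 j := by
  have hD := hS.D_le
  have hh := hS.half_le
  have hn := hS.le_n
  refine Ctx.for_up hc (fun k s' => VStep C m κ s'.key ∧ s'.id = s.id ∧
    (∀ g < 2 ^ C.q, C.arr e s'.key 5 g = ((Finset.range k).filter fun y => dig y = g).card) ∧
    ∀ j < 2 ^ e, C.arr e s'.key 0 j = C.arr e s.key 0 j)
    hc.d (by omega) (by simp) (by simp [radixCountBody, digit, Com.Assigns])
    (by simp [radixCountBody, digit, Com.Assigns])
    (by simp [radixCountBody, digit, Com.Assigns, Com.KeepsCtx, Com.KeepsEnv]) (by simp)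
    (by simpa [hV] using h5) ?_
  rintro k hk t ht ⟨a1, a2, a3, a4⟩ hj hf
  have hsh : t.r .sh = s.r .sh := hf _ (by simp) (by simp [radixCountBody, digit, Com.Assigns])
  have hkey : t.key (m + k) = κ (m + k) := a1.high _ (by omega)
  have hdk : dig k < 2 ^ C.q := by rw [hdig]; exact Cfg.mod_q_lt
  have hcard := card_filter_range_le k fun y => dig y = dig k
  refine wp_digit ht.toEnv (by rw [hj]; omega) ht.m ?_
  rw [hj, hsh, hkey, ← hdig]
  refine wp_vread_arr ((ht.set _ (by simp)).set _ (by simp)) hS (by simp) (by omega) (by simp)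
    (by simp; omega) ?_ ?_
  · simp only [Ex.eval_var, St.set_r, if_true, St.set_key]
    rw [a3 _ hdk]
    exact C.pos_lt (by omega)
  simp only [Ex.eval_var, St.set_r, if_true, St.set_key]
  refine wp_vwrite_arr (((((ht.set _ (by simp)).set _ (by simp)).set _ (by simp)).set _
    (by simp)).set _ (by simp)) hS (by simpa using a1.bounded) (by omega) (by simp)
    (by simp; omega) (fun u => ?_) (by simp) ?_
  · simp only [Ex.ok_add, Ex.ok_var, Ex.ok_one, Ex.eval_var, Ex.eval_one, St.set_r,
      reduceCtorEq, if_false, if_true, true_and]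
    rw [a3 _ hdk]
    exact ⟨C.w_pos, C.pos_lt (by omega)⟩
  simp only [Ex.eval_var, St.set_r, if_true, St.set_key, St.setKey_key, St.set_id, St.setKey_id,
    reduceCtorEq, if_false, Ex.eval_add, Ex.eval_one, a3 _ hdk]
  refine ⟨a1.vset_arr hS (by omega) (by omega) _, a2, fun g hg => ?_, fun j hj => ?_⟩
  · rw [Cfg.arr_vset (by omega) (by omega) (C.word_of_pos (by omega)), card_filter_range_succ]
    by_cases h : g = dig k
    · simp [h]
    · rw [if_neg (by omega), if_neg (by omega), a3 g hg, Nat.add_zero]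
  · rw [Cfg.arr_vset (by omega) (by omega) (C.word_of_pos (by omega)), if_neg (by omega), a4 j hj]

theorem radixSum_spec (hc : Ctx C m d e s) (hS : Sizes C m d e) (hV : VStep C m κ s.key)
    {dig : ℕ → ℕ}
    (h5 : ∀ g < 2 ^ C.q, C.arr e s.key 5 g = ((Finset.range d).filter fun y => dig y = g).card) :
    Spec C.w C.n (radixSum C.θ) s (2 + (m + 2) * ((radixSumBody C.θ).cost + 8)) fun s' =>
      Ctx C m d e s' ∧ VStep C m κ s'.key ∧ s'.id = s.id ∧
      (∀ g < 2 ^ C.q, C.arr e s'.key 5 g = ((Finset.range d).filter fun y => dig y < g).card) ∧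
      ∀ j < 2 ^ e, C.arr e s'.key 0 j = C.arr e s.key 0 j := by
  have hD := hS.D_le
  have hh := hS.half_le
  have hn := hS.le_n
  refine Spec.seq ((spec_asg_zero _).mono le_rfl ?_)
  rintro _ rfl
  refine (Ctx.for_up (hc.set _ (by simp)) (fun k s' => VStep C m κ s'.key ∧ s'.id = s.id ∧
    (∀ g < 2 ^ C.q, C.arr e s'.key 5 g = if g < k then
      ((Finset.range d).filter fun y => dig y < g).card else
      ((Finset.range d).filter fun y => dig y = g).card) ∧
    s'.r .acc = ((Finset.range d).filter fun y => dig y < k).card ∧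
    ∀ j < 2 ^ e, C.arr e s'.key 0 j = C.arr e s.key 0 j)
    (B := 2 ^ C.q) (by simpa using hc.half) (by omega) (by simp)
    (by simp [radixSumBody, Com.Assigns]) (by simp [radixSumBody, Com.Assigns])
    (by simp [radixSumBody, Com.Assigns, Com.KeepsCtx, Com.KeepsEnv]) (by simp)
    ?_ ?_).mono (Nat.mul_le_mul_right _ (by omega)) ?_
  · simp [hV]
    exact h5
  · rintro k hk t ht ⟨a1, a2, a3, a4, a5⟩ hg -
    have h5k := a3 k hk
    rw [if_neg (lt_irrefl _)] at h5k
    have hcard := card_filter_range_le d fun y => dig y < k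
    have hcard' := card_filter_range_le d fun y => dig y < k + 1
    have hsucc := card_filter_lt_succ (d := d) dig k
    refine wp_vread_arr ht hS (by simp) (by omega) (by simp) (by simp [hg]; omega) ?_ ?_
    · simp only [Ex.eval_var, hg, h5k]
      exact C.pos_lt (by omega)
    simp only [Ex.eval_var, hg, h5k]
    refine wp_vwrite_arr (((ht.set _ (by simp)).set _ (by simp)).set _ (by simp)) hS
      (by simpa using a1.bounded) (by omega) (by simp) (by simp [hg]; omega) (by simp) (by simp) ?_
    simp only [Wp, Ex.ok_add, Ex.ok_var, Ex.eval_add, Ex.eval_var, St.set_r, St.setKey_r, hg,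
      reduceCtorEq, if_false, if_true, true_and, a4, St.set_key, St.setKey_key, St.set_id,
      St.setKey_id]
    refine ⟨C.pos_lt (by omega), a1.vset_arr hS (by omega) (by omega) _, a2, fun g hg => ?_, ?_,
      fun j hj => ?_⟩
    · rw [Cfg.arr_vset (by omega) (by omega) (C.word_of_pos (by omega)), a3 g hg]
      split_ifs <;> first | omega | rfl | skip
      rw [show g = k by omega]
    · omega
    · rw [Cfg.arr_vset (by omega) (by omega) (C.word_of_pos (by omega)), if_neg (by omega), a5 j hj]
  · rintro s' ⟨h1, h2, h3, h4, -, h5⟩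
    exact ⟨h1, h2, h3, fun g hg => by rw [h4 g hg, if_pos hg], h5⟩

/-- The indices, which are in the order of `f`, are brought into the order of `f'`, that is, by
digit and for equal digits by `f`.  The counter of a digit is always the rank of the next element
with this digit. -/
theorem radixMove_spec (hc : Ctx C m d e s) (hS : Sizes C m d e) (hV : VStep C m κ s.key)
    {dig f f' : ℕ → ℕ} (hdig : ∀ x, dig x = κ (m + x) / 2 ^ s.r .sh % 2 ^ C.q)
    (hf' : ∀ x < d, ∀ y < d, f' y < f' x ↔ dig y < dig x ∨ dig y = dig x ∧ f y < f x)
    (hf : Set.InjOn f (Set.Iio d)) (hfi' : Set.InjOn f' (Set.Iio d))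
    (h0 : ∀ x < d, C.arr e s.key 0 (rank d f x) = x)
    (h5 : ∀ g < 2 ^ C.q, C.arr e s.key 5 g = ((Finset.range d).filter fun y => dig y < g).card) :
    Spec C.w C.n (radixMove C.θ) s ((d + 2) * ((radixMoveBody C.θ).cost + 8)) fun s' =>
      Ctx C m d e s' ∧ VStep C m κ s'.key ∧ s'.id = s.id ∧
      (∀ x < d, C.arr e s'.key 1 (rank d f' x) = x) := by
  have hD := hS.D_le
  have hh := hS.half_le
  have hn := hS.le_n
  have hde := hS.d_le
  refine (Ctx.for_up hc (fun k s' => VStep C m κ s'.key ∧ s'.id = s.id ∧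
    (∀ g < 2 ^ C.q, C.arr e s'.key 5 g = ((Finset.range d).filter fun y => dig y < g).card +
      ((Finset.range d).filter fun y => dig y = g ∧ rank d f y < k).card) ∧
    (∀ x < d, rank d f x < k → C.arr e s'.key 1 (rank d f' x) = x) ∧
    ∀ x < d, C.arr e s'.key 0 (rank d f x) = x)
    hc.d (by omega) (by simp) (by simp [radixMoveBody, digit, Com.Assigns])
    (by simp [radixMoveBody, digit, Com.Assigns])
    (by simp [radixMoveBody, digit, Com.Assigns, Com.KeepsCtx, Com.KeepsEnv]) (by simp)
    ?_ ?_).mono le_rfl ?_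
  · simp [hV]
    exact ⟨h5, h0⟩
  · rintro k hk t ht ⟨a1, a2, a3, a4, a5⟩ hj hfr
    have hsh : t.r .sh = s.r .sh := hfr _ (by simp) (by simp [radixMoveBody, digit, Com.Assigns])
    obtain ⟨x, hx, rfl⟩ := exists_rank_eq hf hk
    have hkey : t.key (m + x) = κ (m + x) := a1.high _ (by omega)
    have hdx : dig x < 2 ^ C.q := by rw [hdig]; exact Cfg.mod_q_lt
    have hr' := rank_refine hf' hf hx
    have hr'' := rank_lt (f := f') hx
    have h5x := a3 _ hdx
    rw [← hr'] at h5x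
    have hkeep := ((ht.set (x := .tmp) 0 (by simp)).set (x := .adr) 0 (by simp)).set (x := .x) x
      (by simp)
    refine wp_vread_arr ht hS (by simp) (by omega) (by simp) (by simp [hj]; omega) ?_ ?_
    · simp only [Ex.eval_var, hj, a5 x hx]
      exact C.pos_lt (by omega)
    simp only [Ex.eval_var, hj, a5 x hx]
    refine wp_digit hkeep.toEnv (by simp; omega) hkeep.m ?_
    simp only [St.set_r, if_true, St.set_key, reduceCtorEq, if_false, hsh, hkey, ← hdig]
    refine wp_vread_arr ((hkeep.set _ (by simp)).set _ (by simp)) hS (by simp) (by omega) (by simp)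
      (by simp; omega) ?_ ?_
    · simp only [Ex.eval_var, St.set_r, if_true, St.set_key, h5x]
      exact C.pos_lt (by omega)
    simp only [Ex.eval_var, St.set_r, if_true, St.set_key, h5x]
    have hkeep' := ((((hkeep.set (x := .y) (κ (m + x)) (by simp)).set (x := .g) (dig x)
      (by simp)).set (x := .tmp) 0 (by simp)).set (x := .adr) 0 (by simp)).set (x := .c)
      (rank d f' x) (by simp)
    refine wp_vwrite_arr hkeep' hS (by simpa using a1.bounded) (by omega) (by simp)
      (by simp; omega) (by simp) (by simp) ?_
    simp only [Ex.eval_var, St.set_r, if_true, St.set_key, reduceCtorEq, if_false]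
    have hv1 := a1.vset_arr hS (show 1 < 7 by omega) (j := rank d f' x) (by omega) x
    refine wp_vwrite_arr ((((hkeep'.set (x := .tmp) 0 (by simp)).set (x := .adr) 0 (by simp)).set
      (x := .val) 0 (by simp)).setKey _) hS (by simpa using hv1.bounded) (by omega) (by simp)
      (by simp; omega) (fun u => ?_) (by simp) ?_
    · simp
      exact ⟨C.w_pos, C.pos_lt (by omega)⟩
    simp only [Ex.eval_var, St.set_r, if_true, St.setKey_key, St.set_id, St.setKey_id,
      St.setKey_r, reduceCtorEq, if_false, Ex.eval_add, Ex.eval_one]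
    have hwx := C.word_of_pos (show x ≤ C.n by omega)
    have hwr := C.word_of_pos (show rank d f' x + 1 ≤ C.n by omega)
    refine ⟨hv1.vset_arr hS (by omega) (by omega) _, a2, fun g hg => ?_, fun y hy hyk => ?_,
      fun y hy => ?_⟩
    · rw [Cfg.arr_vset (by omega) (by omega) hwr, card_rank_succ _ hf hx, ← Nat.add_assoc,
        ← a3 g hg]
      by_cases h : g = dig x
      · rw [h, h5x]; simp
      · rw [if_neg (by omega), Cfg.arr_vset (by omega) (by omega) hwx, if_neg (by omega),
          if_neg (by omega), Nat.add_zero]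
    · have hry := rank_lt (f := f') hy
      rw [Cfg.arr_vset (by omega) (by omega) hwr, if_neg (by omega),
        Cfg.arr_vset (by omega) (by omega) hwx]
      split_ifs with h
      · exact (rank_inj hfi' hy hx h.2).symm
      · refine a4 y hy ?_
        have : rank d f y ≠ rank d f x := fun he => h ⟨rfl, by rw [rank_inj hf hy hx he]⟩
        omega
    · have hry := rank_lt (f := f) hy
      rw [Cfg.arr_vset (by omega) (by omega) hwr, if_neg (by omega),
        Cfg.arr_vset (by omega) (by omega) hwx, if_neg (by omega), a5 y hy]
  · rintro s' ⟨h1, h2, h3, -, h4, -⟩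
    exact ⟨h1, h2, h3, fun x hx => h4 x hx (rank_lt hx)⟩

theorem radixCopy_spec (hc : Ctx C m d e s) (hS : Sizes C m d e) (hV : VStep C m κ s.key)
    {f : ℕ → ℕ} (hf : Set.InjOn f (Set.Iio d))
    (h1 : ∀ x < d, C.arr e s.key 1 (rank d f x) = x) :
    Spec C.w C.n (radixCopy C.θ) s ((d + 2) * ((radixCopyBody C.θ).cost + 8)) fun s' =>
      Ctx C m d e s' ∧ VStep C m κ s'.key ∧ s'.id = s.id ∧
      (∀ x < d, C.arr e s'.key 0 (rank d f x) = x) := by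
  have hD := hS.D_le
  have hn := hS.le_n
  have hde := hS.d_le
  refine (Ctx.for_up hc (fun k s' => VStep C m κ s'.key ∧ s'.id = s.id ∧
    (∀ x < d, C.arr e s'.key 1 (rank d f x) = x) ∧
    ∀ x < d, rank d f x < k → C.arr e s'.key 0 (rank d f x) = x)
    hc.d (by omega) (by simp) (by simp [radixCopyBody, Com.Assigns])
    (by simp [radixCopyBody, Com.Assigns])
    (by simp [radixCopyBody, Com.Assigns, Com.KeepsCtx, Com.KeepsEnv]) (by simp)
    ?_ ?_).mono le_rfl ?_
  · simpa [hV] using h1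
  · rintro k hk t ht ⟨a1, a2, a3, a4⟩ hj -
    obtain ⟨x, hx, rfl⟩ := exists_rank_eq hf hk
    refine wp_vread_arr ht hS (by simp) (by omega) (by simp) (by simp [hj]; omega) ?_ ?_
    · simp only [Ex.eval_var, hj, a3 x hx]
      exact C.pos_lt (by omega)
    simp only [Ex.eval_var, hj, a3 x hx]
    refine wp_vwrite_arr (((ht.set _ (by simp)).set _ (by simp)).set _ (by simp)) hS
      (by simpa using a1.bounded) (by omega) (by simp) (by simp [hj]; omega) (by simp) (by simp) ?_
    have hwx := C.word_of_pos (show x ≤ C.n by omega)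
    simp only [Ex.eval_var, St.set_r, if_true, St.set_key, St.setKey_key, St.set_id, St.setKey_id,
      reduceCtorEq, if_false, hj]
    refine ⟨a1.vset_arr hS (by omega) (by omega) _, a2, fun y hy => ?_, fun y hy hyk => ?_⟩
    · have hry := rank_lt (f := f) hy
      rw [Cfg.arr_vset (by omega) (by omega) hwx, if_neg (by omega), a3 y hy]
    · have hry := rank_lt (f := f) hy
      rw [Cfg.arr_vset (by omega) (by omega) hwx]
      split_ifs with h
      · exact (rank_inj hf hy hx h.2).symm
      · exact a4 y hy (by omega)
  · rintro s' ⟨h1, h2, h3, -, h4⟩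
    exact ⟨h1, h2, h3, fun x hx => h4 x hx (rank_lt hx)⟩

end Radix

/-- A bound for the time of a pass, per element of the sorted prefix. -/
def radixPassCost (θ : ℕ) : ℕ :=
  (vwrite θ (region 5 ♯.g) 0).cost + (radixCountBody θ).cost + (radixSumBody θ).cost +
    (radixMoveBody θ).cost + (radixCopyBody θ).cost + 48

/-- Sort the indices of the chunk elements by their keys. -/
def radix (θ : ℕ) : Com :=
  forUp .j .d (vwrite θ (region 0 ♯.j) ♯.j) ;; .sh ≔ 0 ;; .loop (.lt ♯.sh ♯.b) (radixPass θ)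

/-- A bound for the time of the radix sort, per element of the sorted prefix. -/
def radixCost (θ : ℕ) : ℕ :=
  (vwrite θ (region 0 ♯.j) ♯.j).cost + 8 + 2 + (2 ^ θ + 1) * (radixPassCost θ + 4)

/-- Write the sorted list of the keys of the chunk, their positions and the inverse table. -/
def buildBody (θ : ℕ) : Com :=
  vread θ .x (region 0 ♯.j) ;; .y ≔ ♯.m + ♯.x ;; .read .g ♯.y ;;
  vwrite θ (region 2 ♯.j) ♯.g ;; vwrite θ (region 3 ♯.j) ♯.y ;;
  vwrite θ (region 4 (.low ♯.y ♯.e)) ♯.j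

section Radix
variable {C : Cfg} {m d e : ℕ} {s : St} {κ : ℕ → ℕ}

theorem Cfg.bits_add_lt (C : Cfg) : C.lob + C.q + 1 + C.q < 2 ^ C.w := by
  have h1 := C.bits_le
  have h2 : C.w - 1 < 2 ^ (C.w - 1) := Nat.lt_two_pow_self
  have h3 : 2 ^ C.w = 2 ^ (C.w - 1) * 2 := by rw [← pow_succ]; congr 1; omega
  omega

theorem radixPass_spec (hc : Ctx C m d e s) (hS : Sizes C m d e) (hV : VStep C m κ s.key)
    {dig f f' : ℕ → ℕ} {sh : ℕ} (hsh : s.r .sh = sh) (hshb : sh < C.lob + C.q + 1)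
    (hdig : ∀ x, dig x = κ (m + x) / 2 ^ sh % 2 ^ C.q)
    (hf' : ∀ x < d, ∀ y < d, f' y < f' x ↔ dig y < dig x ∨ dig y = dig x ∧ f y < f x)
    (hf : Set.InjOn f (Set.Iio d)) (hfi' : Set.InjOn f' (Set.Iio d))
    (h0 : ∀ x < d, C.arr e s.key 0 (rank d f x) = x) :
    Spec C.w C.n (radixPass C.θ) s ((m + 2) * radixPassCost C.θ) fun s' =>
      Ctx C m d e s' ∧ VStep C m κ s'.key ∧ s'.id = s.id ∧ s'.r .sh = sh + C.q ∧
      (∀ x < d, C.arr e s'.key 0 (rank d f' x) = x) := by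
  have hde := hS.d_le
  have hD := hS.D_le
  have hqw := C.bits_add_lt
  have hT : ∀ K, (d + 2) * K ≤ (m + 2) * K := fun K => Nat.mul_le_mul_right _ (by omega)
  refine (Spec.seq_frame (radixClear_spec hc hS hV) fun s1 ⟨a1, a2, a3, a4, a5⟩ f1 =>
    Spec.seq_frame (radixCount_spec (dig := dig) a1 hS a2 ?_ a4) fun s2 ⟨b1, b2, b3, b4, b5⟩ f2 =>
    Spec.seq_frame (radixSum_spec b1 hS b2 b4) fun s3 ⟨c1, c2, c3, c4, c5⟩ f3 =>
    Spec.seq_frame (radixMove_spec c1 hS c2 ?_ hf' hf hfi' (fun x hx => ?_) c4)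
      fun s4 ⟨d1, d2, d3, d4⟩ f4 =>
    Spec.seq_frame (radixCopy_spec d1 hS d2 hfi' d4)
      fun s5 ⟨e1, e2, e3, e4⟩ f5 => ?_).mono (T := _ + (_ + (_ + (_ + (_ + 4))))) ?_ fun _ h => h
  · have g1 : s1.r .sh = s.r .sh := f1 _ (by simp [radixClear])
    rw [g1, hsh]; exact hdig
  · have g1 : s1.r .sh = s.r .sh := f1 _ (by simp [radixClear])
    have g2 : s2.r .sh = s1.r .sh :=
      f2 _ (by simp [radixCount, radixCountBody, digit, Com.Assigns])
    have g3 : s3.r .sh = s2.r .sh := f3 _ (by simp [radixSum, radixSumBody, Com.Assigns])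
    rw [g3, g2, g1, hsh]; exact hdig
  · have := rank_lt (f := f) hx
    rw [c5 _ (by omega), b5 _ (by omega), a5 _ (by omega), h0 x hx]
  · have g1 : s1.r .sh = s.r .sh := f1 _ (by simp [radixClear])
    have g2 : s2.r .sh = s1.r .sh :=
      f2 _ (by simp [radixCount, radixCountBody, digit, Com.Assigns])
    have g3 : s3.r .sh = s2.r .sh := f3 _ (by simp [radixSum, radixSumBody, Com.Assigns])
    have g4 : s4.r .sh = s3.r .sh := f4 _ (by simp [radixMove, radixMoveBody, digit, Com.Assigns])
    have g5 : s5.r .sh = s4.r .sh := f5 _ (by simp [radixCopy, radixCopyBody, Com.Assigns])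
    have g : s5.r .sh = sh := by rw [g5, g4, g3, g2, g1, hsh]
    refine Wp.spec (c := _ ≔ _) ?_
    simp only [Wp, Ex.ok_add, Ex.ok_var, Ex.eval_add, Ex.eval_var, g, e1.q, true_and, St.set_key,
      St.set_id, St.set_r, if_true]
    exact ⟨by omega, e1.set _ (by simp), e2, by rw [e3, d3, c3, b3, a3], e4⟩
  · have h1 := hT ((radixCountBody C.θ).cost + 8)
    have h2 := hT ((radixMoveBody C.θ).cost + 8)
    have h3 := hT ((radixCopyBody C.θ).cost + 8)
    rw [radixPassCost]
    nlinarith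

/-- The order by the lowest `sh + q` bits of the keys is a refinement of the order by the digit at
`sh`, where ties are broken by the lowest `sh` bits. -/
theorem lex_mod_succ (key : ℕ → ℕ) (sh q : ℕ) {x y : ℕ} (hx : x < d) (hy : y < d) :
    lexOrder d (fun y => key y % 2 ^ (sh + q)) y < lexOrder d (fun y => key y % 2 ^ (sh + q)) x ↔
      key y / 2 ^ sh % 2 ^ q < key x / 2 ^ sh % 2 ^ q ∨
      key y / 2 ^ sh % 2 ^ q = key x / 2 ^ sh % 2 ^ q ∧
      lexOrder d (fun y => key y % 2 ^ sh) y < lexOrder d (fun y => key y % 2 ^ sh) x := by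
  have h : ∀ a, key a % 2 ^ (sh + q) = key a / 2 ^ sh % 2 ^ q * 2 ^ sh + key a % 2 ^ sh := by
    intro a
    rw [pow_add, Nat.mod_mul]
    ring
  have hm : ∀ a, key a % 2 ^ sh < 2 ^ sh := fun a => Nat.mod_lt _ (by positivity)
  simp only [lexOrder, h, lex_lt_iff hx hy, lex_lt_iff (hm x) (hm y)]
  have := lex_lt_iff (a := key y / 2 ^ sh % 2 ^ q) (b := key x / 2 ^ sh % 2 ^ q) (hm x) (hm y)
  have := lex_lt_iff (a := key x / 2 ^ sh % 2 ^ q) (b := key y / 2 ^ sh % 2 ^ q) (hm y) (hm x)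
  omega

/-- After `k` passes the indices are sorted by the lowest `k * q` bits of the keys, and `2 ^ θ`
passes are enough for all bits. -/
theorem radix_spec (hc : Ctx C m d e s) (hS : Sizes C m d e) (hb : C.Bounded s.key) :
    Spec C.w C.n (radix C.θ) s ((m + 2) * radixCost C.θ) fun s' =>
      Ctx C m d e s' ∧ VStep C m s.key s'.key ∧ s'.id = s.id ∧
      (∀ x < d, C.arr e s'.key 0 (rank d (lexOrder d fun y => s.key (m + y)) x) = x) := by
  have hde := hS.d_le
  have hn := hS.le_n
  have hD := hS.D_le
  refine (Spec.seq_frame (T := (d + 2) * ((vwrite C.θ (region 0 ♯.j) ♯.j).cost + 8))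
    (Q := fun s' => Ctx C m d e s' ∧ VStep C m s.key s'.key ∧ s'.id = s.id ∧
      ∀ j < d, C.arr e s'.key 0 j = j) ?_ fun s1 ⟨a1, a2, a3, a4⟩ _ =>
    Spec.seq ((spec_asg_zero _).mono le_rfl ?_)).mono
    (T := _ + (2 + (2 ^ C.θ + 1) * ((m + 2) * radixPassCost C.θ + 4))) ?_ fun _ h => h
  · refine (Ctx.for_up hc (fun k s' => VStep C m s.key s'.key ∧ s'.id = s.id ∧
      ∀ j < k, C.arr e s'.key 0 j = j) hc.d (by omega) (by simp) (by simp) (by simp)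
      (by simp [Com.KeepsCtx, Com.KeepsEnv]) (by simp) ?_ ?_).mono le_rfl fun s' h => h
    · simpa using VStep.refl hb
    · rintro k hk t ht ⟨a1, a2, a3⟩ hj -
      refine wp_vwrite_arr ht hS a1.bounded (by omega) (by simp) (by simp [hj]; omega) (by simp)
        (by simp) ?_
      simp only [Ex.eval_var, hj, St.setKey_key, St.set_key]
      refine ⟨a1.vset_arr hS (by omega) (by omega) _, by simpa using a2, fun j hj => ?_⟩
      rw [Cfg.arr_vset (by omega) (by omega) (C.word_of_pos (by omega))]
      split_ifs with h
      · exact h.2.symm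
      · exact a3 j (by omega)
  · rintro _ rfl
    refine (Spec.loop_count (fun N s' => N ≤ 2 ^ C.θ ∧ Ctx C m d e s' ∧ VStep C m s.key s'.key ∧
      s'.id = s.id ∧ s'.r .sh = (2 ^ C.θ - N) * C.q ∧ ∀ x < d, C.arr e s'.key 0 (rank d
        (lexOrder d fun y => s.key (m + y) % 2 ^ ((2 ^ C.θ - N) * C.q)) x) = x)
      (T := (m + 2) * radixPassCost C.θ) (N := 2 ^ C.θ) ?_ ?_).mono le_rfl ?_
    · rintro N s' ⟨hN, b1, b2, b3, b4, b5⟩ -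
      refine ⟨by simp, fun hlt => ?_⟩
      simp only [Cond.holds_lt, Ex.eval_var, b4, b1.b] at hlt
      -- The bound `2 ^ θ` for the number of passes is not exceeded, since all bits have been
      -- treated by then.
      have hN0 : N ≠ 0 := by
        rintro rfl
        have := C.bits_le_cells
        rw [Nat.sub_zero, mul_comm] at hlt
        omega
      have hsucc : (2 ^ C.θ - (N - 1)) * C.q = (2 ^ C.θ - N) * C.q + C.q := by
        rw [show 2 ^ C.θ - (N - 1) = 2 ^ C.θ - N + 1 by omega]; ring
      refine (radixPass_spec b1 hS b2
        (f' := lexOrder d fun y => s.key (m + y) % 2 ^ ((2 ^ C.θ - (N - 1)) * C.q))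
        b4 hlt (fun _ => rfl) ?_ (lexOrder_injOn _) (lexOrder_injOn _) b5).mono le_rfl ?_
      · intro x hx y hy
        rw [hsucc]
        exact lex_mod_succ (fun y => s.key (m + y)) _ _ hx hy
      · rintro s'' ⟨c1, c2, c3, c4, c5⟩
        exact ⟨N - 1, by omega, by omega, c1, c2, c3.trans b3, by rw [c4, hsucc], c5⟩
    · have hr : ∀ x < d, rank d (lexOrder d fun y => s.key (m + y) % 2 ^ 0) x = x := by
        intro x hx
        simp only [rank, lexOrder, pow_zero, Nat.mod_one, Nat.zero_mul, Nat.zero_add]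
        rw [show ((Finset.range d).filter fun y => y < x) = Finset.range x by
          ext y; simp; omega, Finset.card_range]
      refine ⟨le_rfl, a1.set _ (by simp), by simpa using a2, by simpa using a3, by simp, ?_⟩
      intro x hx
      rw [Nat.sub_self, Nat.zero_mul, hr x hx]
      exact a4 x hx
    · rintro s' ⟨⟨N, ⟨-, b1, b2, b3, b4, b5⟩, hnot⟩, -⟩
      simp only [Cond.holds_lt, Ex.eval_var, b4, b1.b, not_lt] at hnot
      refine ⟨b1, b2, b3, fun x hx => ?_⟩
      convert b5 x hx using 2
      simp only [rank, lexOrder]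
      refine congrArg _ (Finset.filter_congr fun y hy => ?_)
      have hy : y < d := by simpa using hy
      have hmod : ∀ y < d, s.key (m + y) % 2 ^ ((2 ^ C.θ - N) * C.q) = s.key (m + y) :=
        fun y hy => Nat.mod_eq_of_lt
          ((hb _ (by omega)).trans_le (Nat.pow_le_pow_right (by omega) hnot))
      rw [hmod x hx, hmod y hy]
  · have h1 : (d + 2) * ((vwrite C.θ (region 0 ♯.j) ♯.j).cost + 8) ≤
      (m + 2) * ((vwrite C.θ (region 0 ♯.j) ♯.j).cost + 8) := Nat.mul_le_mul_right _ (by omega)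
    have h2 : (2 ^ C.θ + 1) * ((m + 2) * radixPassCost C.θ + 4) ≤
        (m + 2) * ((2 ^ C.θ + 1) * (radixPassCost C.θ + 4)) := by
      rw [Nat.mul_left_comm]
      exact Nat.mul_le_mul_left _ (by nlinarith)
    rw [radixCost]
    nlinarith

/-- The chunk elements are still in their original places, so the element with index `x` is at
position `m + x`.  The `d ≤ D` positions of the chunk are different modulo `D`. -/
theorem build_spec (hc : Ctx C m d e s) (hS : Sizes C m d e) (hb : C.Bounded s.key)
    {A : ℕ → ℕ} (hA : ∀ j < d, C.arr e s.key 0 j = A j) (hAd : ∀ j < d, A j < d)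
    (hAi : Set.InjOn A (Set.Iio d)) :
    Spec C.w C.n (forUp .j .d (buildBody C.θ)) s ((m + 2) * ((buildBody C.θ).cost + 8)) fun s' =>
      Ctx C m d e s' ∧ VStep C m s.key s'.key ∧ s'.id = s.id ∧
      (∀ j < d, C.arr e s'.key 2 j = s.key (m + A j)) ∧
      (∀ j < d, C.arr e s'.key 3 j = m + A j) ∧
      (∀ j < d, C.arr e s'.key 4 ((m + A j) % 2 ^ e) = j) := by
  have hde := hS.d_le
  have hn := hS.le_n
  have hD := hS.D_le
  refine (Ctx.for_up hc (fun k s' => VStep C m s.key s'.key ∧ s'.id = s.id ∧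
      (∀ j < d, C.arr e s'.key 0 j = A j) ∧
      (∀ j < k, C.arr e s'.key 2 j = s.key (m + A j)) ∧
      (∀ j < k, C.arr e s'.key 3 j = m + A j) ∧
      (∀ j < k, C.arr e s'.key 4 ((m + A j) % 2 ^ e) = j))
    hc.d (by omega) (by simp) (by simp [buildBody, Com.Assigns])
    (by simp [buildBody, Com.Assigns])
    (by simp [buildBody, Com.Assigns, Com.KeepsCtx, Com.KeepsEnv]) (by simp)
    ?_ ?_).mono (Nat.mul_le_mul_right _ (by omega)) ?_
  · simpa [VStep.refl hb] using hA
  · rintro k hk t ht ⟨a1, a2, a3, a4, a5, a6⟩ hj -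
    have hAk := hAd k hk
    have hwd : ∀ {x}, x ≤ C.n → x < 2 ^ C.w := fun h => C.pos_lt h
    refine wp_vread_arr ht hS (by simp) (by omega) (by simp) (by simp [hj]; omega) ?_ ?_
    · simp only [Ex.eval_var, hj, a3 k hk]
      exact C.pos_lt (by omega)
    simp only [Ex.eval_var, hj, a3 k hk, Wp]
    simp only [Ex.ok_add, Ex.ok_var, Ex.eval_add, Ex.eval_var, true_and, St.set_r, if_true,
      reduceCtorEq, if_false, ht.m, St.set_key, a1.high _ (Nat.le_add_right _ _)]
    refine ⟨hwd (by omega), by omega, ?_⟩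
    have k1 := (((((ht.set (x := .tmp) 0 (by simp)).set (x := .adr) 0 (by simp)).set (x := .x)
      (A k) (by simp)).set (x := .y) (m + A k) (by simp)).set (x := .g) (s.key (m + A k)) (by simp))
    have v1 := a1.vset_arr hS (show 2 < 7 by omega) (j := k) (by omega) (s.key (m + A k))
    have v2 := v1.vset_arr hS (show 3 < 7 by omega) (j := k) (by omega) (m + A k)
    have v3 := v2.vset_arr hS (show 4 < 7 by omega) (j := (m + A k) % 2 ^ e)
      (Nat.mod_lt _ (by positivity)) k
    refine wp_vwrite_arr k1 hS (by simpa using a1.bounded) (by omega) (by simp)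
      (by simp [hj]; omega) (by simp) (by simp) ?_
    have k2 := (((k1.set (x := .tmp) 0 (by simp)).set (x := .adr) 0 (by simp)).set (x := .val) 0
      (by simp))
    simp only [Ex.eval_var, St.set_r, if_true, St.set_key, reduceCtorEq, if_false, hj]
    refine wp_vwrite_arr (k2.setKey _) hS (by simpa using v1.bounded) (by omega) (by simp)
      (by simp [hj]; omega) (by simp) (by simp) ?_
    have k3 := ((((k2.setKey (C.vset t.key (2 * 2 ^ e + k) (s.key (m + A k)))).set (x := .tmp) 0
      (by simp)).set (x := .adr) 0 (by simp)).set (x := .val) 0 (by simp))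
    simp only [Ex.eval_var, St.set_r, if_true, reduceCtorEq, if_false, hj,
      St.setKey_key, St.setKey_r]
    refine wp_vwrite_arr (k3.setKey _) hS (by simpa using v2.bounded) (by omega) (by simp)
      (by simp [ht.e]; exact Nat.mod_lt _ (by positivity)) (by simp) (by simp) ?_
    simp only [Ex.eval_var, St.set_r, if_true, reduceCtorEq, if_false, hj,
      St.setKey_key, St.setKey_r, Ex.eval_low, ht.e, St.set_id, St.setKey_id]
    have hl : (m + A k) % 2 ^ e < 2 ^ e := Nat.mod_lt _ (by positivity)
    have x1 := hb (m + A k) (by omega)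
    have x2 := C.word_of_pos (show m + A k ≤ C.n by omega)
    have x3 := C.word_of_pos (show k ≤ C.n by omega)
    refine ⟨v3, a2, fun j hj => ?_, fun j hj => ?_, fun j hj => ?_, fun j hj => ?_⟩
    · rw [Cfg.arr_vset hl (by omega) x3, if_neg (by omega), Cfg.arr_vset (by omega) (by omega) x2,
        if_neg (by omega), Cfg.arr_vset (by omega) (by omega) x1, if_neg (by omega), a3 j hj]
    · rw [Cfg.arr_vset hl (by omega) x3, if_neg (by omega), Cfg.arr_vset (by omega) (by omega) x2,
        if_neg (by omega), Cfg.arr_vset (by omega) (by omega) x1]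
      split_ifs with h
      · rw [h.2]
      · exact a4 j (by omega)
    · rw [Cfg.arr_vset hl (by omega) x3, if_neg (by omega), Cfg.arr_vset (by omega) (by omega) x2]
      split_ifs with h
      · rw [h.2]
      · rw [Cfg.arr_vset (by omega) (by omega) x1, if_neg (by omega)]
        exact a5 j (by omega)
    · have hl' : (m + A j) % 2 ^ e < 2 ^ e := Nat.mod_lt _ (by positivity)
      rw [Cfg.arr_vset hl hl' x3]
      split_ifs with h
      · have h1 : m + A j ≡ m + A k [MOD 2 ^ e] := h.2
        have h2 := hAd j (by omega)
        have h3 := (Nat.ModEq.add_left_cancel' m h1).eq_of_lt_of_lt (by omega) (by omega)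
        exact (hAi (show j < d by omega) hk h3).symm
      · rw [Cfg.arr_vset (by omega) hl' x2, if_neg (by omega), Cfg.arr_vset (by omega) hl' x1,
          if_neg (by omega)]
        refine a6 j ?_
        have : j ≠ k := by rintro rfl; exact h ⟨rfl, rfl⟩
        omega
  · rintro s' ⟨h1, h2, h3, -, h4⟩
    exact ⟨h1, h2, h3, h4⟩

end Radix

/-! ### The window of the remaining chunk elements -/

/-- While prefix and chunk are merged, the remaining `j` chunk elements occupy the `j` positions
from `i` on, in an arbitrary order.  The position of the `k`-th smallest one is `loc k`, and `who`
is the inverse table, which is indexed by positions modulo `D`. -/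
structure Window (D i j : ℕ) (loc who : ℕ → ℕ) : Prop where
  le : ∀ k < j, i ≤ loc k
  lt : ∀ k < j, loc k < i + j
  who : ∀ k < j, who (loc k % D) = k

theorem mod_inj_of_window {D i p p' : ℕ} (hp : i ≤ p) (hp' : i ≤ p') (h : p < i + D)
    (h' : p' < i + D) (he : p % D = p' % D) : p = p' := by
  obtain ⟨a, rfl⟩ := Nat.exists_eq_add_of_le hp
  obtain ⟨b, rfl⟩ := Nat.exists_eq_add_of_le hp'
  have := (Nat.ModEq.add_left_cancel' i (show i + a ≡ i + b [MOD D] from he)).eq_of_lt_of_lt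
    (by omega) (by omega)
  rw [this]

namespace Window
variable {D i j : ℕ} {loc who : ℕ → ℕ}

theorem congr {loc' who' : ℕ → ℕ} (h : Window D i j loc who) (hj : j ≤ D)
    (hl : ∀ k < D, loc' k = loc k) (hw : ∀ k < D, who' k = who k) : Window D i j loc' who' := by
  refine ⟨fun k hk => ?_, fun k hk => ?_, fun k hk => ?_⟩
  · rw [hl k (by omega)]; exact h.le k hk
  · rw [hl k (by omega)]; exact h.lt k hk
  · rw [hl k (by omega), hw _ (Nat.mod_lt _ (by omega))]; exact h.who k hk

theorem inj (h : Window D i j loc who) {k k' : ℕ} (hk : k < j) (hk' : k' < j)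
    (he : loc k = loc k') : k = k' := by
  rw [← h.who k hk, he, h.who k' hk']

/-- Every position of the window is taken. -/
theorem at_pos (h : Window D i j loc who) {p : ℕ} (hp : i ≤ p) (hp' : p < i + j) :
    who (p % D) < j ∧ loc (who (p % D)) = p := by
  obtain ⟨k, hk, he⟩ := Finset.surj_on_of_inj_on_of_card_le (s := Finset.range j)
    (t := Finset.Ico i (i + j)) (fun k _ => loc k)
    (fun k hk => by
      have hk : k < j := by simpa using hk
      simpa using ⟨h.le k hk, h.lt k hk⟩)
    (fun k k' hk hk' he => h.inj (by simpa using hk) (by simpa using hk') he) (by simp) p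
    (by simpa using ⟨hp, hp'⟩)
  have hk : k < j := by simpa using hk
  rw [he, h.who k hk]
  exact ⟨hk, rfl⟩

/-- The window moves to the left: the element at its end is put in front of it. -/
theorem shift (h : Window D (i + 1) j loc who) (hj : j ≤ D) (hj0 : 0 < j) :
    Window D i j (Function.update loc (who ((i + j) % D)) i)
      (Function.update who (i % D) (who ((i + j) % D))) := by
  obtain ⟨h1, h2⟩ := h.at_pos (show i + 1 ≤ i + j by omega) (by omega)
  have hne : ∀ k < j, k ≠ who ((i + j) % D) → i + 1 ≤ loc k ∧ loc k < i + j := by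
    intro k hk hne
    have h3 := h.le k hk
    have h4 := h.lt k hk
    have : loc k ≠ i + j := fun he => hne (h.inj hk h1 (by rw [he, h2]))
    omega
  refine ⟨fun k hk => ?_, fun k hk => ?_, fun k hk => ?_⟩ <;>
    by_cases hkj : k = who ((i + j) % D)
  · rw [hkj, Function.update_self]
  · rw [Function.update_of_ne hkj]; have := hne k hk hkj; omega
  · rw [hkj, Function.update_self]; omega
  · rw [Function.update_of_ne hkj]; have := hne k hk hkj; omega
  · rw [hkj, Function.update_self, Function.update_self]
  · rw [Function.update_of_ne hkj, Function.update_of_ne, h.who k hk]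
    intro he
    have h3 := hne k hk hkj
    have := mod_inj_of_window (i := i) (by omega) le_rfl (by omega) (by omega) he
    omega

/-- The largest element leaves the window: it is exchanged with the element at the end. -/
theorem drop (h : Window D i (j + 1) loc who) (hj : j + 1 ≤ D) :
    Window D i j (Function.update loc (who ((i + j) % D)) (loc j))
      (Function.update who (loc j % D) (who ((i + j) % D))) := by
  obtain ⟨h1, h2⟩ := h.at_pos (show i ≤ i + j by omega) (by omega)
  have h5 := h.le j (by omega)
  have h6 := h.lt j (by omega)
  have hne : ∀ k < j + 1, k ≠ who ((i + j) % D) → i ≤ loc k ∧ loc k < i + j := by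
    intro k hk hne
    have h3 := h.le k hk
    have h4 := h.lt k hk
    have : loc k ≠ i + j := fun he => hne (h.inj hk h1 (by rw [he, h2]))
    omega
  refine ⟨fun k hk => ?_, fun k hk => ?_, fun k hk => ?_⟩ <;>
    by_cases hkj : k = who ((i + j) % D)
  · rw [hkj, Function.update_self]; exact h5
  · rw [Function.update_of_ne hkj]; have := hne k (by omega) hkj; omega
  · rw [← hkj, Function.update_self]
    exact (hne j (by omega) (by omega)).2
  · rw [Function.update_of_ne hkj]; have := hne k (by omega) hkj; omega
  · rw [← hkj, Function.update_self, Function.update_self]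
  · rw [Function.update_of_ne hkj, Function.update_of_ne, h.who k (by omega)]
    intro he
    have h3 := hne k (by omega) hkj
    have := h.inj (by omega) (by omega)
      (mod_inj_of_window (i := i) (by omega) h5 (by omega) (by omega) he)
    omega

end Window

/-! ### Merging the prefix with the chunk -/

/-- The lists that are merged, and the result of merging them: `κ` are the keys, `A` is the order
of the chunk elements, and `μ` is the order of all elements, each given by its position before the
merge. -/
structure Lists (C : Cfg) (m d e : ℕ) (κ A μ : ℕ → ℕ) : Prop where
  sizes : Sizes C m d e
  bounded : C.Bounded κ
  sorted : ∀ a b, a < b → b < m → κ a ≤ κ b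
  A_lt : ∀ j < d, A j < d
  A_mono : ∀ a b, a < b → b < d →
    lexOrder (m + d) κ (m + A a) < lexOrder (m + d) κ (m + A b)
  A_surj : ∀ x < d, ∃ j < d, A j = x
  μ_lt : ∀ p < m + d, μ p < m + d
  μ_rank : ∀ p < m + d, rank (m + d) (lexOrder (m + d) κ) (μ p) = p

namespace Lists
variable {C : Cfg} {m d e : ℕ} {κ A μ : ℕ → ℕ} (h : Lists C m d e κ A μ)
include h

theorem μ_mono {a b : ℕ} (hab : a < b) (hb : b < m + d) :
    lexOrder (m + d) κ (μ a) < lexOrder (m + d) κ (μ b) := by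
  rw [← rank_lt_rank_iff (lexOrder_injOn κ) (h.μ_lt b hb) (h.μ_lt a (by omega)),
    h.μ_rank b hb, h.μ_rank a (by omega)]
  exact hab

theorem key_μ_le {a b : ℕ} (hab : a < b) (hb : b < m + d) : κ (μ a) ≤ κ (μ b) := by
  have h1 := h.μ_mono hab hb
  rw [lexOrder, lexOrder, lex_lt_iff (h.μ_lt b hb) (h.μ_lt a (by omega))] at h1
  omega

theorem key_μ_lt {p : ℕ} (hp : p < m + d) : κ (μ p) < 2 ^ (C.lob + C.q + 1) := by
  have := h.μ_lt p hp
  have := h.sizes.le_n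
  exact h.bounded _ (by omega)

theorem cnt_le_base : C.cnt (κ ∘ μ) (m + d) (m + d) ≤ C.base :=
  Cfg.cnt_le_base (fun _ _ hab hb => h.key_μ_le hab hb) (fun _ hp => h.key_μ_lt hp) le_rfl

theorem prefix_mono {a b : ℕ} (hab : a < b) (hb : b < m) :
    lexOrder (m + d) κ a < lexOrder (m + d) κ b := by
  have h1 := h.sorted a b hab hb
  rw [lexOrder, lexOrder, lex_lt_iff (by omega) (by omega)]
  omega

/-- The elements that have not been merged are the first `i` prefix elements and the `j` smallest
chunk elements. -/
def Remaining (_ : Lists C m d e κ A μ) (i j : ℕ) : Prop :=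
  ∀ x < m + d, rank (m + d) (lexOrder (m + d) κ) x < i + j ↔ x < i ∨ ∃ k < j, m + A k = x

omit h in
/-- A largest remaining element is the next one of the merged list. -/
theorem eq_μ (h : Lists C m d e κ A μ) {i j T x : ℕ} (hR : h.Remaining i j) (hT : i + j = T + 1)
    (hTN : T < m + d) (hx : x < m + d) (hxR : x < i ∨ ∃ k < j, m + A k = x)
    (hmax : ∀ y < m + d, (y < i ∨ ∃ k < j, m + A k = y) →
      lexOrder (m + d) κ y ≤ lexOrder (m + d) κ x) : μ T = x := by
  have h1 := (hR x hx).mpr hxR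
  have h2 := h.μ_lt T hTN
  have h3 := h.μ_rank T hTN
  have h4 := hmax _ h2 ((hR _ h2).mp (by omega))
  have h5 := rank_lt_rank_iff (lexOrder_injOn κ) h2 hx
  exact rank_inj (lexOrder_injOn κ) h2 hx (by omega)

omit h in
theorem remaining_shift (h : Lists C m d e κ A μ) {i j : ℕ} (hi : i < m)
    (hij : i + j < m + d) (hR : h.Remaining (i + 1) j) (hμ : μ (i + j) = i) :
    h.Remaining i j := by
  intro x hx
  have h1 := hR x hx
  have h2 := h.μ_rank _ hij
  rw [hμ] at h2
  constructor
  · intro hlt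
    rcases h1.mp (by omega) with h3 | h3
    · left
      have : x ≠ i := by rintro rfl; omega
      omega
    · exact .inr h3
  · intro h3
    have h4 := h1.mpr (h3.imp (fun h => by omega) id)
    have : rank (m + d) (lexOrder (m + d) κ) x ≠ i + j := by
      intro he
      have := rank_inj (lexOrder_injOn κ) hx (show i < m + d by omega) (by rw [he, h2])
      subst this
      rcases h3 with h3 | ⟨k, -, h3⟩ <;> omega
    omega

omit h in
theorem remaining_drop (h : Lists C m d e κ A μ) {i j : ℕ} (hi : i ≤ m) (hj : j < d)
    (hij : i + j < m + d) (hR : h.Remaining i (j + 1)) (hμ : μ (i + j) = m + A j) :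
    h.Remaining i j := by
  intro x hx
  have h1 := hR x hx
  have h2 := h.μ_rank _ hij
  have hA := h.A_lt j hj
  rw [hμ] at h2
  constructor
  · intro hlt
    rcases h1.mp (by omega) with h3 | ⟨k, hk, h3⟩
    · exact .inl h3
    · right
      have : k ≠ j := by rintro rfl; rw [h3] at h2; omega
      exact ⟨k, by omega, h3⟩
  · intro h3
    have h4 := h1.mpr (h3.imp id fun ⟨k, hk, h⟩ => ⟨k, by omega, h⟩)
    have : rank (m + d) (lexOrder (m + d) κ) x ≠ i + j := by
      intro he
      have := rank_inj (lexOrder_injOn κ) hx (show m + A j < m + d by omega) (by rw [he, h2])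
      subst this
      rcases h3 with h3 | ⟨k, hk, h3⟩
      · omega
      · have := h.A_mono k j hk hj
        rw [h3] at this
        omega
    omega

end Lists

/-! ### The steps of the merge -/

/-- Find the cell of the last remaining prefix element.  It is the first cell of the list of runs
that has not been passed if a run ends with the element; otherwise it is that of the next element,
which the variable `cu` holds. -/
def fetchRun : Com :=
  .jj ≔ ♯.i - 1 ;; .read .x ♯.jj ;; .r' ≔ ♯.r ;; .u' ≔ ♯.cu ;;
  .ite (.eq (♯.x >>> ♯.bq) 0) .skip
    (.r' ≔ ♯.r - 1 ;; .read .y ♯.r' ;; .u' ≔ .low (♯.y >>> ♯.lob) ♯.q)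

/-- Compute the key of the last remaining prefix element, if there is one. -/
def peekPrefix : Com :=
  .pk ≔ 0 ;; .sel ≔ 1 ;;
  .ite (.lt 0 ♯.i)
    (fetchRun ;; .pk ≔ ♯.u' <<< ♯.lob + .low ♯.x ♯.lob ;;
      .ite (.lt ♯.jj ♯.z) .skip (.pk ≔ ♯.pk + (1 : Ex) <<< ♯.bq))
    .skip

/-- Compare this key with that of the largest remaining chunk element, if there is one.  The
variable `sel` tells which of them is taken.  For equal keys it is the chunk element, which is the
later one in the original sequence.  When the prefix is exhausted, `pk = 0` makes the comparison
choose the chunk. -/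
def peekChunk (θ : ℕ) : Com :=
  .ite (.lt 0 ♯.j)
    (.jj ≔ ♯.j - 1 ;; vread θ .c (region 2 ♯.jj) ;;
      .ite (.lt ♯.c ♯.pk) .skip (.sel ≔ 0 ;; .pk ≔ ♯.c))
    .skip

/-- Move the chosen element to its final place `t`, by an exchange with the remaining chunk
element that is there. -/
def moveData (θ : ℕ) : Com :=
  .ite (.lt 0 ♯.j)
    (.ite (.eq ♯.sel 1) (.src ≔ ♯.i - 1) (.jj ≔ ♯.j - 1 ;; vread θ .src (region 3 ♯.jj)) ;;
      vread θ .jj (region 4 (.low ♯.t ♯.e)) ;; swapData ♯.src ♯.t ;;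
      vwrite θ (region 3 ♯.jj) ♯.src ;; vwrite θ (region 4 (.low ♯.src ♯.e)) ♯.jj)
    .skip

/-- Remove the chosen element from its list. -/
def advance : Com :=
  .ite (.eq ♯.sel 1) (.i ≔ ♯.i - 1 ;; .r ≔ ♯.r' ;; .cu ≔ ♯.u') (.j ≔ ♯.j - 1)

/-- Note the cell of the chosen element if a run of the merged list ends with it.  The list of runs
is built from its end, at the entries of array `6` below `base`, because the list of runs of the
prefix is still needed. -/
def putRun (θ : ℕ) : Com :=
  .u ≔ .low (♯.pk >>> ♯.lob) ♯.q ;;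
  .ite (.eq ♯.u ♯.pu) (.f ≔ 0) (.f ≔ 1 ;; .hp ≔ ♯.hp - 1 ;; vwrite θ (region 6 ♯.hp) ♯.u) ;;
  .pu ≔ ♯.u

/-- Write the key of the chosen element in compressed form.  The variable `z'` becomes the position
of the first element whose top bit is `1`. -/
def putKey : Com :=
  .ite (.eq (♯.pk >>> ♯.bq) 0) .skip (.z' ≔ ♯.t) ;; setLoC ♯.t ♯.f (.low ♯.pk ♯.lob)

section Merge
variable {C : Cfg} {m d e : ℕ} {s : St} {κ A μ : ℕ → ℕ}

theorem wp_fetchRun {i : ℕ} (hE : Env C s) (hi : s.r .i = i + 1) (him : i < m) (hmn : m ≤ C.n)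
    (htop : C.top (s.key i) = C.flag κ m i)
    (hrun : C.flag κ m i = 1 → C.mid (s.key (C.cnt κ m i)) = C.mid (κ i))
    (hr : s.r .r = C.cnt κ m (i + 1)) (hcu : i + 1 < m → s.r .cu = C.mid (κ (i + 1))) :
    Wp C.w C.n fetchRun (fun s' => s'.key = s.key ∧ s'.id = s.id ∧ s'.r .jj = i ∧
      s'.r .x = s.key i ∧ s'.r .r' = C.cnt κ m i ∧ s'.r .u' = C.mid (κ i)) s := by
  have hf := Cfg.flag_le (C := C) (κ := κ) (N := m) (p := i)
  have hc := Cfg.cnt_le (C := C) (κ := κ) (N := m) (p := i)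
  have hs := Cfg.cnt_succ (C := C) (κ := κ) (N := m) (p := i)
  have hw := C.w_pos
  rw [Cfg.top] at htop
  simp [fetchRun, Wp, hi, hE.bq, hE.lob, hE.q, htop, hw, hr]
  refine ⟨by omega, fun h => ⟨by omega, ?_⟩, fun h => ?_⟩
  · rw [Cfg.flag] at h
    have h' : i + 1 ≠ m ∧ C.mid (κ i) = C.mid (κ (i + 1)) := by
      by_contra hcon
      rw [if_pos (by tauto)] at h
      exact one_ne_zero h
    rw [hcu (by omega), h'.2]
  · have h1 : C.flag κ m i = 1 := by omega
    have h2 := hrun h1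
    rw [hs, h1, Nat.add_sub_cancel]
    exact ⟨by omega, by omega, rfl, h2⟩

/-- The key is put together from the low field of its word, the cell of its run and the top bit,
which is `1` exactly from position `z` on. -/
theorem wp_peekPrefix {i : ℕ} (hE : Env C s) (hb : ∀ p < m, κ p < 2 ^ (C.lob + C.q + 1))
    (hi : s.r .i = i) (him : i ≤ m) (hmn : m ≤ C.n)
    (hlo : ∀ p < i, C.lo (s.key p) = C.lo (κ p))
    (htop : ∀ p < i, C.top (s.key p) = C.flag κ m p)
    (hrun : ∀ p < i, C.flag κ m p = 1 → C.mid (s.key (C.cnt κ m p)) = C.mid (κ p))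
    (hr : s.r .r = C.cnt κ m i) (hcu : i < m → s.r .cu = C.mid (κ i))
    (hz : ∀ p < m, p < s.r .z ↔ κ p < 2 ^ (C.lob + C.q)) :
    Wp C.w C.n peekPrefix (fun s' => s'.key = s.key ∧ s'.id = s.id ∧ s'.r .sel = 1 ∧
      (i = 0 → s'.r .pk = 0) ∧ ∀ i', i = i' + 1 →
        s'.r .pk = κ i' ∧ s'.r .r' = C.cnt κ m i' ∧ s'.r .u' = C.mid (κ i')) s := by
  have hw := C.w_pos
  refine (show Wp C.w C.n (.pk ≔ 0) (Wp C.w C.n (.sel ≔ 1) (Wp C.w C.n (.ite ..) _)) s from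
    ⟨by simp, by simp [hw], by simp, fun h => ?_, fun h => ?_⟩)
  · obtain ⟨i, rfl⟩ : ∃ i', i = i' + 1 := ⟨i - 1, by simp [hi] at h; omega⟩
    refine Wp.seq_frame (wp_fetchRun (κ := κ) (hE.of_eq (by simp) (by simp) (by simp) (by simp)
      (by simp) (by simp) (by simp)) (by simpa using hi) (by omega) hmn
      (by simpa using htop i (by omega)) (by simpa using hrun i (by omega)) (by simpa using hr)
      (by simpa using hcu)) ?_
    rintro s' ⟨a1, a2, a3, a4, a5, a6⟩ hf
    have hE' : Env C s' := Env.of_frame (hE.of_eq (by simp) (by simp) (by simp) (by simp)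
      (by simp) (by simp) (by simp)) hf (by simp [Com.KeepsEnv, fetchRun, Com.Assigns])
    have hz' : s'.r .z = s.r .z := by rw [hf _ (by simp [fetchRun, Com.Assigns])]; simp
    have hsel : s'.r .sel = 1 := by rw [hf _ (by simp [fetchRun, Com.Assigns])]; simp
    have hκ := hb i (by omega)
    have hκw := C.word_lt hκ
    have hlo := hlo i (by omega)
    have hpk := C.pack_fields (κ i)
    have htl := C.top_le hκ
    have htop0 : C.top (κ i) = 0 ↔ κ i < 2 ^ (C.lob + C.q) := by
      rw [Cfg.top, Nat.div_eq_zero_iff_lt (by positivity)]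
    rw [Cfg.pack, Nat.add_mul, mul_assoc, ← pow_add, Nat.add_comm C.q C.lob] at hpk
    simp only [St.set_key, Cfg.lo] at hlo a4
    rw [Cfg.lo] at hpk
    have hzi := hz i (by omega)
    simp [Wp, a6, hE'.lob, a4, a3, hz', hsel, hE'.bq, hlo, a1, a2, hw, a5]
    refine ⟨⟨?_, ?_⟩, fun h => ?_, fun h => ?_⟩
    · refine lt_of_le_of_lt ?_ hκw; omega
    · refine lt_of_le_of_lt ?_ hκw; omega
    · rw [htop0.mpr (hzi.mp h)] at hpk
      omega
    · have : C.top (κ i) ≠ 0 := fun h0 => by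
        have := hzi.mpr (htop0.mp h0); omega
      rw [show C.top (κ i) = 1 by omega] at hpk
      refine ⟨⟨?_, ?_⟩, ?_⟩
      · refine lt_of_le_of_lt ?_ hκw; omega
      · refine lt_of_le_of_lt ?_ hκw; omega
      · omega
  · have : i = 0 := by simpa [hi] using h
    simp [Wp, this]

/-- The choice between the two lists. -/
theorem wp_peekChunk {i j T : ℕ} (h : Lists C m d e κ A μ) (hc : Ctx C m d e s)
    (hj : s.r .j = j) (him : i ≤ m) (hjd : j ≤ d) (hT : i + j = T + 1) (hsel : s.r .sel = 1)
    (hpk : i = 0 → s.r .pk = 0) (hpk' : ∀ i', i = i' + 1 → s.r .pk = κ i')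
    (hSK : ∀ k < d, C.arr e s.key 2 k = κ (m + A k)) (hR : h.Remaining i j) :
    Wp C.w C.n (peekChunk C.θ) (fun s' => s'.key = s.key ∧ s'.id = s.id ∧ s'.r .pk = κ (μ T) ∧
      (s'.r .sel = 1 ∧ i ≠ 0 ∧ μ T = i - 1 ∨
        s'.r .sel = 0 ∧ j ≠ 0 ∧ μ T = m + A (j - 1))) s := by
  have hw := C.w_pos
  have hn := h.sizes.le_n
  have hd := h.sizes.d_le
  have hlast : ∀ k < j, lexOrder (m + d) κ (m + A k) ≤ lexOrder (m + d) κ (m + A (j - 1)) := by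
    intro k hk
    rcases (show k < j - 1 ∨ k = j - 1 by omega) with h' | rfl
    · exact (h.A_mono _ _ h' (by omega)).le
    · rfl
  have hlast' : ∀ x < i, lexOrder (m + d) κ x ≤ lexOrder (m + d) κ (i - 1) := by
    intro x hx
    rcases (show x < i - 1 ∨ x = i - 1 by omega) with h' | rfl
    · exact (h.prefix_mono h' (by omega)).le
    · rfl
  have hcmp : i ≠ 0 → j ≠ 0 → (lexOrder (m + d) κ (m + A (j - 1)) < lexOrder (m + d) κ (i - 1) ↔
      κ (m + A (j - 1)) < κ (i - 1)) := by
    intro hi hj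
    have := h.A_lt (j - 1) (by omega)
    rw [lexOrder, lexOrder, lex_lt_iff (by omega) (by omega)]
    omega
  refine ⟨by simp, fun hj0 => ?_, fun hj0 => ?_⟩
  · simp only [Cond.holds_lt, Ex.eval_zero, Ex.eval_var, hj] at hj0
    have hA := h.A_lt (j - 1) (by omega)
    have hSKj := hSK (j - 1) (by omega)
    have hbA := C.word_lt (h.bounded (m + A (j - 1)) (by omega))
    refine ⟨by simp [hj, hw]; omega, ?_⟩
    refine wp_vread_arr (hc.set _ (by simp)) h.sizes (by simp) (by omega) (by simp)
      (by simp [hj]; omega) ?_ ?_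
    · simp [hj, hSKj, hbA]
    simp [Wp, hj, hSKj, hsel]
    refine ⟨fun hlt => ?_, fun hle => ?_⟩
    · have hi : i ≠ 0 := by
        intro hi; rw [hpk hi] at hlt; omega
      have hpki := hpk' (i - 1) (by omega)
      have := h.eq_μ hR hT (by omega) (x := i - 1) (by omega) (.inl (by omega)) (by
        rintro y hy (hy' | ⟨k, hk, rfl⟩)
        · exact hlast' y hy'
        · rw [hpki] at hlt
          exact (hlast k hk).trans ((hcmp hi (by omega)).mpr hlt).le)
      rw [this]
      exact ⟨hpki, hi, rfl⟩
    · have := h.eq_μ hR hT (by omega) (x := m + A (j - 1)) (by omega)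
        (.inr ⟨j - 1, by omega, rfl⟩) (by
        rintro y hy (hy' | ⟨k, hk, rfl⟩)
        · have hi : i ≠ 0 := by omega
          have hpki := hpk' (i - 1) (by omega)
          rw [hpki] at hle
          refine (hlast' y hy').trans ?_
          by_contra hcon
          have := (hcmp hi (by omega)).mp (not_le.mp hcon)
          omega
        · exact hlast k hk)
      rw [this]
      exact ⟨rfl, by omega, rfl⟩
  · have hj0 : j = 0 := by simpa [hj] using hj0
    subst hj0
    have hpki := hpk' (i - 1) (by omega)
    have := h.eq_μ hR hT (by omega) (x := i - 1) (by omega) (.inl (by omega)) (by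
        rintro y hy (hy' | ⟨k, hk, rfl⟩)
        · exact hlast' y hy'
        · omega)
    refine ⟨rfl, rfl, ?_, ?_⟩
    · rw [this, hpki]
    · rw [this]; exact .inl ⟨hsel, by omega, rfl⟩

/-- The data are moved according to the choice. -/
theorem wp_moveData {i j i' j' T : ℕ} {ι : ℕ → ℕ} (h : Lists C m d e κ A μ) (hc : Ctx C m d e s)
    (hb : C.Bounded s.key) (ht : s.r .t = T) (hi : s.r .i = i) (hj : s.r .j = j) (him : i ≤ m)
    (hjd : j ≤ d) (hT : i + j = T + 1)
    (hW : Window (2 ^ e) i j (C.arr e s.key 3) (C.arr e s.key 4))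
    (hidP : ∀ p < i, s.id p = ι p) (hidL : ∀ k < j, s.id (C.arr e s.key 3 k) = ι (m + A k))
    (hsel : s.r .sel = 1 ∧ i = i' + 1 ∧ j = j' ∧ μ T = i' ∨
      s.r .sel = 0 ∧ i = i' ∧ j = j' + 1 ∧ μ T = m + A j') :
    Wp C.w C.n (moveData C.θ) (fun s' => VStep C m s.key s'.key ∧
      Window (2 ^ e) i' j' (C.arr e s'.key 3) (C.arr e s'.key 4) ∧
      (∀ k < 7, k ≠ 3 → k ≠ 4 → ∀ a < 2 ^ e, C.arr e s'.key k a = C.arr e s.key k a) ∧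
      (∀ p < i', s'.id p = ι p) ∧ (∀ k < j', s'.id (C.arr e s'.key 3 k) = ι (m + A k)) ∧
      s'.id T = ι (μ T) ∧ ∀ p, T < p → s'.id p = s.id p) s := by
  have hw := C.w_pos
  have hn := h.sizes.le_n
  have hd := h.sizes.d_le
  refine ⟨by simp, fun hj0 => ?_, fun hj0 => ?_⟩
  swap
  · have hj0 : j = 0 := by simpa [hj] using hj0
    obtain ⟨h1, rfl, rfl, h2⟩ : s.r .sel = 1 ∧ i = i' + 1 ∧ j = j' ∧ μ T = i' := by
      rcases hsel with h' | h'
      · exact h'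
      · omega
    subst hj0
    obtain rfl : i' = T := by omega
    refine ⟨VStep.refl hb, ⟨by omega, by omega, by omega⟩, fun _ _ _ _ _ _ => rfl,
      fun p hp => hidP p (by omega), by omega, ?_, fun _ _ => rfl⟩
    rw [h2, hidP _ (by omega)]
  simp only [Cond.holds_lt, Ex.eval_zero, Ex.eval_var, hj] at hj0
  obtain ⟨hJ, hJT⟩ := hW.at_pos (show i ≤ T by omega) (by omega)
  -- The element at position `T` is the `J`-th of the remaining chunk elements; it gives way to the
  -- chosen element, which comes from position `S`.
  set J := C.arr e s.key 4 (T % 2 ^ e) with hJdef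
  obtain ⟨S, hS⟩ : ∃ S, S = if s.r .sel = 1 then i - 1 else C.arr e s.key 3 (j - 1) := ⟨_, rfl⟩
  have hle := hW.le (j - 1) (by omega)
  have hlt := hW.lt (j - 1) (by omega)
  have hST : S ≤ T := by rw [hS]; split_ifs <;> omega
  have hiS : i' ≤ S := by
    rw [hS]
    rcases hsel with ⟨h1, rfl, rfl, h2⟩ | ⟨h1, rfl, rfl, h2⟩
    · rw [if_pos h1]; omega
    · rw [if_neg (by omega)]; exact hle
  have hTn : T < C.n := by omega
  have hml : T % 2 ^ e < 2 ^ e := Nat.mod_lt _ (by positivity)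
  have hSl : S % 2 ^ e < 2 ^ e := Nat.mod_lt _ (by positivity)
  refine Wp.seq_frame (Q := fun s' => s'.key = s.key ∧ s'.id = s.id ∧ s'.r .src = S) ?_
    fun s1 ⟨a1, a2, a3⟩ f1 => ?_
  · refine ⟨by simp [hw], fun hs => ?_, fun hs => ?_⟩
    · have hs : s.r .sel = 1 := by simpa using hs
      simp [Wp, hw, hi, hS, hs]
      omega
    · have hs : ¬ s.r .sel = 1 := by simpa using hs
      refine ⟨by simp [hw, hj]; omega, ?_⟩
      refine wp_vread_arr (hc.set _ (by simp)) h.sizes (by simp) (by omega) (by simp)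
        (by simp [hj]; omega) ?_ ?_
      · simp [hj]
        exact C.pos_lt (by omega)
      · simp [hj, hS, hs]
  have c1 := hc.of_frame f1 (by simp [Com.KeepsCtx, Com.KeepsEnv, Com.Assigns])
  have t1 : s1.r .t = T := by rw [f1 _ (by simp [Com.Assigns]), ht]
  clear f1
  refine wp_vread_arr c1 h.sizes (by simp) (by omega) (by simp)
    (by simpa [t1, c1.e] using hml) ?_ ?_
  · simp only [Ex.eval_low, Ex.eval_var, t1, c1.e, a1, ← hJdef]
    exact C.pos_lt (by omega)
  simp only [Ex.eval_low, Ex.eval_var, t1, c1.e, a1, ← hJdef]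
  have c2 := ((c1.set (x := .tmp) 0 (by simp)).set (x := .adr) 0 (by simp)).set (x := .jj) J
    (by simp)
  refine wp_swapData (a := .src) (b := .t) (by simp) (by simp) (by simp [a3]; omega)
    (by simp [t1]; omega) ?_
  have hx1 := C.word_of_pos (show S ≤ C.n by omega)
  have hx2 := C.word_of_pos (show J ≤ C.n by omega)
  have v1 := (VStep.refl (m := m) hb).vset_arr h.sizes (show 3 < 7 by omega) (j := J) (by omega) S
  have v2 := v1.vset_arr h.sizes (show 4 < 7 by omega) (j := S % 2 ^ e) hSl J
  have c3 : Ctx C m d e ((((((s1.set .tmp 0).set .adr 0).set .jj J).set .tmp 0).set .val 0).setId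
      (s.id ∘ Equiv.swap S T)) := by
    have := (c2.set (x := .tmp) 0 (by simp)).set (x := .val) 0 (by simp)
    exact ⟨⟨this.n, this.q, this.lob, this.bq, this.b, this.half, this.base⟩, this.m, this.d,
      this.D, this.e⟩
  simp only [St.set_r, reduceCtorEq, if_false, a3, t1, St.set_id, a2]
  refine wp_vwrite_arr c3 h.sizes (by simpa [a1] using hb) (by omega) (by simp)
    (by simp; omega) (by simp) (by simp) ?_
  simp only [Ex.eval_var, St.set_r, reduceCtorEq, if_false, if_true, a3, St.setId_r, St.set_key,
    St.setId_key, a1]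
  have c4 := (((c3.set (x := .tmp) 0 (by simp)).set (x := .adr) 0 (by simp)).set (x := .val) 0
    (by simp)).setKey (C.vset s.key (3 * 2 ^ e + J) S)
  have e4 : s1.r .e = e := c1.e
  refine wp_vwrite_arr c4 h.sizes (by simpa using v1.bounded) (by omega) (by simp)
    (by simpa [a3, e4] using hSl) (by simp) (by simp) ?_
  simp only [Ex.eval_var, St.set_r, reduceCtorEq, if_false, if_true, a3, St.setId_r,
    St.setKey_r, St.setKey_key, Ex.eval_low, e4, St.set_id, St.setKey_id, St.setId_id]
  set κ' := C.vset (C.vset s.key (3 * 2 ^ e + J) S) (4 * 2 ^ e + S % 2 ^ e) J with hκ'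
  have g3 : ∀ k < 2 ^ e, C.arr e κ' 3 k = Function.update (C.arr e s.key 3) J S k := by
    intro k hk
    rw [hκ', Cfg.arr_vset hSl hk hx2, if_neg (by omega), Cfg.arr_vset (by omega) hk hx1,
      Function.update_apply]
    simp
  have g4 : ∀ k < 2 ^ e, C.arr e κ' 4 k =
      Function.update (C.arr e s.key 4) (S % 2 ^ e) J k := by
    intro k hk
    rw [hκ', Cfg.arr_vset hSl hk hx2, Cfg.arr_vset (by omega) hk hx1, Function.update_apply]
    simp
  have hidS : s.id S = ι (μ T) := by
    rw [hS]
    rcases hsel with ⟨h1, rfl, rfl, h2⟩ | ⟨h1, rfl, rfl, h2⟩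
    · rw [if_pos h1, h2, hidP _ (by omega)]; rfl
    · rw [if_neg (by omega), h2, Nat.add_sub_cancel, hidL _ (by omega)]
  -- The exchange does not move any other chunk element.
  have hother : ∀ k < j', k ≠ J → C.arr e s.key 3 k ≠ S ∧ C.arr e s.key 3 k ≠ T := by
    intro k hk hkJ
    refine ⟨fun he => ?_, fun he => hkJ (hW.inj (by omega) hJ (by rw [he, hJT]))⟩
    have h5 := hW.le k (by omega)
    rw [hS] at he
    rcases hsel with ⟨h1, rfl, rfl, h2⟩ | ⟨h1, rfl, rfl, h2⟩
    · rw [if_pos h1] at he; omega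
    · rw [if_neg (by omega), Nat.add_sub_cancel] at he
      have := hW.inj (by omega) (by omega) he
      omega
  refine ⟨v2, ?_, fun k hk7 hk3 hk4 a ha => ?_, fun p hp => ?_, fun k hk => ?_, ?_, fun p hp => ?_⟩
  · rcases hsel with ⟨h1, rfl, rfl, h2⟩ | ⟨h1, rfl, rfl, h2⟩
    · refine (hW.shift (by omega) hj0).congr (by omega) ?_ ?_
      · intro k hk
        rw [g3 k hk, hJdef, hS, if_pos h1, show i' + j = T by omega, Nat.add_sub_cancel]
      · intro k hk
        rw [g4 k hk, hJdef, hS, if_pos h1, show i' + j = T by omega, Nat.add_sub_cancel]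
    · refine (hW.drop (by omega)).congr (by omega) ?_ ?_
      · intro k hk
        rw [g3 k hk, hJdef, hS, if_neg (by omega), show i + j' = T by omega, Nat.add_sub_cancel]
      · intro k hk
        rw [g4 k hk, hJdef, hS, if_neg (by omega), show i + j' = T by omega, Nat.add_sub_cancel]
  · rw [hκ', Cfg.arr_vset hSl ha hx2, if_neg (by omega), Cfg.arr_vset (by omega) ha hx1,
      if_neg (by omega)]
  · rw [Function.comp_apply, Equiv.swap_apply_of_ne_of_ne (by omega) (by omega)]
    exact hidP p (by omega)
  · rw [g3 k (by omega), Function.comp_apply]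
    by_cases hkJ : k = J
    · rw [hkJ, Function.update_self, Equiv.swap_apply_left, ← hJT]
      exact hidL J hJ
    · rw [Function.update_of_ne hkJ, Equiv.swap_apply_of_ne_of_ne (hother k hk hkJ).1
        (hother k hk hkJ).2]
      exact hidL k (by omega)
  · rw [Function.comp_apply, Equiv.swap_apply_right, hidS]
  · rw [Function.comp_apply, Equiv.swap_apply_of_ne_of_ne (by omega) (by omega)]

theorem wp_advance {i j i' j' : ℕ} (hi : s.r .i = i) (hj : s.r .j = j)
    (hsel : s.r .sel = 1 ∧ i = i' + 1 ∧ j = j' ∨ s.r .sel = 0 ∧ i = i' ∧ j = j' + 1)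
    {w n : ℕ} (hw : 0 < w) {r cu : ℕ}
    (h1 : s.r .sel = 1 → s.r .r' = r ∧ s.r .u' = cu)
    (h0 : s.r .sel = 0 → s.r .r = r ∧ s.r .cu = cu) :
    Wp w n advance (fun s' => s'.key = s.key ∧ s'.id = s.id ∧ s'.r .i = i' ∧ s'.r .j = j' ∧
      s'.r .r = r ∧ s'.r .cu = cu) s := by
  rcases hsel with ⟨h, rfl, rfl⟩ | ⟨h, rfl, rfl⟩
  · simp [advance, Wp, hi, hj, h, h1 h, hw]
  · simp [advance, Wp, hi, hj, h, h0 h, hw]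

end Merge

/-- One step of the merge: the final element at position `t` is found. -/
def mergeBody (θ : ℕ) : Com :=
  peekPrefix ;; peekChunk θ ;; moveData θ ;; advance ;; putRun θ ;; putKey

section Merge
variable {C : Cfg} {m d e : ℕ} {s : St} {κ A μ : ℕ → ℕ}

theorem Cfg.flag_eq_one_iff {C : Cfg} {κ : ℕ → ℕ} {N p : ℕ} :
    C.flag κ N p = 1 ↔ p + 1 = N ∨ C.mid (κ p) ≠ C.mid (κ (p + 1)) := by
  rw [Cfg.flag]; split_ifs with h <;> simp [h]

theorem wp_putRun {T : ℕ} (h : Lists C m d e κ A μ) (hc : Ctx C m d e s)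
    (hb : C.Bounded s.key) (hT : T < m + d) (hpk : s.r .pk = κ (μ T))
    (hpu : s.r .pu = if T + 1 = m + d then 2 ^ C.q else C.mid (κ (μ (T + 1))))
    (hhp : s.r .hp + C.cnt (κ ∘ μ) (m + d) (m + d) = C.base + C.cnt (κ ∘ μ) (m + d) (T + 1))
    (hH : ∀ p < m + d, T + 1 ≤ p → C.flag (κ ∘ μ) (m + d) p = 1 →
      C.arr e s.key 6 (C.base + C.cnt (κ ∘ μ) (m + d) p - C.cnt (κ ∘ μ) (m + d) (m + d)) =
        C.mid (κ (μ p))) :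
    Wp C.w C.n (putRun C.θ) (fun s' => VStep C m s.key s'.key ∧ s'.id = s.id ∧
      (∀ k < 6, ∀ a < 2 ^ e, C.arr e s'.key k a = C.arr e s.key k a) ∧
      s'.r .f = C.flag (κ ∘ μ) (m + d) T ∧ s'.r .pu = C.mid (κ (μ T)) ∧
      s'.r .hp + C.cnt (κ ∘ μ) (m + d) (m + d) = C.base + C.cnt (κ ∘ μ) (m + d) T ∧
      ∀ p < m + d, T ≤ p → C.flag (κ ∘ μ) (m + d) p = 1 →
        C.arr e s'.key 6 (C.base + C.cnt (κ ∘ μ) (m + d) p - C.cnt (κ ∘ μ) (m + d) (m + d)) =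
          C.mid (κ (μ p))) s := by
  have hw := C.w_pos
  have hbase := h.cnt_le_base
  have hs := Cfg.cnt_succ (C := C) (κ := κ ∘ μ) (N := m + d) (p := T)
  have hflag : C.flag (κ ∘ μ) (m + d) T = 1 ↔ C.mid (κ (μ T)) ≠ s.r .pu := by
    rw [Cfg.flag_eq_one_iff, hpu]
    split_ifs with hT'
    · have := C.mid_lt (κ (μ T))
      simp only [hT', true_or, true_iff]
      omega
    · simp [hT']
  have hfl := Cfg.flag_le (C := C) (κ := κ ∘ μ) (N := m + d) (p := T)
  have hu : (Ex.low (♯.pk >>> ♯.lob) ♯.q).eval s.r = C.mid (κ (μ T)) := by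
    simp [hpk, hc.lob, hc.q, Cfg.mid]
  refine (show Wp C.w C.n (.u ≔ .low (♯.pk >>> ♯.lob) ♯.q) (Wp C.w C.n (.ite ..) _) s from
    ⟨by simp, by simp, fun hE => ?_, fun hE => ?_⟩)
  · rw [hu] at hE ⊢
    have hE : C.mid (κ (μ T)) = s.r .pu := by simpa using hE
    have hf0 : C.flag (κ ∘ μ) (m + d) T = 0 := by
      have := hflag.not.mpr (by simpa using hE)
      omega
    simp only [Wp, Ex.ok_zero, Ex.ok_var, Ex.eval_zero, Ex.eval_var, true_and, St.set_key,
      St.set_id, St.set_r, reduceCtorEq, if_false, if_true]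
    refine ⟨VStep.refl hb, fun _ _ _ _ => trivial, hf0.symm, by omega, fun p hp hTp hf => ?_⟩
    refine hH p hp ?_ hf
    have : p ≠ T := by rintro rfl; omega
    omega
  · rw [hu] at hE ⊢
    have hE : ¬ C.mid (κ (μ T)) = s.r .pu := by simpa using hE
    have hf1 := hflag.mpr hE
    have hhp0 : s.r .hp = C.base + C.cnt (κ ∘ μ) (m + d) T -
        C.cnt (κ ∘ μ) (m + d) (m + d) + 1 := by omega
    have hcT := Cfg.cnt_lt_cnt (C := C) (κ := κ ∘ μ) (N := m + d) hT hf1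
    have hbe := h.sizes.base_le
    have hxu : C.mid (κ (μ T)) < 2 ^ (C.lob + C.q + 1) :=
      (C.mid_lt _).trans_le (Nat.pow_le_pow_right (by omega) (by omega))
    set H := C.base + C.cnt (κ ∘ μ) (m + d) T - C.cnt (κ ∘ μ) (m + d) (m + d) with hH0
    refine ⟨by simp [hw], by simp [hw, hhp0], ?_⟩
    refine wp_vwrite_arr (((hc.set (x := .u) _ (by simp)).set (x := .f) _
      (by simp)).set (x := .hp) _ (by simp)) h.sizes (by simpa using hb) (by omega) (by simp)
      ?_ (by simp) (by simp) ?_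
    · simp [hhp0]; omega
    simp only [Wp, Ex.ok_var, Ex.eval_var, Ex.eval_one, Ex.eval_sub, true_and, St.set_key,
      St.setKey_key, St.set_id, St.setKey_id, St.set_r, St.setKey_r, reduceCtorEq, if_false,
      if_true, hhp0, Nat.add_sub_cancel]
    refine ⟨(VStep.refl hb).vset_arr h.sizes (by omega) (by omega) _, fun k hk a ha => ?_,
      hf1.symm, by omega, fun p hp hTp hf => ?_⟩
    · rw [Cfg.arr_vset (by omega) ha hxu, if_neg (by omega)]
    · have hcp := Cfg.cnt_lt_cnt (C := C) (κ := κ ∘ μ) (N := m + d) hp hf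
      rw [Cfg.arr_vset (by omega) (by omega) hxu]
      rcases (show p = T ∨ T + 1 ≤ p by omega) with rfl | hp'
      · rw [if_pos ⟨rfl, rfl⟩]
      · have := Cfg.cnt_lt_cnt (C := C) (κ := κ ∘ μ) (N := m + d) (show T < p by omega) hf1
        rw [if_neg (by omega), hH p hp hp' hf]

theorem wp_putKey {T : ℕ} (h : Lists C m d e κ A μ) (hc : Ctx C m d e s)
    (hT : T < m + d) (ht : s.r .t = T) (hpk : s.r .pk = κ (μ T))
    (hf : s.r .f = C.flag (κ ∘ μ) (m + d) T)
    (hz1 : T + 1 ≤ s.r .z') (hz2 : s.r .z' ≤ m + d)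
    (hz : ∀ p < m + d, T + 1 ≤ p → (s.r .z' ≤ p ↔ 2 ^ (C.lob + C.q) ≤ κ (μ p))) :
    Wp C.w C.n putKey (fun s' => s'.id = s.id ∧
      s'.key = C.setLo s.key T (C.flag (κ ∘ μ) (m + d) T) (C.lo (κ (μ T))) ∧
      T ≤ s'.r .z' ∧ s'.r .z' ≤ m + d ∧
      ∀ p < m + d, T ≤ p → (s'.r .z' ≤ p ↔ 2 ^ (C.lob + C.q) ≤ κ (μ p))) s := by
  have hn := h.sizes.le_n
  refine Wp.seq_frame (Q := fun s' => s'.id = s.id ∧ s'.key = s.key ∧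
      T ≤ s'.r .z' ∧ s'.r .z' ≤ m + d ∧
      ∀ p < m + d, T ≤ p → (s'.r .z' ≤ p ↔ 2 ^ (C.lob + C.q) ≤ κ (μ p))) ?_ ?_
  · refine ⟨by simp, fun h0 => ?_, fun h0 => ?_⟩
    · have h0 : κ (μ T) < 2 ^ (C.lob + C.q) := by simpa [hpk, hc.bq] using h0
      refine ⟨rfl, rfl, by omega, hz2, fun p hp hTp => ?_⟩
      rcases (show p = T ∨ T + 1 ≤ p by omega) with rfl | hp'
      · omega
      · exact hz p hp hp'
    · have h0 : 2 ^ (C.lob + C.q) ≤ κ (μ T) := by simpa [hpk, hc.bq] using h0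
      simp only [Wp, Ex.ok_var, Ex.eval_var, ht, St.set_id, St.set_key, St.set_r, if_true,
        true_and, le_refl]
      refine ⟨hT.le, fun p hp hTp => ⟨fun _ => ?_, fun _ => hTp⟩⟩
      rcases (show p = T ∨ T < p by omega) with rfl | hp'
      · exact h0
      · exact h0.trans (h.key_μ_le hp' hp)
  · rintro s' ⟨a1, a2, a3⟩ fr
    have hc' := hc.of_frame fr (by simp [Com.KeepsCtx, Com.KeepsEnv, Com.Assigns])
    have ht' : s'.r .t = T := by rw [fr _ (by simp [Com.Assigns]), ht]
    have hf' : s'.r .f = C.flag (κ ∘ μ) (m + d) T := by rw [fr _ (by simp [Com.Assigns]), hf]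
    have hpk' : s'.r .pk = κ (μ T) := by rw [fr _ (by simp [Com.Assigns]), hpk]
    have hl : κ (μ T) % 2 ^ C.lob < 2 ^ C.lob := Cfg.lo_lt _
    refine wp_setLoC hc'.toEnv (by simp) (by simp) (by simp) (by simp) (by simp) (by simp)
      (by simp [ht']; omega) (by simpa [hf'] using Cfg.flag_le)
      (by simpa [hc'.lob, hpk'] using hl) ?_
    simpa [ht', hf', hpk', hc'.lob, a1, a2, Cfg.lo] using a3

/-- The state of the merge when the elements at the positions from `t` on are final.  The fields
`r`, `cu`, `z`, `lo`, `top` and `run` describe the compressed list of the remaining prefix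
elements, and `pu`, `hp`, `z'`, `lo'`, `top'` and `run'` that of the final elements.  The data are
given by `ι` before the merge. -/
structure MergeInv (h : Lists C m d e κ A μ) (ι : ℕ → ℕ) (t : ℕ) (s : St) : Prop where
  ctx : Ctx C m d e s
  sum : s.r .i + s.r .j = t
  i_le : s.r .i ≤ m
  j_le : s.r .j ≤ d
  r : s.r .r = C.cnt κ m (s.r .i)
  cu : s.r .i < m → s.r .cu = C.mid (κ (s.r .i))
  pu : s.r .pu = if t = m + d then 2 ^ C.q else C.mid (κ (μ t))
  hp : s.r .hp + C.cnt (κ ∘ μ) (m + d) (m + d) = C.base + C.cnt (κ ∘ μ) (m + d) t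
  le_z : t ≤ s.r .z'
  z_le : s.r .z' ≤ m + d
  z' : ∀ p < m + d, t ≤ p → (s.r .z' ≤ p ↔ 2 ^ (C.lob + C.q) ≤ κ (μ p))
  z : ∀ p < m, p < s.r .z ↔ κ p < 2 ^ (C.lob + C.q)
  bounded : C.Bounded s.key
  lo : ∀ p < s.r .i, C.lo (s.key p) = C.lo (κ p)
  top : ∀ p < s.r .i, C.top (s.key p) = C.flag κ m p
  run : ∀ p < s.r .i, C.flag κ m p = 1 → C.mid (s.key (C.cnt κ m p)) = C.mid (κ p)
  lo' : ∀ p < m + d, t ≤ p → C.lo (s.key p) = C.lo (κ (μ p))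
  top' : ∀ p < m + d, t ≤ p → C.top (s.key p) = C.flag (κ ∘ μ) (m + d) p
  run' : ∀ p < m + d, t ≤ p → C.flag (κ ∘ μ) (m + d) p = 1 →
    C.arr e s.key 6 (C.base + C.cnt (κ ∘ μ) (m + d) p - C.cnt (κ ∘ μ) (m + d) (m + d)) =
      C.mid (κ (μ p))
  high : ∀ p, m + d ≤ p → s.key p = κ p
  chunk : ∀ k < d, C.arr e s.key 2 k = κ (m + A k)
  window : Window (2 ^ e) (s.r .i) (s.r .j) (C.arr e s.key 3) (C.arr e s.key 4)
  id_prefix : ∀ p < s.r .i, s.id p = ι p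
  id_chunk : ∀ k < s.r .j, s.id (C.arr e s.key 3 k) = ι (m + A k)
  id_out : ∀ p < m + d, t ≤ p → s.id p = ι (μ p)
  id_high : ∀ p, m + d ≤ p → s.id p = ι p
  remaining : h.Remaining (s.r .i) (s.r .j)

theorem wp_mergeBody (h : Lists C m d e κ A μ) {ι : ℕ → ℕ} {T : ℕ} (hT : T < m + d)
    (hI : MergeInv h ι (T + 1) s) :
    Wp C.w C.n (mergeBody C.θ) (MergeInv h ι T) (s.set .t T) := by
  have hn := h.sizes.le_n
  have hw := C.w_pos
  obtain ⟨i, hi⟩ : ∃ i, s.r .i = i := ⟨_, rfl⟩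
  obtain ⟨j, hj⟩ : ∃ j, s.r .j = j := ⟨_, rfl⟩
  obtain ⟨x1, x2, x3, x4, x5, x6, x7, x8, x9, x10, x11, x12, x13, x14, x15, x16, x17, x18, x19,
    x20, x21, x22, x23, x24, x25, x26, x27⟩ := hI
  rw [hi] at x2 x3 x5 x6 x14 x15 x16 x22 x23 x27
  rw [hj] at x2 x4 x22 x24 x27
  have c0 : Ctx C m d e (s.set .t T) := x1.set _ (by simp)
  refine Wp.seq_frame (wp_peekPrefix (κ := κ) (i := i) (m := m) c0.toEnv
    (fun p hp => h.bounded p (by omega))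
    (by simpa using hi) (by omega) (by omega) (by simpa using x14) (by simpa using x15)
    (by simpa using x16) (by simpa using x5) (by simpa using x6) (by simpa using x12)) ?_
  rintro s1 ⟨a1, a2, a3, a4, a5⟩ f1
  have c1 := c0.of_frame f1
    (by simp [Com.KeepsCtx, Com.KeepsEnv, peekPrefix, fetchRun, Com.Assigns])
  have g1 : ∀ y ∈ [Var.t, .i, .j, .r, .cu, .pu, .hp, .z, .z'], s1.r y = (s.set .t T).r y := by
    intro y hy
    apply f1
    simp only [List.mem_cons, List.not_mem_nil, or_false] at hy
    rcases hy with rfl | rfl | rfl | rfl | rfl | rfl | rfl | rfl | rfl <;>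
      simp [peekPrefix, fetchRun, Com.Assigns]
  clear f1
  simp only [St.set_key] at a1
  simp only [St.set_id] at a2
  refine Wp.seq_frame (wp_peekChunk (i := i) (j := j) (T := T) h c1
    (by rw [g1 _ (by simp)]; simpa using hj) x3 x4 x2 a3 a4 (fun i' hi' => (a5 i' hi').1)
    (by rw [a1]; exact x21) x27) ?_
  rintro s2 ⟨b1, b2, b3, b4⟩ f2
  have c2 := c1.of_frame f2 (by simp [Com.KeepsCtx, Com.KeepsEnv, peekChunk, Com.Assigns])
  have g2 : ∀ y ∈ [Var.t, .i, .j, .r, .cu, .pu, .hp, .z, .z', .r', .u'], s2.r y = s1.r y := by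
    intro y hy
    apply f2
    simp only [List.mem_cons, List.not_mem_nil, or_false] at hy
    rcases hy with rfl | rfl | rfl | rfl | rfl | rfl | rfl | rfl | rfl | rfl | rfl <;>
      simp [peekChunk, Com.Assigns]
  clear f2
  rw [a1] at b1
  rw [a2] at b2
  obtain ⟨i', j', hsel⟩ : ∃ i' j', s2.r .sel = 1 ∧ i = i' + 1 ∧ j = j' ∧ μ T = i' ∨
      s2.r .sel = 0 ∧ i = i' ∧ j = j' + 1 ∧ μ T = m + A j' := by
    rcases b4 with ⟨h1, h2, h3⟩ | ⟨h1, h2, h3⟩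
    · exact ⟨i - 1, j, .inl ⟨h1, by omega, rfl, h3⟩⟩
    · exact ⟨i, j - 1, .inr ⟨h1, rfl, by omega, h3⟩⟩
  have i2 : s2.r .i = i := by rw [g2 _ (by simp), g1 _ (by simp)]; simpa using hi
  have j2 : s2.r .j = j := by rw [g2 _ (by simp), g1 _ (by simp)]; simpa using hj
  have t2 : s2.r .t = T := by rw [g2 _ (by simp), g1 _ (by simp)]; simp
  refine Wp.seq_frame (wp_moveData (ι := ι) h c2 (by rwa [b1]) t2 i2 j2 x3 x4 x2
    (by rwa [b1]) (by rwa [b2]) (by rwa [b1, b2]) hsel) ?_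
  rintro s3 ⟨d1, d2, d3, d4, d5, d6, d7⟩ f3
  have c3 := c2.of_frame f3 (by simp [Com.KeepsCtx, Com.KeepsEnv, moveData, Com.Assigns])
  have g3 : ∀ y ∈ [Var.t, .i, .j, .r, .cu, .pu, .hp, .z, .z', .r', .u', .sel, .pk],
      s3.r y = s2.r y := by
    intro y hy
    apply f3
    simp only [List.mem_cons, List.not_mem_nil, or_false] at hy
    rcases hy with rfl | rfl | rfl | rfl | rfl | rfl | rfl | rfl | rfl | rfl | rfl | rfl | rfl <;>
      simp [moveData, Com.Assigns]
  clear f3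
  rw [b1] at d1 d3
  rw [b2] at d7
  refine Wp.seq_frame (wp_advance (i' := i') (j' := j') (r := C.cnt κ m i')
    (cu := if i' < m then C.mid (κ i') else s2.r .cu)
    ((g3 _ (by simp)).trans i2) ((g3 _ (by simp)).trans j2) (by
      rw [g3 _ (by simp)]
      rcases hsel with h | h
      · exact .inl ⟨h.1, h.2.1, h.2.2.1⟩
      · exact .inr ⟨h.1, h.2.1, h.2.2.1⟩) hw ?_ ?_) ?_
  · rw [g3 _ (by simp), g3 .r' (by simp), g3 .u' (by simp), g2 .r' (by simp), g2 .u' (by simp)]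
    intro h1
    rcases hsel with h | h
    · have := a5 i' h.2.1
      rw [if_pos (by omega)]
      exact this.2
    · omega
  · rw [g3 _ (by simp), g3 .r (by simp), g3 .cu (by simp), g2 .r (by simp), g2 .cu (by simp),
      g1 .r (by simp), g1 .cu (by simp)]
    intro h1
    rcases hsel with h | h
    · omega
    · rw [← h.2.1]
      refine ⟨by simpa using x5, ?_⟩
      split_ifs with h'
      · simpa using x6 h'
      · rfl
  rintro s4 ⟨e1, e2, e3, e4, e5, e6⟩ f4
  have c4 := c3.of_frame f4 (by simp [Com.KeepsCtx, Com.KeepsEnv, advance, Com.Assigns])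
  have g4 : ∀ y ∈ [Var.t, .pu, .hp, .z, .z', .pk], s4.r y = s3.r y := by
    intro y hy
    apply f4
    simp only [List.mem_cons, List.not_mem_nil, or_false] at hy
    rcases hy with rfl | rfl | rfl | rfl | rfl | rfl <;> simp [advance, Com.Assigns]
  clear f4
  have pk4 : s4.r .pk = κ (μ T) := by rw [g4 _ (by simp), g3 _ (by simp), b3]
  have gg : ∀ y ∈ [Var.pu, .hp, .z, .z'], s4.r y = s.r y := by
    intro y hy
    simp only [List.mem_cons, List.not_mem_nil, or_false] at hy
    rw [g4 _ (by rcases hy with rfl | rfl | rfl | rfl <;> simp),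
      g3 _ (by rcases hy with rfl | rfl | rfl | rfl <;> simp),
      g2 _ (by rcases hy with rfl | rfl | rfl | rfl <;> simp),
      g1 _ (by rcases hy with rfl | rfl | rfl | rfl <;> simp)]
    rcases hy with rfl | rfl | rfl | rfl <;> simp
  have t4 : s4.r .t = T := by rw [g4 _ (by simp), g3 _ (by simp), t2]
  -- The entries of the list of runs stay inside of array `6`.
  have hD : ∀ p < m + d, C.base + C.cnt (κ ∘ μ) (m + d) p - C.cnt (κ ∘ μ) (m + d) (m + d) ≤
      2 ^ e - 1 ∨ C.flag (κ ∘ μ) (m + d) p ≠ 1 := by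
    intro p hp
    by_cases hf : C.flag (κ ∘ μ) (m + d) p = 1
    · have := Cfg.cnt_lt_cnt (C := C) (κ := κ ∘ μ) (N := m + d) hp hf
      have := h.sizes.base_le
      exact .inl (by omega)
    · exact .inr hf
  have hDpos : 0 < 2 ^ e := by positivity
  have run4 : ∀ p < m + d, T + 1 ≤ p → C.flag (κ ∘ μ) (m + d) p = 1 →
      C.arr e s4.key 6 (C.base + C.cnt (κ ∘ μ) (m + d) p - C.cnt (κ ∘ μ) (m + d) (m + d)) =
        C.mid (κ (μ p)) := by
    intro p hp hTp hf
    have := hD p hp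
    rw [e1, d3 6 (by omega) (by omega) (by omega) _ (by omega), x19 p hp hTp hf]
  refine Wp.seq_frame (wp_putRun h c4 (by rw [e1]; exact d1.bounded) hT pk4
    (by rw [gg _ (by simp), x7]) (by rw [gg _ (by simp), x8]) run4) ?_
  rintro s5 ⟨k1, k2, k3, k4, k5, k6, k7⟩ f5
  have c5 := c4.of_frame f5 (by simp [Com.KeepsCtx, Com.KeepsEnv, putRun, Com.Assigns])
  have g5 : ∀ y ∈ [Var.t, .z, .z', .pk, .i, .j, .r, .cu], s5.r y = s4.r y := by
    intro y hy
    apply f5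
    simp only [List.mem_cons, List.not_mem_nil, or_false] at hy
    rcases hy with rfl | rfl | rfl | rfl | rfl | rfl | rfl | rfl <;> simp [putRun, Com.Assigns]
  clear f5
  rw [e1] at k1 k3
  rw [e2] at k2
  refine (wp_putKey h c5 hT (by rw [g5 _ (by simp), t4]) (by rw [g5 _ (by simp), pk4]) k4
    (by rw [g5 _ (by simp), gg _ (by simp)]; exact x9)
    (by rw [g5 _ (by simp), gg _ (by simp)]; exact x10)
    (by rw [g5 _ (by simp), gg _ (by simp)]; exact x11)).frame.mono ?_
  rintro s6 ⟨⟨l1, l2, l3, l4, l5⟩, f6⟩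
  have c6 := c5.of_frame f6 (by simp [Com.KeepsCtx, Com.KeepsEnv, putKey, Com.Assigns])
  have g6 : ∀ y ∈ [Var.z, .i, .j, .r, .cu, .pu, .hp], s6.r y = s5.r y := by
    intro y hy
    apply f6
    simp only [List.mem_cons, List.not_mem_nil, or_false] at hy
    rcases hy with rfl | rfl | rfl | rfl | rfl | rfl | rfl <;> simp [putKey, Com.Assigns]
  clear f6
  have i6 : s6.r .i = i' := by rw [g6 _ (by simp), g5 _ (by simp), e3]
  have j6 : s6.r .j = j' := by rw [g6 _ (by simp), g5 _ (by simp), e4]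
  have hl := C.lo_lt (κ (μ T))
  have vv := d1.trans k1
  have harr : ∀ k a, C.arr e s6.key k a = C.arr e s5.key k a := by
    intro k a
    rw [l2, Cfg.arr, Cfg.vw_setLo hl]; rfl
  have hij : i' + j' = T := by
    rcases hsel with ⟨h1, rfl, rfl, h2⟩ | ⟨h1, rfl, rfl, h2⟩ <;> omega
  have hi'm : i' ≤ m := by rcases hsel with ⟨h1, rfl, rfl, h2⟩ | ⟨h1, rfl, rfl, h2⟩ <;> omega
  have hj'd : j' ≤ d := by rcases hsel with ⟨h1, rfl, rfl, h2⟩ | ⟨h1, rfl, rfl, h2⟩ <;> omega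
  have hi'i : i' ≤ i := by rcases hsel with ⟨h1, rfl, rfl, h2⟩ | ⟨h1, rfl, rfl, h2⟩ <;> omega
  have hde := h.sizes.d_le
  have hlo6 : ∀ p, C.lo (s6.key p) = if p = T then C.lo (κ (μ T)) else C.lo (s.key p) := by
    intro p; rw [l2, Cfg.lo_setLo hl, vv.lo]
  have htop6 : ∀ p, C.top (s6.key p) =
      if p = T then C.flag (κ ∘ μ) (m + d) T else C.top (s.key p) := by
    intro p; rw [l2, Cfg.top_setLo hl, vv.top]
  have harr3 : ∀ a < 2 ^ e, C.arr e s6.key 3 a = C.arr e s3.key 3 a := by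
    intro a ha; rw [harr, k3 3 (by omega) a ha]
  have hid : s6.id = s3.id := l1.trans k2
  constructor
  · exact c6
  · rw [i6, j6, hij]
  · rw [i6]; exact hi'm
  · rw [j6]; exact hj'd
  · rw [g6 _ (by simp), g5 _ (by simp), e5, i6]
  · rw [i6, g6 .cu (by simp), g5 .cu (by simp), e6]
    intro h'; rw [if_pos h']
  · rw [g6 _ (by simp), k5, if_neg (by omega)]
  · rw [g6 _ (by simp), k6]
  · exact l3
  · exact l4
  · exact l5
  · rw [g6 _ (by simp), g5 _ (by simp), gg _ (by simp)]; exact x12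
  · rw [l2]; exact vv.bounded.setLo Cfg.flag_le hl
  · intro p hp
    rw [hlo6, if_neg (by omega), x14 p (by omega)]
  · intro p hp
    rw [htop6, if_neg (by omega), x15 p (by omega)]
  · intro p hp hf
    rw [l2, Cfg.mid_setLo hl, vv.low, x16 p (by omega) hf]
    exact Cfg.cnt_lt_base h.sorted (fun p hp => h.bounded p (by omega)) (by omega)
  · intro p hp hTp
    rw [hlo6]
    split_ifs with hpT
    · rw [hpT]
    · exact x17 p hp (by omega)
  · intro p hp hTp
    rw [htop6]
    split_ifs with hpT
    · rw [hpT]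
    · exact x18 p hp (by omega)
  · intro p hp hTp hf
    rw [harr, k7 p hp hTp hf]
  · intro p hp
    rw [l2, Cfg.setLo_of_ne (by omega), vv.high p (by omega), x20 p hp]
  · intro k hk
    rw [harr, k3 2 (by omega) k (by omega), d3 2 (by omega) (by omega) (by omega) k (by omega),
      x21 k hk]
  · rw [i6, j6]
    refine d2.congr (by omega) harr3 fun k hk => ?_
    rw [harr, k3 4 (by omega) k hk]
  · rw [i6, hid]; exact d4
  · rw [j6, hid]
    intro k hk
    rw [harr3 k (by omega)]
    exact d5 k hk
  · intro p hp hTp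
    rw [hid]
    rcases (show p = T ∨ T < p by omega) with rfl | hp'
    · exact d6
    · rw [d7 p hp', x25 p hp hp']
  · intro p hp
    rw [hid, d7 p (by omega), x26 p hp]
  · rw [i6, j6]
    rcases hsel with ⟨h1, rfl, rfl, h2⟩ | ⟨h1, rfl, rfl, h2⟩
    · exact h.remaining_shift (by omega) (by omega) x27 (by rw [hij, h2])
    · exact h.remaining_drop (by omega) (by omega) (by omega) x27 (by rw [hij, h2])

end Merge

/-! ### A round -/

/-- The merge of prefix and chunk, with the keys in compressed form.  The initial value `2 ^ q` of
`pu` is different from all cells, so that a run ends with the last element. -/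
def merge (θ : ℕ) : Com :=
  .i ≔ ♯.m ;; .j ≔ ♯.d ;; .t ≔ ♯.m + ♯.d ;; .z' ≔ ♯.t ;; .pu ≔ ♯.half ;; .hp ≔ ♯.base ;;
  forDown .t (mergeBody θ)

/-- Move an entry of the list of runs to its final place. -/
def copyRunBody (θ : ℕ) : Com := vread θ .c (region 6 (♯.hp + ♯.i)) ;; setCellC ♯.i ♯.c

/-- Move the list of runs of the merged list to its final place. -/
def copyRuns (θ : ℕ) : Com := .g ≔ ♯.base - ♯.hp ;; forUp .i .g (copyRunBody θ)

/-- Restore the key at position `t`. -/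
def decodeBody : Com :=
  peekPrefix ;; .i ≔ ♯.t ;; .write ♯.t ♯.pk ;; .r ≔ ♯.r' ;; .cu ≔ ♯.u'

/-- Restore the keys of the merged list. -/
def decode : Com :=
  .z ≔ ♯.z' ;; .r ≔ ♯.base - ♯.hp ;; .i ≔ ♯.m + ♯.d ;; .t ≔ ♯.i ;; forDown .t decodeBody

/-- Extend the sorted prefix by a chunk. -/
def round (θ : ℕ) : Com :=
  compress ;; radix θ ;; forUp .j .d (buildBody θ) ;; merge θ ;; copyRuns θ ;; decode

/-- A bound for the time of a round, per element of the prefix. -/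
def roundCost (θ : ℕ) : ℕ :=
  compressBody.cost + radixCost θ + (buildBody θ).cost + 2 * (mergeBody θ).cost +
    (copyRunBody θ).cost + 2 * decodeBody.cost + 128

theorem Cfg.exists_flag_of_lt_cnt {C : Cfg} {κ : ℕ → ℕ} {N P k : ℕ} (h : k < C.cnt κ N P) :
    ∃ p < P, C.flag κ N p = 1 ∧ C.cnt κ N p = k := by
  induction P with
  | zero => simp [Cfg.cnt_zero] at h
  | succ P ih =>
    have hf := Cfg.flag_le (C := C) (κ := κ) (N := N) (p := P)
    rw [Cfg.cnt_succ] at h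
    by_cases hk : k < C.cnt κ N P
    · obtain ⟨p, hp, h'⟩ := ih hk
      exact ⟨p, by omega, h'⟩
    · exact ⟨P, by omega, by omega, by omega⟩

section Round
variable {C : Cfg} {m d e : ℕ} {s : St} {κ A μ : ℕ → ℕ}

theorem merge_spec (h : Lists C m d e κ A μ) (hc : Ctx C m d e s) (hb : C.Bounded s.key)
    (hP : C.Packed κ m s.key) (hhigh : ∀ p, m + d ≤ p → s.key p = κ p)
    (hr : s.r .r = C.cnt κ m m) (hz : ∀ p < m, p < s.r .z ↔ κ p < 2 ^ (C.lob + C.q))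
    (h2 : ∀ k < d, C.arr e s.key 2 k = κ (m + A k)) (h3 : ∀ k < d, C.arr e s.key 3 k = m + A k)
    (h4 : ∀ k < d, C.arr e s.key 4 ((m + A k) % 2 ^ e) = k) :
    Spec C.w C.n (merge C.θ) s (14 + (m + d + 2) * ((mergeBody C.θ).cost + 8))
      (MergeInv h s.id 0) := by
  have hn := h.sizes.le_n
  refine Spec.seq (T := 2) (Wp.spec (c := _ ≔ _) ⟨by simp, ?_⟩) |>.mono
    (T := 2 + (2 + (4 + (2 + (2 + (2 + (m + d + 2) * ((mergeBody C.θ).cost + 8)))))))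
    (by omega) fun _ h => h
  refine Spec.seq (T := 2) (Wp.spec (c := _ ≔ _) ⟨by simp, ?_⟩)
  refine Spec.seq (T := 4) (Wp.spec (c := _ ≔ _) ⟨?_, ?_⟩)
  · simp [hc.m, hc.d]; exact C.pos_lt (by omega)
  refine Spec.seq (T := 2) (Wp.spec (c := _ ≔ _) ⟨by simp, ?_⟩)
  refine Spec.seq (T := 2) (Wp.spec (c := _ ≔ _) ⟨by simp, ?_⟩)
  refine Spec.seq (T := 2) (Wp.spec (c := _ ≔ _) ⟨by simp, ?_⟩)
  simp only [Ex.eval_var, Ex.eval_add, St.set_r, reduceCtorEq, if_false, if_true, hc.m, hc.d,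
    hc.half, hc.base]
  refine (Spec.for_down (MergeInv h s.id) (B := m + d) (T := (mergeBody C.θ).cost) (by simp)
    C.w_pos (by simp [mergeBody, peekPrefix, fetchRun, peekChunk, moveData, advance, putRun, putKey,
      Com.Assigns]) ?_ fun T hT s' hI ht hf => (wp_mergeBody h hT hI).spec)
  constructor
  case ctx =>
    exact (((((hc.set _ (by simp)).set _ (by simp)).set _ (by simp)).set _ (by simp)).set _
      (by simp)).set _ (by simp)
  case window =>
    simp only [St.set_r, reduceCtorEq, if_false, if_true, St.set_key]
    refine ⟨fun k hk => ?_, fun k hk => ?_, fun k hk => ?_⟩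
    · rw [h3 k hk]; omega
    · rw [h3 k hk]; have := h.A_lt k hk; omega
    · rw [h3 k hk, h4 k hk]
  case remaining =>
    simp only [St.set_r, reduceCtorEq, if_false, if_true]
    intro x hx
    refine ⟨fun _ => ?_, fun _ => rank_lt hx⟩
    by_cases hxm : x < m
    · exact .inl hxm
    · obtain ⟨k, hk, hA⟩ := h.A_surj (x - m) (by omega)
      exact .inr ⟨k, hk, by omega⟩
  case id_chunk =>
    simp only [St.set_r, reduceCtorEq, if_false, if_true, St.set_key, St.set_id]
    intro k hk
    rw [h3 k hk]
  all_goals simp only [St.set_r, reduceCtorEq, if_false, if_true, St.set_key, St.set_id]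
  case i_le => rfl
  case j_le => rfl
  case r => exact hr
  case cu => omega
  case le_z => rfl
  case z_le => rfl
  case z' => omega
  case z => exact hz
  case bounded => exact hb
  case lo => exact hP.lo
  case top => exact hP.top
  case run => exact hP.run
  case lo' => omega
  case top' => omega
  case run' => omega
  case high => exact hhigh
  case chunk => exact h2
  case id_prefix => exact fun _ _ => trivial
  case id_out => omega
  case id_high => exact fun _ _ => trivial

/-- The list of runs is brought to its final place. -/
theorem copyRuns_spec {ι : ℕ → ℕ} (h : Lists C m d e κ A μ) (hI : MergeInv h ι 0 s) :
    Spec C.w C.n (copyRuns C.θ) s (4 + (m + 2) * ((copyRunBody C.θ).cost + 8)) fun s' =>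
      Ctx C m d e s' ∧ C.Bounded s'.key ∧ C.Packed (κ ∘ μ) (m + d) s'.key ∧
      (∀ p, m + d ≤ p → s'.key p = s.key p) ∧ s'.id = s.id := by
  have hn := h.sizes.le_n
  have hbase := h.cnt_le_base
  have hbe := h.sizes.base_le
  have hf := h.sizes.fits
  have hhp := hI.hp
  rw [Cfg.cnt_zero] at hhp
  have hc := hI.ctx
  have hg : (♯.base - ♯.hp).eval s.r = C.cnt (κ ∘ μ) (m + d) (m + d) := by
    simp [hc.base]; omega
  refine Spec.seq (T := 4) (Wp.spec (c := _ ≔ _) ⟨?_, ?_⟩)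
  · simp [hc.base]; omega
  rw [hg]
  set R := C.cnt (κ ∘ μ) (m + d) (m + d) with hR
  refine ((Ctx.for_up (B := R) (hc.set (x := .g) R (by simp)) (fun k s' => C.Bounded s'.key ∧
    s'.id = s.id ∧ (∀ p, C.lo (s'.key p) = C.lo (s.key p)) ∧
    (∀ p, C.top (s'.key p) = C.top (s.key p)) ∧ (∀ p, m + d ≤ p → s'.key p = s.key p) ∧
    (∀ a, C.arr e s'.key 6 a = C.arr e s.key 6 a) ∧
    ∀ p < m + d, C.flag (κ ∘ μ) (m + d) p = 1 → C.cnt (κ ∘ μ) (m + d) p < k →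
      C.mid (s'.key (C.cnt (κ ∘ μ) (m + d) p)) = C.mid (κ (μ p)))
    (by simp) (by omega) (by simp) (by simp [copyRunBody, Com.Assigns])
    (by simp [copyRunBody, Com.Assigns])
    (by simp [copyRunBody, Com.Assigns, Com.KeepsCtx, Com.KeepsEnv]) (by simp) ?_ ?_).mono
      (Nat.mul_le_mul_right _ (by omega)) ?_)
  · simp
    exact hI.bounded
  · rintro k hk t ht ⟨a1, a2, a3, a4, a5, a6, a7⟩ hi hfr
    have hthp : t.r .hp = s.r .hp := by
      rw [hfr _ (by simp) (by simp [copyRunBody, Com.Assigns])]; simp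
    obtain ⟨p, hp, hpf, rfl⟩ := Cfg.exists_flag_of_lt_cnt hk
    have hH := hI.run' p hp (by omega) hpf
    rw [show C.base + C.cnt (κ ∘ μ) (m + d) p - R =
      s.r .hp + C.cnt (κ ∘ μ) (m + d) p by omega] at hH
    have hmq := C.mid_lt (κ (μ p))
    have hmw : C.mid (κ (μ p)) < 2 ^ C.w := by
      have : 2 ^ C.q ≤ 2 ^ C.w := Nat.pow_le_pow_right (by omega) (by have := C.bits_le; omega)
      omega
    refine wp_vread_arr ht h.sizes (by simp) (by omega) ?_ ?_ ?_ ?_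
    · simp [hi, hthp]; exact C.pos_lt (by omega)
    · simp [hi, hthp]; omega
    · simp [hi, hthp, a6, hH, hmw]
    simp only [Ex.eval_add, Ex.eval_var, hi, hthp, a6, hH]
    refine wp_setCellC (((ht.set (x := .tmp) 0 (by simp)).set (x := .adr) 0 (by simp)).set
      (x := .c) _ (by simp)).toEnv (by simpa using a1) (by simp) (by simp) (by simp) (by simp)
      (by simp [hi]; omega) (by simpa using hmq) ?_
    simp only [Ex.eval_var, hi, St.set_r, reduceCtorEq, if_false, if_true, St.set_key, St.set_id,
      St.setKey_key, St.setKey_id]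
    refine ⟨a1.setCell hmq, a2, fun p' => ?_, fun p' => ?_, fun p' hp' => ?_, fun a => ?_,
      fun p' hp' hf' hlt => ?_⟩
    · rw [Cfg.lo_setCell, a3]
    · rw [Cfg.top_setCell hmq, a4]
    · rw [Cfg.setCell_of_ne (by omega), a5 p' hp']
    · rw [Cfg.arr, Cfg.vw_setCell (by omega)]; exact a6 a
    · rw [Cfg.mid_setCell hmq]
      split_ifs with he
      · have : p' = p := by
          rcases lt_trichotomy p' p with hl | hl | hl
          · have := Cfg.cnt_lt_cnt (C := C) (κ := κ ∘ μ) (N := m + d) hl hf'; omega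
          · exact hl
          · have := Cfg.cnt_lt_cnt (C := C) (κ := κ ∘ μ) (N := m + d) hl hpf; omega
        rw [this]
      · exact a7 p' hp' hf' (by omega)
  · rintro s' ⟨b1, b2, b3, b4, b5, b6, -, b7⟩
    refine ⟨b1, b2, ⟨fun p hp => ?_, fun p hp => ?_, fun p hp hf => ?_⟩, b6, b3⟩
    · rw [b4, hI.lo' p hp (by omega)]; rfl
    · rw [b5, hI.top' p hp (by omega)]
    · exact b7 p hp hf (Cfg.cnt_lt_cnt hp hf)

/-- The merged list is decoded in place, from right to left: the list of runs lies at positions that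
are not overwritten before the entries are read, since at most `p` runs end before position `p`. -/
theorem decode_spec (h : Lists C m d e κ A μ) (hc : Ctx C m d e s)
    (hP : C.Packed (κ ∘ μ) (m + d) s.key)
    (hhp : s.r .hp + C.cnt (κ ∘ μ) (m + d) (m + d) = C.base)
    (hz : ∀ p < m + d, s.r .z' ≤ p ↔ 2 ^ (C.lob + C.q) ≤ κ (μ p)) :
    Spec C.w C.n decode s (12 + (m + d + 2) * (decodeBody.cost + 8)) fun s' =>
      Ctx C m d e s' ∧ (∀ p < m + d, s'.key p = κ (μ p)) ∧
      (∀ p, m + d ≤ p → s'.key p = s.key p) ∧ s'.id = s.id := by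
  have hn := h.sizes.le_n
  refine Spec.seq (T := 2) (Wp.spec (c := _ ≔ _) ⟨by simp, ?_⟩) |>.mono
    (T := 2 + (4 + (4 + (2 + (m + d + 2) * (decodeBody.cost + 8)))))
    (by omega) fun _ h => h
  refine Spec.seq (T := 4) (Wp.spec (c := _ ≔ _) ⟨?_, ?_⟩)
  · simp [hc.base]; omega
  refine Spec.seq (T := 4) (Wp.spec (c := _ ≔ _) ⟨?_, ?_⟩)
  · simp [hc.m, hc.d]; exact C.pos_lt (by omega)
  refine Spec.seq (T := 2) (Wp.spec (c := _ ≔ _) ⟨by simp, ?_⟩)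
  have hR : s.r .base - s.r .hp = C.cnt (κ ∘ μ) (m + d) (m + d) := by rw [hc.base]; omega
  simp only [Ex.eval_var, Ex.eval_add, Ex.eval_sub, St.set_r, reduceCtorEq, if_false, if_true,
    hc.m, hc.d, hR]
  have hkeep : decodeBody.KeepsCtx := by
    simp [Com.KeepsCtx, Com.KeepsEnv, decodeBody, peekPrefix, fetchRun, Com.Assigns]
  refine (Spec.for_down (T := decodeBody.cost) (B := m + d) (fun k s' => Ctx C m d e s' ∧
    s'.r .z = s.r .z' ∧ s'.r .i = k ∧ s'.r .r = C.cnt (κ ∘ μ) (m + d) k ∧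
    (k < m + d → s'.r .cu = C.mid (κ (μ k))) ∧ s'.id = s.id ∧
    (∀ p < k, s'.key p = s.key p) ∧ (∀ p < m + d, k ≤ p → s'.key p = κ (μ p)) ∧
    ∀ p, m + d ≤ p → s'.key p = s.key p) (by simp) C.w_pos
    (by simp [decodeBody, peekPrefix, fetchRun, Com.Assigns]) ?_ ?_).mono le_rfl ?_
  · simp
    refine ⟨(((hc.set _ (by simp)).set _ (by simp)).set _ (by simp)).set _ (by simp), ?_⟩
    omega
  · rintro k hk t ⟨a0, a1, a2, a3, a4, a5, a6, a7, a8⟩ htk -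
    refine Wp.spec ?_
    have c0 : Ctx C m d e (t.set .t k) := a0.set _ (by simp)
    refine Wp.seq_frame (wp_peekPrefix (κ := κ ∘ μ) (i := k + 1) (m := m + d) c0.toEnv
      (fun p hp => h.key_μ_lt hp) (by simpa using a2) (by omega) hn ?_ ?_ ?_ (by simpa using a3)
      (by simpa using a4) ?_) ?_
    · intro p hp; simp only [St.set_key, a6 p hp]; exact hP.lo p (by omega)
    · intro p hp; simp only [St.set_key, a6 p hp]; exact hP.top p (by omega)
    · intro p hp hf
      have := Cfg.cnt_le (C := C) (κ := κ ∘ μ) (N := m + d) (p := p)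
      simp only [St.set_key]
      rw [a6 _ (by omega)]
      exact hP.run p (by omega) hf
    · intro p hp
      have := hz p hp
      simp [a1]
      omega
    · rintro s1 ⟨b1, b2, b3, -, b5⟩ f1
      obtain ⟨b6, b7, b8⟩ := b5 k rfl
      have c1 := c0.of_frame f1
        (by simp [Com.KeepsCtx, Com.KeepsEnv, peekPrefix, fetchRun, Com.Assigns])
      have t1 : s1.r .t = k := by rw [f1 _ (by simp [peekPrefix, fetchRun, Com.Assigns])]; simp
      have z1 : s1.r .z = s.r .z' := by
        rw [f1 _ (by simp [peekPrefix, fetchRun, Com.Assigns])]; simpa using a1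
      simp only [Wp, Ex.ok_var, Ex.eval_var, St.set_r, St.setKey_r, reduceCtorEq, if_false,
        if_true, t1, true_and, St.set_key, St.setKey_key, St.set_id, St.setKey_id, b1, b6, z1, b7,
        b8]
      refine ⟨by omega, ((((c1.set _ (by simp)).setKey _).set _ (by simp)).set _ (by simp)),
        fun _ => rfl, b2.trans a5, fun p hp => ?_, fun p hp hkp => ?_, fun p hp => ?_⟩
      · rw [Function.update_of_ne (by omega), a6 p (by omega)]
      · by_cases hpk : p = k
        · rw [hpk, Function.update_self]; rfl
        · rw [Function.update_of_ne hpk, a7 p hp (by omega)]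
      · rw [Function.update_of_ne (by omega), a8 p hp]
  · rintro s' ⟨b0, -, -, -, -, b5, -, b7, b8⟩
    exact ⟨b0, fun p hp => b7 p hp (by omega), b8, b5⟩

/-- The order of the chunk that the radix sort finds, and the order of the merged list. -/
theorem exists_lists (hS : Sizes C m d e) (hb : C.Bounded κ)
    (hs : ∀ a b, a < b → b < m → κ a ≤ κ b) :
    ∃ A μ, Lists C m d e κ A μ ∧ ∀ k < d, rank d (lexOrder d fun y => κ (m + y)) (A k) = k := by
  have h1 : ∀ k, ∃ x, k < d → x < d ∧ rank d (lexOrder d fun y => κ (m + y)) x = k := by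
    intro k
    by_cases hk : k < d
    · obtain ⟨x, hx, h⟩ := exists_rank_eq (lexOrder_injOn fun y => κ (m + y)) hk
      exact ⟨x, fun _ => ⟨hx, h⟩⟩
    · exact ⟨0, fun h => absurd h hk⟩
  have h2 : ∀ p, ∃ x, p < m + d → x < m + d ∧ rank (m + d) (lexOrder (m + d) κ) x = p := by
    intro k
    by_cases hk : k < m + d
    · obtain ⟨x, hx, h⟩ := exists_rank_eq (lexOrder_injOn κ) hk
      exact ⟨x, fun _ => ⟨hx, h⟩⟩
    · exact ⟨0, fun h => absurd h hk⟩
  choose A hA using h1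
  choose μ hμ using h2
  refine ⟨A, μ, ⟨hS, hb, hs, fun j hj => (hA j hj).1, fun a b hab hbd => ?_, fun x hx => ?_,
    fun p hp => (hμ p hp).1, fun p hp => (hμ p hp).2⟩, fun k hk => (hA k hk).2⟩
  · obtain ⟨a1, a2⟩ := hA a (by omega)
    obtain ⟨b1, b2⟩ := hA b hbd
    have := (rank_lt_rank_iff (lexOrder_injOn fun y => κ (m + y)) b1 a1).mp (by omega)
    rw [lexOrder, lexOrder, lex_lt_iff b1 a1] at this
    rw [lexOrder, lexOrder, lex_lt_iff (by omega) (by omega)]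
    omega
  · have hr := rank_lt (f := lexOrder d fun y => κ (m + y)) hx
    obtain ⟨a1, a2⟩ := hA _ hr
    exact ⟨_, hr, rank_inj (lexOrder_injOn _) a1 hx a2⟩

/-- In a round the first `m + d` elements are sorted stably. -/
theorem round_spec (hc : Ctx C m d e s) (hS : Sizes C m d e) (hb : C.Bounded s.key)
    (hs : ∀ a b, a < b → b < m → s.key a ≤ s.key b) :
    Spec C.w C.n (round C.θ) s ((m + 2) * roundCost C.θ) fun s' => Ctx C m d e s' ∧
      (∃ μ : ℕ → ℕ, (∀ p < m + d, μ p < m + d) ∧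
        (∀ a b, a < b → b < m + d →
          lexOrder (m + d) s.key (μ a) < lexOrder (m + d) s.key (μ b)) ∧
        ∀ p < m + d, s'.key p = s.key (μ p) ∧ s'.id p = s.id (μ p)) ∧
      ∀ p, m + d ≤ p → s'.key p = s.key p ∧ s'.id p = s.id p := by
  have hn := hS.le_n
  have hde := hS.d_le
  have hD := hS.D_le
  obtain ⟨A, μ, h, hA⟩ := exists_lists hS hb hs
  have hbm : ∀ p < m, s.key p < 2 ^ (C.lob + C.q + 1) := fun p hp => hb p (by omega)
  refine (Spec.seq_frame (compress_spec hc.toEnv hb hc.m (by omega) hs) ?_).mono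
    (T := _ + ((m + 2) * radixCost C.θ + ((m + 2) * ((buildBody C.θ).cost + 8) +
      ((14 + (m + d + 2) * ((mergeBody C.θ).cost + 8)) +
      ((4 + (m + 2) * ((copyRunBody C.θ).cost + 8)) +
      (12 + (m + d + 2) * (decodeBody.cost + 8))))))) ?_ fun _ h => h
  swap
  · have : ∀ X, (m + d + 2) * X ≤ (m + 2) * (2 * X) := fun X => by
      rw [← mul_assoc]; exact Nat.mul_le_mul_right _ (by omega)
    have h1 := this ((mergeBody C.θ).cost + 8)
    have h2 := this (decodeBody.cost + 8)
    rw [roundCost]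
    nlinarith
  rintro s1 ⟨a1, a2, a3, a4, a5, a6⟩ f1
  have c1 := hc.of_frame f1
    (by simp [Com.KeepsCtx, Com.KeepsEnv, compress, compressBody, findFlag, Com.Assigns])
  clear f1
  refine Spec.seq_frame (radix_spec c1 hS a1) ?_
  rintro s2 ⟨c2, b2, b3, b4⟩ f2
  have r2 : s2.r .r = s1.r .r := f2 _ (by simp [radix, radixPass, radixClear, radixCount, radixSum,
    radixMove, radixCopy, radixCountBody, radixSumBody, radixMoveBody, radixCopyBody, digit,
    Com.Assigns])
  have z2 : s2.r .z = s1.r .z := f2 _ (by simp [radix, radixPass, radixClear, radixCount, radixSum,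
    radixMove, radixCopy, radixCountBody, radixSumBody, radixMoveBody, radixCopyBody, digit,
    Com.Assigns])
  clear f2
  have hlex : (fun y => s1.key (m + y)) = fun y => s.key (m + y) := by
    funext y; exact a3 _ (by omega)
  rw [hlex] at b4
  have hAd := h.A_lt
  refine Spec.seq_frame (build_spec (A := A) c2 hS b2.bounded (fun j hj => ?_) hAd ?_) ?_
  · have := b4 _ (hAd j hj)
    rwa [hA j hj] at this
  · intro a ha b hb he
    rw [← hA a ha, ← hA b hb, he]
  rintro s3 ⟨c3, d2, d3, d4, d5, d6⟩ f3
  have r3 : s3.r .r = s2.r .r := f3 _ (by simp [buildBody, Com.Assigns])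
  have z3 : s3.r .z = s2.r .z := f3 _ (by simp [buildBody, Com.Assigns])
  clear f3
  have vv := b2.trans d2
  refine Spec.seq (merge_spec h c3 d2.bounded (vv.packed a2 hs hbm) ?_ ?_ ?_ ?_ d5 d6
    |>.mono le_rfl ?_)
  · intro p hp; rw [vv.high _ (by omega), a3 _ (by omega)]
  · rw [r3, r2, a5]
  · rw [z3, z2]; exact a6
  · intro k hk; rw [d4 k hk, b2.high _ (by omega), a3 _ (by omega)]
  intro s4 hI
  refine Spec.seq_frame (copyRuns_spec h hI) ?_
  rintro s5 ⟨c5, e2, e3, e4, e5⟩ f5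
  have hp5 : s5.r .hp = s4.r .hp := f5 _ (by simp [copyRuns, copyRunBody, Com.Assigns])
  have z5 : s5.r .z' = s4.r .z' := f5 _ (by simp [copyRuns, copyRunBody, Com.Assigns])
  refine (decode_spec h c5 e3 ?_ ?_).mono le_rfl ?_
  · rw [hp5, hI.hp, Cfg.cnt_zero, Nat.add_zero]
  · intro p hp; rw [z5]; exact hI.z' p hp (by omega)
  rintro s6 ⟨c6, g2, g3, g4⟩
  have hid3 : s3.id = s.id := by rw [d3, b3, a4]
  refine ⟨c6, ⟨μ, h.μ_lt, fun a b hab hb => h.μ_mono hab hb, fun p hp => ⟨g2 p hp, ?_⟩⟩,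
    fun p hp => ⟨?_, ?_⟩⟩
  · rw [g4, e5, hI.id_out p hp (by omega), hid3]
  · rw [g3 p hp, e4 p hp, hI.high p hp]
  · rw [g4, e5, hI.id_high p hp, hid3]

end Round

/-! ### The sequence of rounds -/

/-- The first `m` elements are sorted stably, and the others are where they were.  `K` are the
original keys, and `s.id p` is the original position of the element at position `p`. -/
structure Prefix (K : ℕ → ℕ) (n m : ℕ) (s : St) : Prop where
  key : ∀ p < n, s.key p = K (s.id p)
  id_lt : ∀ p < m, s.id p < m
  id_high : ∀ p, m ≤ p → s.id p = p
  mono : ∀ a b, a < b → b < m → lexOrder n K (s.id a) < lexOrder n K (s.id b)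

/-- Choose the size of the chunk and the size of the arrays. -/
def chooseChunk (θ : ℕ) : Com :=
  .ite (.lt (♯.m >>> Ex.lit (θ + 3)) (♯.D + ♯.D)) .skip (.D ≔ ♯.D + ♯.D ;; .e ≔ ♯.e + 1) ;;
  .d ≔ ♯.n - ♯.m ;; .ite (.lt ♯.D ♯.d) (.d ≔ ♯.D) .skip

/-- Extend the sorted prefix until it is the whole sequence. -/
def rounds (θ : ℕ) : Com :=
  .loop (.lt ♯.m ♯.n) (chooseChunk θ ;; round θ ;; .m ≔ ♯.m + ♯.d)

/-- A bound for the time of an iteration, per element of the prefix. -/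
def iterationCost (θ : ℕ) : ℕ := roundCost θ + (chooseChunk θ).cost + 8

/-- A bound for the time of all rounds, per element. -/
def roundsCost (θ : ℕ) : ℕ := (3 * 2 ^ (θ + 4) + 2) * iterationCost θ + 4

section Rounds
variable {C : Cfg} {m d e : ℕ} {s s' : St} {K : ℕ → ℕ}

theorem Prefix.sorted {n : ℕ} (h : Prefix K n m s) (hmn : m ≤ n) (a b : ℕ) (hab : a < b)
    (hb : b < m) : s.key a ≤ s.key b := by
  have h1 := h.mono a b hab hb
  have ha := h.id_lt a (by omega)
  have hb' := h.id_lt b hb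
  rw [lexOrder, lexOrder, lex_lt_iff (by omega) (by omega)] at h1
  rw [h.key a (by omega), h.key b (by omega)]
  omega

/-- The chunk consists of elements that come after those of the prefix in the original
sequence, so that a merge by current positions is a stable one. -/
theorem Prefix.extend {n : ℕ} (h : Prefix K n m s) (hn : m + d ≤ n)
    {μ : ℕ → ℕ} (h1 : ∀ p < m + d, μ p < m + d)
    (h2 : ∀ a b, a < b → b < m + d →
      lexOrder (m + d) s.key (μ a) < lexOrder (m + d) s.key (μ b))
    (h3 : ∀ p < m + d, s'.key p = s.key (μ p) ∧ s'.id p = s.id (μ p))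
    (h4 : ∀ p, m + d ≤ p → s'.key p = s.key p ∧ s'.id p = s.id p) : Prefix K n (m + d) s' := by
  have hid : ∀ p < m + d, s.id p < m + d := by
    intro p hp
    by_cases hpm : p < m
    · have := h.id_lt p hpm; omega
    · rw [h.id_high p (by omega)]; exact hp
  refine ⟨fun p hp => ?_, fun p hp => ?_, fun p hp => ?_, fun a b hab hb => ?_⟩
  · by_cases hpm : p < m + d
    · rw [(h3 p hpm).1, (h3 p hpm).2]
      exact h.key _ (by have := h1 p hpm; omega)
    · rw [(h4 p (by omega)).1, (h4 p (by omega)).2]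
      exact h.key p hp
  · rw [(h3 p hp).2]
    exact hid _ (h1 p hp)
  · rw [(h4 p hp).2, h.id_high p (by omega)]
  · rw [(h3 a (by omega)).2, (h3 b hb).2]
    have ha' := h1 a (by omega)
    have hb' := h1 b hb
    have hia := hid _ ha'
    have hib := hid _ hb'
    have hlt := h2 a b hab hb
    rw [lexOrder, lexOrder, lex_lt_iff hb' ha', h.key _ (by omega), h.key _ (by omega)] at hlt
    rw [lexOrder, lexOrder, lex_lt_iff (by omega) (by omega)]
    rcases hlt with hlt | ⟨he, hlt⟩
    · exact .inl hlt
    · right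
      refine ⟨he, ?_⟩
      by_cases hbm : μ b < m
      · have := h.mono _ _ hlt hbm
        rw [lexOrder, lexOrder, lex_lt_iff (by omega) (by omega)] at this
        omega
      · rw [h.id_high (μ b) (by omega)]
        by_cases ham : μ a < m
        · have := h.id_lt _ ham; omega
        · rw [h.id_high (μ a) (by omega)]; exact hlt

/-- The size of the arrays is doubled at most once in a round.  This is enough to keep it
proportional to `m`, because `m` grows by at most `2 ^ e`. -/
theorem wp_chooseChunk (hE : Env C s) (hm : s.r .m = m) (hD : s.r .D = 2 ^ e) (he : s.r .e = e)
    (hmn : m ≤ C.n) (hlow : 2 ^ (C.θ + 3) * 2 ^ e ≤ m) (hhigh : m < 2 ^ (C.θ + 5) * 2 ^ e)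
    (hbase : C.base ≤ 2 ^ e) (hθ : C.θ + 3 < 2 ^ C.w) :
    Wp C.w C.n (chooseChunk C.θ) (fun s' => s'.key = s.key ∧ s'.id = s.id ∧
      ∃ d e, Ctx C m d e s' ∧ Sizes C m d e ∧ m < 2 ^ (C.θ + 4) * 2 ^ e ∧
        2 ^ (C.θ + 3) * 2 ^ e ≤ m ∧ (d = 2 ^ e ∨ m + d = C.n)) s := by
  have hw := C.w_pos
  have h8 : 2 ^ (C.θ + 3) = 8 * 2 ^ C.θ := by ring
  have hθ1 : 1 ≤ 2 ^ C.θ := Nat.one_le_two_pow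
  have hDm : 8 * 2 ^ e ≤ m := by
    refine le_trans ?_ hlow
    rw [h8]
    exact Nat.mul_le_mul_right _ (by omega)
  have hDw : 2 ^ e + 2 ^ e < 2 ^ C.w := C.pos_lt (by omega)
  have hew : e + 1 < 2 ^ C.w := by
    have : e < 2 ^ e := Nat.lt_two_pow_self
    exact C.pos_lt (by omega)
  refine Wp.seq_frame (Q := fun s' => s'.key = s.key ∧ s'.id = s.id ∧ ∃ e, s'.r .D = 2 ^ e ∧
    s'.r .e = e ∧ C.base ≤ 2 ^ e ∧ m < 2 ^ (C.θ + 4) * 2 ^ e ∧ 2 ^ (C.θ + 3) * 2 ^ e ≤ m) ?_ ?_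
  · refine ⟨by simp [hD, hDw, hθ], fun h => ?_, fun h => ?_⟩
    · refine ⟨rfl, rfl, e, hD, he, hbase, ?_, hlow⟩
      have h : m / 2 ^ (C.θ + 3) < 2 ^ e + 2 ^ e := by simpa [hm, hD] using h
      rw [Nat.div_lt_iff_lt_mul (by positivity)] at h
      rw [show 2 ^ (C.θ + 4) = 2 ^ (C.θ + 3) * 2 by ring]
      nlinarith
    · have h : ¬ m / 2 ^ (C.θ + 3) < 2 ^ e + 2 ^ e := by simpa [hm, hD] using h
      rw [Nat.div_lt_iff_lt_mul (by positivity), not_lt] at h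
      simp only [Wp, Ex.ok_add, Ex.ok_var, Ex.ok_one, Ex.eval_add, Ex.eval_var, Ex.eval_one,
        St.set_r, reduceCtorEq, if_false, if_true, true_and, hD, he, St.set_key, St.set_id]
      refine ⟨hDw, ⟨hw, hew⟩, e + 1, by ring, rfl, ?_, ?_, ?_⟩
      · rw [pow_succ]; omega
      · rw [show 2 ^ (C.θ + 4) * 2 ^ (e + 1) = 2 ^ (C.θ + 5) * 2 ^ e by ring]; exact hhigh
      · rw [show 2 ^ (C.θ + 3) * 2 ^ (e + 1) = (2 ^ e + 2 ^ e) * 2 ^ (C.θ + 3) by ring]; exact h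
  · rintro s1 ⟨a1, a2, e', a3, a4, a5, a6, a7⟩ f1
    have hE1 := hE.of_frame f1 (by simp [Com.KeepsEnv, Com.Assigns])
    have m1 : s1.r .m = m := by rw [f1 _ (by simp [Com.Assigns]), hm]
    have hsz : ∀ d, d ≤ 2 ^ e' → m + d ≤ C.n → Sizes C m d e' := by
      intro d hd hmd
      refine ⟨hmd, ?_, a5, hd⟩
      rw [h8] at a7
      have : 1 * 2 ^ e' ≤ 2 ^ C.θ * 2 ^ e' := Nat.mul_le_mul_right _ hθ1
      nlinarith
    simp only [Wp, Ex.ok_sub, Ex.ok_var, Ex.eval_sub, Ex.eval_var, hE1.n, m1, true_and,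
      Cond.ok_lt, Cond.holds_lt, St.set_r, reduceCtorEq, if_false, if_true, a3, St.set_key,
      St.set_id, a1, a2]
    refine ⟨hmn, fun h => ?_, fun h => ?_⟩
    · refine ⟨2 ^ e', e', ?_, hsz _ le_rfl (by omega), a6, a7, .inl rfl⟩
      exact ⟨(hE1.set _ (by simp)).set _ (by simp), by simpa using m1, by simp, by simpa using a3,
        by simpa using a4⟩
    · refine ⟨C.n - m, e', ?_, hsz _ (by omega) (by omega), a6, a7, .inr (by omega)⟩
      exact ⟨hE1.set _ (by simp), by simpa using m1, by simp, by simpa using a3,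
        by simpa using a4⟩

/-- A round that is not the last one extends the prefix by `d = 2 ^ e` elements, more than
`m / 2 ^ (θ + 4)`, so that its time is bounded by a constant multiple `W * d`; summed up, this
gives the bound `W * (n - m)` for the rounds after a prefix of `m` elements.  The last round, whose
chunk may be shorter, is bounded by `(n + 2) * R`. -/
theorem rounds_spec (hE : Env C s) (hm : s.r .m = m) (hD : s.r .D = 2 ^ e) (he : s.r .e = e)
    (hmn : m ≤ C.n) (hlow : 2 ^ (C.θ + 3) * 2 ^ e ≤ m) (hhigh : m < 2 ^ (C.θ + 5) * 2 ^ e)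
    (hbase : C.base ≤ 2 ^ e) (hθ : C.θ + 3 < 2 ^ C.w) (hK : ∀ p < C.n, K p < 2 ^ (C.lob + C.q + 1))
    (hP : Prefix K C.n m s) :
    Spec C.w C.n (rounds C.θ) s ((C.n + 1) * roundsCost C.θ) (Prefix K C.n C.n) := by
  set R := iterationCost C.θ with hR
  set W := 3 * 2 ^ (C.θ + 4) * R with hW
  have hle : (if m < C.n then W * (C.n - m) + (C.n + 2) * R else 0) + (2 + 2) ≤
      (C.n + 1) * roundsCost C.θ := by
    rw [roundsCost, ← hR]
    split_ifs
    · have : W * (C.n - m) ≤ W * C.n := Nat.mul_le_mul_left _ (Nat.sub_le _ _)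
      rw [show (3 * 2 ^ (C.θ + 4) + 2) * R = W + 2 * R by rw [hW]; ring]
      nlinarith
    · nlinarith
  refine (Spec.loop_time (fun N s' => ∃ m e, Env C s' ∧ s'.r .m = m ∧ s'.r .D = 2 ^ e ∧
    s'.r .e = e ∧ m ≤ C.n ∧ 2 ^ (C.θ + 3) * 2 ^ e ≤ m ∧ m < 2 ^ (C.θ + 5) * 2 ^ e ∧
    C.base ≤ 2 ^ e ∧ Prefix K C.n m s' ∧
    N = if m < C.n then W * (C.n - m) + (C.n + 2) * R else 0) ?_
    ⟨m, e, hE, hm, hD, he, hmn, hlow, hhigh, hbase, hP, rfl⟩).mono hle ?_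
  · rintro N s1 ⟨m, e, hE, hm, hD, he, hmn, hlow, hhigh, hbase, hP, rfl⟩ -
    refine ⟨by simp, fun hlt => ?_⟩
    have hlt : m < C.n := by simpa [hm, hE.n] using hlt
    rw [if_pos hlt]
    refine ⟨(chooseChunk C.θ).cost + ((m + 2) * roundCost C.θ + 4), ?_, Spec.seq_frame
      (wp_chooseChunk hE hm hD he hmn hlow hhigh hbase hθ).spec ?_⟩
    · have : (chooseChunk C.θ).cost + ((m + 2) * roundCost C.θ + 4) + (2 + 2) ≤ (m + 2) * R := by
        rw [hR, iterationCost]; nlinarith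
      have : (m + 2) * R ≤ (C.n + 2) * R := Nat.mul_le_mul_right _ (by omega)
      simp only [Cond.len, Ex.len]
      omega
    · rintro s2 ⟨a1, a2, d, e, a3, a4, a5, a6, a7⟩ -
      have hPd : Prefix K C.n m s2 := by
        refine ⟨?_, ?_, ?_, ?_⟩ <;> simp only [a1, a2]
        exacts [hP.key, hP.id_lt, hP.id_high, hP.mono]
      have hle := a4.le_n
      refine Spec.seq ((round_spec a3 a4 ?_ (hPd.sorted hmn)).mono le_rfl ?_)
      · intro p hp
        rw [hPd.key p hp]
        refine hK _ ?_
        by_cases hpm : p < m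
        · have := hPd.id_lt p hpm; omega
        · rw [hPd.id_high p (by omega)]; exact hp
      · rintro s3 ⟨b1, ⟨μ, b2, b3, b4⟩, b5⟩
        have hP3 := hPd.extend hle b2 b3 b4 b5
        refine Wp.spec (c := _ ≔ _) ⟨?_, ?_⟩
        · simp [b1.m, b1.d]; exact C.pos_lt (by omega)
        simp only [Ex.eval_add, Ex.eval_var, b1.m, b1.d]
        refine ⟨_, ?_, m + d, e, b1.toEnv.set _ (by simp), by simp, by simpa using b1.D,
          by simpa using b1.e, hle, by omega, ?_, a4.base_le, ?_, rfl⟩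
        · have h1 : (chooseChunk C.θ).cost + ((m + 2) * roundCost C.θ + 4) + (2 + 2) ≤
              (m + 2) * R := by
            rw [hR, iterationCost]; nlinarith
          simp only [Cond.len, Ex.len]
          split_ifs with hlast
          · have hd : d = 2 ^ e := by omega
            have hm8 : 1 ≤ m := by
              have : 0 < 2 ^ (C.θ + 3) * 2 ^ e := by positivity
              omega
            have h2 : (m + 2) * R ≤ W * d := by
              rw [hW, hd, show 3 * 2 ^ (C.θ + 4) * R * 2 ^ e = 3 * (2 ^ (C.θ + 4) * 2 ^ e) * R by
                ring]
              exact Nat.mul_le_mul_right _ (by omega)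
            have h3 : W * (C.n - m) = W * d + W * (C.n - (m + d)) := by
              rw [← Nat.mul_add]; congr 1; omega
            omega
          · have : (m + 2) * R ≤ (C.n + 2) * R := Nat.mul_le_mul_right _ (by omega)
            omega
        · have hd := a4.d_le
          rw [show 2 ^ (C.θ + 5) = 2 ^ (C.θ + 4) * 2 by ring]
          have : 1 * 2 ^ e ≤ 2 ^ (C.θ + 4) * 2 ^ e := Nat.mul_le_mul_right _ Nat.one_le_two_pow
          nlinarith
        · exact ⟨hP3.key, hP3.id_lt, hP3.id_high, hP3.mono⟩
  · rintro s' ⟨⟨N, ⟨m, e, hE, hm, -, -, hmn, -, -, -, hP, -⟩, hnot⟩, -⟩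
    have : m = C.n := by
      simp [hm, hE.n] at hnot; omega
    rwa [this] at hP

end Rounds

/-! ### The first prefix -/

/-- Compute the number of bits of the variable `y`. -/
def bits (y x : Var) : Com :=
  .t ≔ ♯y ;; x ≔ 0 ;; .loop (.lt 0 ♯.t) (.t ≔ ♯.t >>> (1 : Ex) ;; x ≔ ♯x + 1)

/-- Compare the neighbours at the positions `t` and `t + 1`, and exchange them if necessary. -/
def insertBody : Com :=
  .read .x ♯.t ;; .jj ≔ ♯.t + 1 ;; .read .y ♯.jj ;; .ite (.lt ♯.y ♯.x) (.exch ♯.t ♯.jj) .skip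

/-- Sort the first `m` elements by insertion. -/
def insertion : Com := forUp .i .m (.t ≔ ♯.i ;; forDown .t insertBody)

/-- Take the key at position `i` into account for the maximum. -/
def maximumBody : Com := .read .x ♯.i ;; .ite (.lt ♯.mx ♯.x) (.mx ≔ ♯.x) .skip

/-- The maximum of the keys and of the number of elements. -/
def maximum : Com := .mx ≔ ♯.n ;; forUp .i .n maximumBody

@[simp] theorem bits_assigns (y x z : Var) : (bits y x).Assigns z ↔ z = .t ∨ z = x := by
  simp only [bits, Com.Assigns]; tauto

theorem size_half {t : ℕ} (ht : 0 < t) : (t / 2).size + 1 = t.size := by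
  refine le_antisymm ?_ ?_
  · have h1 : t < 2 ^ t.size := Nat.lt_size_self t
    have h2 : 0 < t.size := Nat.size_pos.mpr ht
    have h3 : (t / 2).size ≤ t.size - 1 := by
      rw [Nat.size_le, Nat.div_lt_iff_lt_mul (by omega), ← pow_succ]
      rwa [Nat.sub_add_cancel h2]
    omega
  · rw [Nat.size_le, pow_succ, ← Nat.div_lt_iff_lt_mul (by omega)]
    exact Nat.lt_size_self _

theorem bits_spec {w n N : ℕ} {s : St} {x y : Var} (hx : x ≠ .t) (hN : s.r y = N)
    (hNw : N < 2 ^ w) (hw : 0 < w) :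
    Spec w n (bits y x) s ((N.size + 2) * 15) fun s' =>
      s'.key = s.key ∧ s'.id = s.id ∧ s'.r x = N.size := by
  have hsz : N.size ≤ w := Nat.size_le.mpr hNw
  have hww : w < 2 ^ w := Nat.lt_two_pow_self
  refine Spec.seq (T := 2) (T' := 2 + (N.size + 1) * (8 + 2 + 2))
    (Wp.spec (c := _ ≔ _) ⟨by simp, ?_⟩)
    |>.mono (by omega) fun _ h => h
  refine Spec.seq (T := 2) (Wp.spec (c := _ ≔ _) ⟨by simp, ?_⟩)
  refine (Spec.loop_count (T := 8) (N := N.size) (fun k s' => s'.key = s.key ∧ s'.id = s.id ∧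
    (s'.r .t).size = k ∧ k + s'.r x = N.size) ?_ ?_).mono le_rfl ?_
  · rintro k s' ⟨a1, a2, a3, a4⟩ -
    refine ⟨by simp, fun h => ?_⟩
    have h : 0 < s'.r .t := by simpa using h
    have hh := size_half h
    refine Wp.spec (c := _ ;; _) (Q := fun s'' => ∃ N', N' < k ∧ s''.key = s.key ∧ s''.id = s.id ∧
      (s''.r .t).size = N' ∧ N' + s''.r x = N.size) ?_ |>.mono (le_of_eq rfl) fun _ h => h
    simp [Wp, hw, hx, hx.symm, a1, a2]
    omega
  · simp [hN, hx.symm]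
  · rintro s' ⟨⟨k, ⟨a1, a2, a3, a4⟩, hnot⟩, -⟩
    have : s'.r .t = 0 := by simpa using hnot
    rw [this, Nat.size_zero] at a3
    exact ⟨a1, a2, by omega⟩

/-- The state of the insertion sort: the first `m` elements are sorted, except that the one at
position `c` may be too small for its place. -/
structure Inserting (K : ℕ → ℕ) (n m c : ℕ) (s : St) : Prop where
  key : ∀ p < n, s.key p = K (s.id p)
  stable : ∀ a b, a < b → K (s.id a) = K (s.id b) → s.id a < s.id b
  id_lt : ∀ p < m, s.id p < m
  id_high : ∀ p, m ≤ p → s.id p = p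
  sorted : ∀ a b, a < b → b < m → b ≠ c → K (s.id a) ≤ K (s.id b)

section Insertion
variable {K : ℕ → ℕ} {w n m c : ℕ} {s : St}

theorem Inserting.prefix (h : Inserting K n m 0 s) (hmn : m ≤ n) : Prefix K n m s := by
  refine ⟨h.key, h.id_lt, h.id_high, fun a b hab hb => ?_⟩
  have h1 := h.sorted a b hab hb (by omega)
  have h2 := h.stable a b hab
  have h3 := h.id_lt a (by omega)
  have h4 := h.id_lt b hb
  rw [lexOrder, lexOrder, lex_lt_iff (by omega) (by omega)]
  omega

theorem Inserting.congr {s' : St} (h : Inserting K n m c s) (h1 : s'.key = s.key)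
    (h2 : s'.id = s.id) : Inserting K n m c s' := by
  refine ⟨?_, ?_, ?_, ?_, ?_⟩ <;> simp only [h1, h2]
  exacts [h.key, h.stable, h.id_lt, h.id_high, h.sorted]

theorem Inserting.keep (h : Inserting K n m (c + 1) s) (hcm : c + 1 < m)
    (hle : K (s.id c) ≤ K (s.id (c + 1))) : Inserting K n m c s := by
  refine ⟨h.key, h.stable, h.id_lt, h.id_high, fun a b hab hb hbc => ?_⟩
  by_cases hb' : b = c + 1
  · subst hb'
    by_cases ha : a = c
    · rw [ha]; exact hle
    · exact (h.sorted a c (by omega) (by omega) (by omega)).trans hle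
  · exact h.sorted a b hab hb hb'

theorem Inserting.exchange (h : Inserting K n m (c + 1) s) (hcm : c + 1 < m) (hmn : m ≤ n)
    (hlt : K (s.id (c + 1)) < K (s.id c)) :
    Inserting K n m c ((s.setKey (s.key ∘ Equiv.swap c (c + 1))).setId
      (s.id ∘ Equiv.swap c (c + 1))) := by
  have hsw : ∀ p, Equiv.swap c (c + 1) p = if p = c then c + 1 else if p = c + 1 then c else p :=
    fun p => Equiv.swap_apply_def ..
  refine ⟨fun p hp => ?_, fun a b hab he => ?_, fun p hp => ?_, fun p hp => ?_,
    fun a b hab hb hbc => ?_⟩ <;>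
    simp only [St.setId_id, St.setId_key, St.setKey_key, Function.comp] at *
  · refine h.key _ ?_
    rw [hsw]; split_ifs <;> omega
  · rw [hsw, hsw] at *
    have := h.stable
    split_ifs at he ⊢ <;> first | omega | (apply h.stable _ _ (by omega) he)
  · refine h.id_lt _ ?_
    rw [hsw]; split_ifs <;> omega
  · rw [hsw, if_neg (by omega), if_neg (by omega), h.id_high p hp]
  · rw [hsw, hsw]
    split_ifs <;> first | omega | (apply h.sorted _ _ (by omega) (by omega) (by omega))

theorem wp_insertBody (hn : n < 2 ^ w) (hw : 0 < w) (h : Inserting K n m (c + 1) s)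
    (hcm : c + 1 < m) (hmn : m ≤ n) (ht : s.r .t = c) :
    Wp w n insertBody (Inserting K n m c) s := by
  have h1 := h.key c (by omega)
  have h2 := h.key (c + 1) (by omega)
  simp only [insertBody, Wp, Ex.ok_var, Ex.eval_var, ht, St.set_r, reduceCtorEq, if_false, if_true,
    true_and, Ex.ok_add, Ex.ok_one, Ex.eval_add, Ex.eval_one, Cond.ok_lt, Cond.holds_lt, St.set_key,
    h1, h2, St.set_id]
  refine ⟨by omega, ⟨hw, by omega⟩, by omega, fun hlt => ?_, fun hlt => ?_⟩
  · exact ⟨by omega, by omega, (h.exchange hcm hmn hlt).congr rfl rfl⟩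
  · exact (h.keep hcm (by omega)).congr rfl rfl

theorem insertion_spec (hn : n < 2 ^ w) (hw : 0 < w) (hm : s.r .m = m) (hmn : m ≤ n)
    (hkey : ∀ p < n, s.key p = K p) (hid : ∀ p, s.id p = p) :
    Spec w n insertion s ((m + 2) ^ 2 * (insertBody.cost + 18)) (Prefix K n m) := by
  refine (Spec.for_up (T := 2 + (m + 2) * (insertBody.cost + 8)) (fun k s' => Inserting K n k 0 s')
    hm (by omega) (by simp) (by simp [insertBody, Com.Assigns]) (by simp [insertBody, Com.Assigns])
    ?_ ?_).mono ?_ fun s' h => h.prefix hmn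
  · refine ⟨?_, ?_, ?_, ?_, ?_⟩ <;> simp [hid]
    · exact hkey
    · exact fun a b hab _ => hab
  · rintro k hk s' hI hi -
    refine Spec.seq (T := 2) (Wp.spec (c := _ ≔ _) ⟨by simp, ?_⟩)
    refine (Spec.for_down (T := insertBody.cost) (B := k) (Inserting K n (k + 1))
      (by simpa using hi) hw (by simp [insertBody, Com.Assigns]) ?_ ?_).mono
      (Nat.mul_le_mul_right _ (by omega)) fun s'' h => h.congr rfl rfl
    · have : Inserting K n (k + 1) k s' := by
        refine ⟨hI.key, hI.stable, fun p hp => ?_, fun p hp => hI.id_high p (by omega),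
          fun a b hab hb hbk => hI.sorted a b hab (by omega) (by omega)⟩
        rcases (show p < k ∨ p = k by omega) with hp | rfl
        · exact (hI.id_lt p hp).trans (by omega)
        · rw [hI.id_high _ le_rfl]; omega
      exact this.congr rfl rfl
    · intro c hc t ht _ _
      exact (wp_insertBody (s := t.set .t c) hn hw (ht.congr rfl rfl) (by omega) (by omega)
        (by simp)).spec
  · have : 2 + (m + 2) * (insertBody.cost + 8) + 8 ≤ (m + 2) * (insertBody.cost + 18) := by
      nlinarith
    calc _ ≤ (m + 2) * ((m + 2) * (insertBody.cost + 18)) := Nat.mul_le_mul_left _ this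
      _ = _ := by ring

theorem maximum_spec (hn : n < 2 ^ w) (hnr : s.r .n = n) :
    Spec w n maximum s (2 + (n + 2) * (maximumBody.cost + 8)) fun s' => s'.key = s.key ∧
      s'.id = s.id ∧ n ≤ s'.r .mx ∧ (∀ p < n, s.key p ≤ s'.r .mx) ∧
      ∀ B, n ≤ B → (∀ p < n, s.key p ≤ B) → s'.r .mx ≤ B := by
  refine Spec.seq (T := 2) (Wp.spec (c := _ ≔ _) ⟨by simp, ?_⟩)
  simp only [Ex.eval_var, hnr]
  refine (Spec.for_up (T := maximumBody.cost) (B := n) (fun k s' => s'.key = s.key ∧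
      s'.id = s.id ∧ n ≤ s'.r .mx ∧ (∀ p < k, s.key p ≤ s'.r .mx) ∧
      ∀ B, n ≤ B → (∀ p < k, s.key p ≤ B) → s'.r .mx ≤ B)
    (by simpa using hnr) hn (by simp) (by simp [maximumBody, Com.Assigns])
    (by simp [maximumBody, Com.Assigns]) ?_ ?_).mono le_rfl fun s' h => h
  · simp
  · rintro k hk t ⟨a1, a2, a3, a4, a5⟩ hi -
    refine Wp.spec ?_
    simp only [maximumBody, Wp, Ex.ok_var, Ex.eval_var, hi, true_and, Cond.ok_lt, Cond.holds_lt,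
      St.set_r, reduceCtorEq, if_false, if_true, and_self, a1, St.set_key, St.set_id, a2]
    refine ⟨hk, fun h => ⟨by omega, fun p hp => ?_, fun B h1 h2 => h2 k (by omega)⟩,
      fun h => ⟨a3, fun p hp => ?_, fun B h1 h2 => a5 B h1 fun p hp => h2 p (by omega)⟩⟩
    · rcases (show p < k ∨ p = k by omega) with hp | rfl
      · exact (a4 p hp).trans h.le
      · exact le_rfl
    · rcases (show p < k ∨ p = k by omega) with hp | rfl
      · exact a4 p hp
      · omega

end Insertion

/-! ### The sorting program -/

/-- `halve k a` is the expression `a / 2 ^ k`.  It contains no constant greater than `1`, since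
`k` need not fit into a word when the sequence is short. -/
def halve : ℕ → Ex → Ex
  | 0, a => a
  | k + 1, a => halve k a >>> (1 : Ex)

theorem halve_eval (r : Var → ℕ) (k : ℕ) (a : Ex) : (halve k a).eval r = a.eval r / 2 ^ k := by
  induction k with
  | zero => simp [halve]
  | succ k ih => simp [halve, ih, Nat.div_div_eq_div_mul, pow_succ]

theorem halve_ok {w : ℕ} {r : Var → ℕ} {k : ℕ} {a : Ex} (hw : 0 < w) (ha : a.Ok w r) :
    (halve k a).Ok w r := by
  induction k with
  | zero => exact ha
  | succ k ih => exact ⟨ih, by simpa using hw⟩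

/-- Determine the length of the cells, and sort a first prefix, whose length is about the square
root of the number of elements. -/
def firstPrefix : Com :=
  bits .n .len ;; .q ≔ halve 2 ♯.len ;; .m ≔ (1 : Ex) <<< (♯.q + ♯.q) ;; insertion

/-- Compute the parameters that depend on the maximum of the keys. -/
def parameters (θ : ℕ) : Com :=
  .lob ≔ ♯.b - 1 - ♯.q ;; .bq ≔ ♯.lob + ♯.q ;; .half ≔ (1 : Ex) <<< ♯.q ;;
  .base ≔ ♯.half + ♯.half ;; .e ≔ ♯.q + ♯.q - Ex.lit (θ + 3) ;; .D ≔ (1 : Ex) <<< ♯.e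

/-- Sort the sequence.  Short sequences are sorted by insertion. -/
def sort (θ : ℕ) : Com :=
  .ite (.lt 0 ♯.n)
    (.ite (.eq (halve (4 * (θ + 4)) ♯.n) 0) (.m ≔ ♯.n ;; insertion)
      (maximum ;; firstPrefix ;; bits .mx .b ;; parameters θ ;; rounds θ))
    .skip

/-- A bound for the time of the insertion sort, in terms of the number of comparisons. -/
def insertionCost : ℕ := insertBody.cost + 18

/-- A bound for the time of sorting, per element, for keys that are at most `n ^ c`. -/
def sortCost (θ c : ℕ) : ℕ :=
  (Cond.lt 0 ♯.n).len + (Cond.eq (halve (4 * (θ + 4)) ♯.n) 0).len + 4 +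
  (2 + 9 * 2 ^ (4 * (θ + 4)) * insertionCost) +
  (45 + 12 + 18 * insertionCost + (2 + 2 * (maximumBody.cost + 8)) + 15 * (c + 2) +
    (parameters θ).cost + roundsCost θ)

section Sorting
variable {K : ℕ → ℕ} {w n m θ : ℕ} {s : St}

theorem Prefix.congr {s' : St} (h : Prefix K n m s) (h1 : s'.key = s.key) (h2 : s'.id = s.id) :
    Prefix K n m s' := by
  refine ⟨?_, ?_, ?_, ?_⟩ <;> simp only [h1, h2]
  exacts [h.key, h.id_lt, h.id_high, h.mono]

theorem size_le_self (n : ℕ) : n.size ≤ n := Nat.size_le.mpr Nat.lt_two_pow_self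

/-- The length of the cells is about a quarter of the number of bits of `n`, so that the square of
the length of the first prefix is linear in `n`. -/
theorem firstPrefix_spec (hn : n < 2 ^ w) (hnr : s.r .n = n) (hq : 0 < n.size / 4)
    (hkey : ∀ p < n, s.key p = K p) (hid : ∀ p, s.id p = p) :
    Spec w n firstPrefix s ((45 + 12 + 18 * insertionCost) * (n + 1)) fun s' =>
      Prefix K n (2 ^ (2 * (n.size / 4))) s' ∧ 2 ^ (2 * (n.size / 4)) ≤ n ∧
      s'.r .q = n.size / 4 ∧ s'.r .m = 2 ^ (2 * (n.size / 4)) ∧ s'.r .n = n := by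
  have hsn : n.size ≤ n := size_le_self n
  have hw : 0 < w := by
    by_contra h
    have : w = 0 := by omega
    subst this
    have : n = 0 := by simpa using hn
    subst this
    simp at hq
  have hlow : 2 ^ (n.size - 1) ≤ n := Nat.lt_size.mp (by omega)
  obtain ⟨q, hqdef⟩ : ∃ q, q = n.size / 4 := ⟨_, rfl⟩
  rw [← hqdef] at hq ⊢
  -- As `4 * q ≤ n.size`, the square of the length of the first prefix is at most `2 * n`.
  have hmn : 2 ^ (2 * q) ≤ n := (Nat.pow_le_pow_right (by omega) (by omega)).trans hlow
  have hsq : (2 ^ (2 * q)) ^ 2 ≤ 2 * n := by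
    rw [← pow_mul]
    calc 2 ^ (2 * q * 2) ≤ 2 ^ (n.size - 1 + 1) := Nat.pow_le_pow_right (by omega) (by omega)
      _ = 2 * 2 ^ (n.size - 1) := by ring
      _ ≤ _ := by omega
  have hm1 : 1 ≤ 2 ^ (2 * q) := Nat.one_le_two_pow
  have htime : (2 ^ (2 * q) + 2) ^ 2 ≤ 18 * n := by nlinarith
  have hqq : q + q < 2 ^ w := by omega
  refine (Spec.seq_frame (bits_spec (by simp) hnr hn hw) ?_).mono
    (T := (n.size + 2) * 15 + (6 + (6 + ((2 ^ (2 * q) + 2) ^ 2 * insertionCost)))) ?_ fun _ h => h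
  swap
  · have := Nat.mul_le_mul_right insertionCost htime
    nlinarith
  rintro s1 ⟨a1, a2, a3⟩ f1
  have n1 : s1.r .n = n := (f1 _ (by simp)).trans hnr
  refine Spec.seq_frame (T := 6) (Q := fun s' => s'.key = s.key ∧ s'.id = s.id ∧ s'.r .q = q)
    (Wp.spec (c := _ ≔ _) ⟨halve_ok hw (by simp), ?_⟩) ?_
  · simp [halve_eval, a1, a2, a3, hqdef]
  rintro s2 ⟨b1, b2, b3⟩ f2
  have n2 : s2.r .n = n := (f2 _ (by simp [Com.Assigns])).trans n1
  refine Spec.seq_frame (T := 6) (Q := fun s' => s'.key = s.key ∧ s'.id = s.id ∧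
      s'.r .m = 2 ^ (2 * q)) (Wp.spec (c := _ ≔ _) ⟨?_, ?_⟩) ?_
  · simp [b3, hw, hqq]
    rw [← two_mul]; omega
  · simp [b3, b1, b2, two_mul]
  rintro s3 ⟨c1, c2, c3⟩ f3
  have n3 : s3.r .n = n := (f3 _ (by simp [Com.Assigns])).trans n2
  have q3 : s3.r .q = q := (f3 _ (by simp [Com.Assigns])).trans b3
  refine (insertion_spec hn hw c3 hmn (by rwa [c1]) (by rwa [c2])).frame.mono le_rfl ?_
  rintro s4 ⟨hP, f4⟩
  refine ⟨hP, hmn, (f4 _ ?_).trans q3, (f4 _ ?_).trans c3, (f4 _ ?_).trans n3⟩ <;>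
    simp [insertion, insertBody, Com.Assigns]

theorem wp_parameters (C : Cfg) (hn : s.r .n = C.n) (hb : s.r .b = C.lob + C.q + 1)
    (hq : s.r .q = C.q) (hθq : C.θ + 4 ≤ C.q) (hqn : 2 ^ (2 * C.q) ≤ C.n) (hm : s.r .m = m) :
    Wp C.w C.n (parameters C.θ) (fun s' => Env C s' ∧ s'.key = s.key ∧ s'.id = s.id ∧
      s'.r .m = m ∧ s'.r .e = 2 * C.q - (C.θ + 3) ∧ s'.r .D = 2 ^ (2 * C.q - (C.θ + 3))) s := by
  have hw := C.w_pos
  have hbw := C.word_lt (show C.lob + C.q + 1 < 2 ^ (C.lob + C.q + 1) from Nat.lt_two_pow_self)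
  have h1 : 2 ^ (C.q + 1) ≤ C.n :=
    (Nat.pow_le_pow_right (by omega) (by have := C.q_pos; omega)).trans hqn
  have h2 : 2 ^ C.q + 2 ^ C.q < 2 ^ C.w := C.pos_lt (by rw [pow_succ] at h1; omega)
  have h3 : 2 ^ (C.q + C.q - (C.θ + 3)) < 2 ^ C.w :=
    C.pos_lt ((Nat.pow_le_pow_right (by omega) (by omega)).trans hqn)
  have h4 : C.q + C.q < 2 ^ C.w := C.pos_lt (by
    have := (Nat.lt_two_pow_self (n := 2 * C.q)).le.trans hqn; omega)
  simp only [parameters, Wp, Ex.ok_add, Ex.ok_sub, Ex.ok_shl, Ex.ok_var, Ex.ok_one, Ex.ok_lit,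
    Ex.eval_add, Ex.eval_sub, Ex.eval_shl, Ex.eval_var, Ex.eval_one, Ex.eval_lit, St.set_r,
    reduceCtorEq, if_false, if_true, true_and, hb, hq, Nat.add_sub_cancel, St.set_key, St.set_id,
    one_mul, hm, hw]
  refine ⟨⟨by omega, by omega⟩, by omega, by omega, h2, ⟨h4, by omega, by omega⟩, h3, ?_, ?_, ?_⟩
  · constructor <;> simp [hn, hq, hb, Cfg.base, two_mul]
  · rw [two_mul]
  · rw [two_mul]

/-- The sort of a long sequence. -/
theorem sortLong_spec {c : ℕ} (hc : 1 ≤ c) (hθ : 8 * c ≤ 2 ^ θ) (hn : n < 2 ^ w) (hnr : s.r .n = n)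
    (hlong : 2 ^ (4 * (θ + 4)) ≤ n) (hKw : ∀ p < n, K p < 2 ^ w) (hKc : ∀ p < n, K p ≤ n ^ c)
    (hkey : ∀ p < n, s.key p = K p) (hid : ∀ p, s.id p = p) :
    Spec w n (maximum ;; firstPrefix ;; bits .mx .b ;; parameters θ ;; rounds θ) s
      ((2 + (n + 2) * (maximumBody.cost + 8)) + ((45 + 12 + 18 * insertionCost) * (n + 1) +
        ((c * n.size + 2) * 15 + ((parameters θ).cost + (n + 1) * roundsCost θ))))
      (Prefix K n n) := by
  have hsz : 4 * (θ + 4) < n.size := Nat.lt_size.mpr hlong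
  obtain ⟨q, hqdef⟩ : ∃ q, q = n.size / 4 := ⟨_, rfl⟩
  have hqθ : θ + 4 ≤ q := by omega
  have hww : w < 2 ^ w := Nat.lt_two_pow_self
  have hnw : n.size ≤ w := Nat.size_le.mpr hn
  refine Spec.seq_frame (maximum_spec hn hnr) ?_
  rintro s1 ⟨a1, a2, a3, a4, a5⟩ f1
  have n1 : s1.r .n = n := (f1 _ (by simp [maximum, maximumBody, Com.Assigns])).trans hnr
  obtain ⟨M, hM⟩ : ∃ M, M = s1.r .mx := ⟨_, rfl⟩
  rw [← hM] at a3 a4 a5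
  have hKM : ∀ p < n, K p ≤ M := fun p hp => by rw [← hkey p hp]; exact a4 p hp
  have hMw : M < 2 ^ w := by
    have := a5 (2 ^ w - 1) (by omega) fun p hp => by
      rw [hkey p hp]; have := hKw p hp; omega
    omega
  have hMc : M ≤ n ^ c := a5 _ (Nat.le_self_pow (by omega) n) fun p hp => by
    rw [hkey p hp]; exact hKc p hp
  have hMsize : M.size ≤ c * n.size := by
    rw [Nat.size_le]
    calc M ≤ n ^ c := hMc
      _ < (2 ^ n.size) ^ c := Nat.pow_lt_pow_left (Nat.lt_size_self n) (by omega)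
      _ = _ := by rw [← pow_mul, mul_comm]
  have hnM : n.size ≤ M.size := Nat.size_le_size a3
  have hMwsize : M.size ≤ w := Nat.size_le.mpr hMw
  refine Spec.seq_frame (firstPrefix_spec (K := K) hn n1 (by omega) (by rwa [a1])
    (by rwa [a2])) ?_
  rintro s2 ⟨hP, hmn, q2, m2, n2⟩ f2
  rw [← hqdef] at hP hmn q2 m2
  have x2 : s2.r .mx = M :=
    (f2 _ (by simp [firstPrefix, insertion, insertBody, Com.Assigns])).trans hM.symm
  refine Spec.seq_frame ((bits_spec (x := .b) (by simp) x2 hMw (by omega)).mono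
    (Nat.mul_le_mul_right _ (by omega)) fun _ h => h) ?_
  rintro s3 ⟨b1, b2, b3⟩ f3
  have q3 : s3.r .q = q := (f3 _ (by simp)).trans q2
  have m3 : s3.r .m = 2 ^ (2 * q) := (f3 _ (by simp)).trans m2
  have n3 : s3.r .n = n := (f3 _ (by simp)).trans n2
  -- The significant bits are those of the maximum `M`, which is at least `n` and at most `n ^ c`.
  obtain ⟨C, hCw, hCn, hCq, hCb, hCθ⟩ : ∃ C : Cfg, C.w = w ∧ C.n = n ∧ C.q = q ∧
      C.lob + C.q + 1 = M.size ∧ C.θ = θ := by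
    have hb : M.size - 1 - q + q + 1 = M.size := by omega
    refine ⟨⟨w, n, q, M.size - 1 - q, θ, hn, by omega, by omega, ?_, by omega, ?_⟩,
      rfl, rfl, rfl, hb, rfl⟩
    · rw [hb]
      have h1 : c * n.size ≤ c * (8 * q) := Nat.mul_le_mul_left _ (by omega)
      have h2 : q * (8 * c) ≤ q * 2 ^ θ := Nat.mul_le_mul_left _ hθ
      have h3 : c * (8 * q) = q * (8 * c) := by ring
      omega
    · rw [hb]
      exact a3.trans_lt (Nat.lt_size_self M)
  subst hCw hCn hCq hCθ
  refine Spec.seq ((wp_parameters C n3 (by rw [b3, hCb]) q3 hqθ hmn m3).spec.mono le_rfl ?_)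
  rintro s4 ⟨c1, c2, c3, c4, c5, c6⟩
  have hpow : C.θ + 3 + (2 * C.q - (C.θ + 3)) = 2 * C.q := by omega
  have hθw : C.θ + 3 < 2 ^ C.w := by omega
  refine rounds_spec (K := K) c1 c4 c6 c5 hmn ?_ ?_ ?_ hθw (fun p hp => ?_)
    (hP.congr (c2.trans b1) (c3.trans b2))
  · rw [← pow_add, hpow]
  · rw [← pow_add]
    exact Nat.pow_lt_pow_right (by omega) (by omega)
  · rw [Cfg.base, ← pow_succ']
    exact Nat.pow_le_pow_right (by omega) (by omega)
  · rw [hCb]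
    exact (hKM p hp).trans_lt (Nat.lt_size_self M)

theorem sort_spec {c : ℕ} (hc : 1 ≤ c) (hθ : 8 * c ≤ 2 ^ θ) (hn : n < 2 ^ w) (hnr : s.r .n = n)
    (hKw : ∀ p < n, K p < 2 ^ w) (hKc : ∀ p < n, K p ≤ n ^ c)
    (hkey : ∀ p < n, s.key p = K p) (hid : ∀ p, s.id p = p) :
    Spec w n (sort θ) s (sortCost θ c * (n + 1)) (Prefix K n n) := by
  have hP0 : Prefix K n 0 s := by
    refine ⟨fun p hp => by rw [hid, hkey p hp], ?_, fun p _ => hid p, ?_⟩ <;> intros <;> omega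
  obtain ⟨X, hX⟩ : ∃ X, X = 2 + 9 * 2 ^ (4 * (θ + 4)) * insertionCost := ⟨_, rfl⟩
  obtain ⟨Y, hY⟩ : ∃ Y, Y = 45 + 12 + 18 * insertionCost + (2 + 2 * (maximumBody.cost + 8)) +
    15 * (c + 2) + (parameters θ).cost + roundsCost θ := ⟨_, rfl⟩
  refine (Spec.ite (T := (Cond.eq (halve (4 * (θ + 4)) ♯.n) 0).len + 2 + (X + Y) * (n + 1))
    (by simp) (fun hn0 => ?_) (fun hn0 => ?_)).mono ?_ fun _ h => h
  rotate_left
  · have hn0 : n = 0 := by simpa [hnr] using hn0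
    subst hn0
    exact Spec.mono (T := 0) ⟨0, s, .skip s, le_rfl, hP0⟩ (Nat.zero_le _) fun _ h => h
  · rw [sortCost, ← hX, ← hY]
    nlinarith
  have hn0 : 0 < n := by simpa [hnr] using hn0
  have hw : 0 < w := by
    by_contra h
    have : w = 0 := by omega
    subst this
    omega
  refine Spec.ite (T := (X + Y) * (n + 1)) ⟨halve_ok hw (by simp), by simp⟩ (fun hs => ?_)
    (fun hs => ?_)
  · have hs : n / 2 ^ (4 * (θ + 4)) = 0 := by simpa only [Cond.holds_eq, halve_eval,
      Ex.eval_var, hnr, Ex.eval_zero] using hs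
    have hs := (Nat.div_eq_zero_iff_lt (by positivity)).mp hs
    refine (Spec.seq (T := 2) (Wp.spec (c := _ ≔ _) ⟨by simp, ?_⟩)).mono
      (T := 2 + (n + 2) ^ 2 * insertionCost) ?_ fun _ h => h
    · exact insertion_spec hn hw (by simpa using hnr) le_rfl (by simpa using hkey)
        (by simpa using hid)
    · -- The sequence is shorter than a constant, so quadratic time is linear time.
      have h1 : (n + 2) ^ 2 ≤ 9 * 2 ^ (4 * (θ + 4)) * n := by nlinarith
      have h2 := Nat.mul_le_mul_right insertionCost h1
      have h3 : 2 + (n + 2) ^ 2 * insertionCost ≤ X * (n + 1) := by rw [hX]; nlinarith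
      exact h3.trans (Nat.mul_le_mul_right _ (by omega))
  · have hs : ¬ n / 2 ^ (4 * (θ + 4)) = 0 := by simpa only [Cond.holds_eq, halve_eval,
      Ex.eval_var, hnr, Ex.eval_zero] using hs
    rw [Nat.div_eq_zero_iff_lt (by positivity), not_lt] at hs
    refine (sortLong_spec hc hθ hn hnr hs hKw hKc hkey hid).mono ?_ fun _ h => h
    have h1 : c * n.size ≤ c * n := Nat.mul_le_mul_left _ (size_le_self n)
    have h2 : Y * (n + 1) ≤ (X + Y) * (n + 1) := Nat.mul_le_mul_right _ (by omega)
    refine le_trans ?_ h2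
    rw [hY]
    nlinarith

end Sorting

/-- The sorted state determines the permutation of the elements. -/
theorem Prefix.isStableSort {α : Type*} {k w n : ℕ} {S : Fin n → Elem w α} {s : St} {K : ℕ → ℕ}
    {T : State (k + 1) w n α} (hP : Prefix K n n s) (hK : ∀ p : Fin n, K p = (S p).key.toNat)
    (hT : Rel S s T) : IsStableSort S T.seq := by
  have hlt : ∀ i j : Fin n, i < j → K (s.id i) < K (s.id j) ∨
      K (s.id i) = K (s.id j) ∧ s.id i < s.id j := by
    intro i j hij
    have h1 := hP.mono i j hij j.isLt
    rwa [lexOrder, lexOrder, lex_lt_iff (hP.id_lt j j.isLt) (hP.id_lt i i.isLt)] at h1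
  have hinj : Function.Injective fun i : Fin n => (⟨s.id i, hP.id_lt i i.isLt⟩ : Fin n) := by
    intro i j hij
    have hij : s.id i = s.id j := by simpa using hij
    rcases lt_trichotomy i j with h | h | h
    · have := hlt i j h; rw [hij] at this; omega
    · exact h
    · have := hlt j i h; rw [hij] at this; omega
  have hkey : ∀ i : Fin n, (T.seq i).key.toNat = K (s.id i) := fun i => by
    rw [hT.key i, hP.key i i.isLt]
  refine ⟨Equiv.ofBijective _ (Finite.injective_iff_bijective.mp hinj), fun i => ?_,
    fun i j hij => ?_, fun i j hij he => ?_⟩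
  · obtain ⟨h, hd⟩ := hT.id i
    have hk : (T.seq i).key = (S ⟨s.id i, h⟩).key := by
      rw [← BitVec.toNat_inj, hkey, ← hK]
    show T.seq i = S ⟨s.id i, h⟩
    revert hd hk
    cases T.seq i
    cases S ⟨s.id i, h⟩
    rintro rfl rfl
    rfl
  · rw [hkey, hkey]
    have := hlt i j hij
    omega
  · rw [← BitVec.toNat_inj, hkey, hkey] at he
    have := hlt i j hij
    show s.id i < s.id j
    omega

end InPlaceSort

theorem mainTheorem1 (c : ℝ) (hc : 0 < c) :
    ∃ (k : ℕ) (P : InPlaceSort.Program k) (K : ℕ),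
      ∀ (α : Type*) (w n : ℕ) (S : Fin n → InPlaceSort.Elem w α),
        n < 2 ^ w →
        (∀ i, 1 ≤ (S i).key.toNat ∧ ((S i).key.toNat : ℝ) ≤ (n : ℝ) ^ c) →
        ∃ t ≤ K * (n + 1),
          InPlaceSort.Halted P (InPlaceSort.run P S t) ∧
          InPlaceSort.IsStableSort S (InPlaceSort.run P S t).seq := by
  obtain ⟨C, hcC, hC1⟩ : ∃ C : ℕ, c ≤ C ∧ 1 ≤ C :=
    ⟨⌈c⌉₊, Nat.le_ceil c, Nat.one_le_ceil_iff.mpr hc⟩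
  -- A virtual word of `2 ^ θ` cells has to be as long as a key, which has at most `C` times as many
  -- bits as `n`, while a cell has at least an eighth of the bits of `n`.  So `2 ^ θ ≥ 8 * C` is
  -- enough, and `θ = 8 * C` is a simple choice.
  obtain ⟨prog, T, hprog⟩ : ∃ (prog : InPlaceSort.Com) (T : ℕ), ∀ (w n : ℕ) (K : ℕ → ℕ)
      (s : InPlaceSort.St), n < 2 ^ w → s.r .n = n → (∀ p < n, K p < 2 ^ w) →
      (∀ p < n, K p ≤ n ^ C) → (∀ p < n, s.key p = K p) → (∀ p, s.id p = p) →
      InPlaceSort.Spec w n prog s (T * (n + 1)) (InPlaceSort.Prefix K n n) :=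
    ⟨_, _, fun w n K s h1 h2 h3 h4 h5 h6 => InPlaceSort.sort_spec hC1
      (Nat.lt_two_pow_self (n := 8 * C)).le h1 h2 h3 h4 h5 h6⟩
  refine ⟨InPlaceSort.numVars + prog.width + 1,
    .move (InPlaceSort.Var.reg _ .n) 0 :: prog.code _ 1, T + 1, fun α w n S hn hS => ?_⟩
  obtain ⟨K, hKS⟩ : ∃ K : ℕ → ℕ, ∀ p : Fin n, K p = (S p).key.toNat :=
    ⟨fun p => if h : p < n then (S ⟨p, h⟩).key.toNat else 0, fun p => by simp⟩
  have hKw : ∀ p < n, K p < 2 ^ w := fun p hp => by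
    rw [hKS ⟨p, hp⟩]
    exact BitVec.isLt _
  have hKc : ∀ p < n, K p ≤ n ^ C := fun p hp => by
    have h1 := (hS ⟨p, hp⟩).2
    have h2 : (1 : ℝ) ≤ n := by exact_mod_cast (show 1 ≤ n by omega)
    have h3 : (n : ℝ) ^ c ≤ (n : ℝ) ^ (C : ℝ) := Real.rpow_le_rpow_of_exponent_le h2 hcC
    rw [Real.rpow_natCast] at h3
    rw [hKS ⟨p, hp⟩]
    exact_mod_cast h1.trans h3
  obtain ⟨t, s', h1, h2, h3⟩ := hprog w n K ⟨fun x => if x = .n then n else 0, K, fun p => p⟩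
    hn rfl hKw hKc (fun _ _ => rfl) fun _ => rfl
  obtain ⟨h4, h5⟩ := h1.run S hn (fun _ => rfl) (fun p => (hKS p).symm) (fun _ => rfl) le_rfl
  exact ⟨t + 1, by nlinarith, h4, h3.isStableSort hKS h5⟩
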